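/- Plant and sensors. Let $m\ge 2$, $x(k+1)=Ax(k)+w(k)\in\mathbb R^n$ and $y_i(k)=C_ix(k)+v_i(k)\in\mathbb R$ for sensors $i=1,\dots,m$; write $y=Cx+v$ for the stacked measurements. The $w(k)\sim\mathcal N(0,Q)$ are i.i.d., the $v(k)\sim\mathcal N(0,R)$ are i.i.d., $x(0)\sim\mathcal N(0,\Sigma_0)$, with $Q,R,\Sigma_0\succeq0$, and $x(0)$, $\{w(k)\}$, $\{v(k)\}$ are mutually independent. Assume that $(A,C)$ is observable. Kalman filter. For a covariance $X$ put $K(X)=XC^T(CXC^T+R)^{-1}$ and $X^+=X-K(X)CX$. Let $P(0)=A\Sigma_0A^T+Q$, $P(k+1)=AP(k)^+A^T+Q$ be the prediction error covariances of the Kalman filter, let $P=\lim_{k\to\infty}P(k)$ (the limit and all the inverses involved, also at $P$, are assumed to exist), and let $K=K(P)=[K_1,\dots,K_m]$. The steady-state Kalman estimate is $\hat x(0)=0$, $\hat x(k+1)=(A-KCA)\hat x(k)+Ky(k+1)$; the steady-state covariance of its error is $P^+=P-KCP\preceq P$. If $R$ is singular, assume moreover that all eigenvalues of $A-KCA$ lie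 in the open unit disc (for $R\succ0$ this is not assumed). Assume that the eigenvalues of $A-KCA$ are distinct and that none of them is an eigenvalue of $A$. Local filters. Write $A-KCA=V\Lambda V^{-1}$ with $\Lambda$ diagonal, let $\beta\in\mathbb C^n$ and $G_1,\dots,G_m\in\mathbb C^{n\times n}$ satisfy $(G_i-\mathbf 1_nC_i)A=\Lambda G_i$ and $\beta^TG_i=C_iA$ for all $i$, and put $S=\Lambda+\mathbf 1_n\beta^T$. (All these objects may be taken real if the eigenvalues of $A-KCA$ are real.) Sensor $i$ runs $\hat\xi_i(0)=0$, $z_i(k)=y_i(k+1)-\beta^T\hat\xi_i(k)$, $\hat\xi_i(k+1)=S\hat\xi_i(k)+\mathbf 1_nz_i(k)$. Network and gain. The sensors form a connected undirected graph with weights $a_{ij}=a_{ji}\ge0$ (an edge where $a_{ij}>0$), whose Laplacian has eigenvalues $0=\mu_1<\mu_2\le\dots\le\mu_m$. Let $B\in\mathbb C^n$ be such that $(S,B)$ is controllable. Let $M(S)$ be the absolute value of the product of the unstable eigenvalues of $S$, and assume $M(S)<\frac{1+\mu_2/\mu_m}{1-\mu_2/\mu_m}$ (read as $+\infty$ if $\mu_2=\mu_m$).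 Let $M(S)<\zeta^{-1}\le\frac{1+\mu_2/\mu_m}{1-\mu_2/\mu_m}$, let $\mathcal P\succ0$ satisfy $$\mathcal P-S^*\mathcal PS+(1-\zeta^2)\frac{S^*\mathcal PBB^*\mathcal PS}{B^*\mathcal PB}\succ0,$$ and let $\Gamma=\frac{2}{\mu_2+\mu_m}\frac{B^*\mathcal PS}{B^*\mathcal PB}$. Event-triggered synchronization. Let $c_0,c_1>0$ and $\varrho\in(0,1)$. With $\tilde S=I_m\otimes S$, sensor $i$ keeps $\eta_i(k)\in\mathbb C^{mn}$, $\eta_i(0)=0$, $$\eta_i(k+1)=\tilde S\eta_i(k)+(e_i\otimes\mathbf 1_n)z_i(k)+(I_m\otimes B)(I_m\otimes\Gamma)\sum_{j}a_{ij}\big(\hat\eta_j(k)-\hat\eta_i(k)\big),$$ where $\hat\eta_i(k)=\tilde S^{\,k-k^i_s}\eta_i(k^i_s)$ for $k^i_s\le k<k^i_{s+1}$, and the broadcast times are $k^i_0=0$, $k^i_{s+1}=\min\{k>k^i_s:\ \|\tilde S^{\,k-k^i_s}\eta_i(k^i_s)-\eta_i(k)\|^2\ge c_0+c_1\varrho^k\}$.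 The local estimate is $\breve x_i(k)=mF\eta_i(k)$ with $F=[F_1,\dots,F_m]$, $F_j=V\operatorname{diag}(V^{-1}K_j)$. Put $\bar\eta=\frac1m\sum_i\eta_i$ and $\delta_i=\eta_i-\bar\eta$. Then all $\delta_i(k)$ and $\breve x_i(k)-x(k)$ are square integrable, and: (1) $\frac1m\sum_{i=1}^m\breve x_i(k)=\hat x(k)$ for all $k\ge0$. (2) The error covariances are uniformly bounded: there is a matrix $\Xi$ such that, for all $i$ and all $k\ge0$, $\operatorname{cov}(\delta_i(k))\preceq\Xi$ and $$\operatorname{cov}(\breve x_i(k)-x(k))\preceq m^2F\Xi F^*+P^+\preceq m^2F\Xi F^*+P .$$ Moreover, for every $\Xi$ with $\operatorname{cov}(\delta_i(k))\preceq\Xi$ for all $i$ and $k$: for every $\varepsilon>0$, $\operatorname{cov}(\breve x_i(k)-x(k))\preceq m^2F\Xi F^*+P^++\varepsilon I$ for all $i$ and all sufficiently large $k$; and if the Kalman filter starts in its steady state, that is $\Sigma_0=P^+$, then $\operatorname{cov}(\breve x_i(k)-x(k))\preceq m^2F\Xi F^*+P^+$ for all $i$ and all $k\ge0$. -/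

import Mathlib

open Matrix Filter Topology MeasureTheory ProbabilityTheory
open scoped Kronecker ComplexOrder

noncomputable section

/-- A real matrix regarded as a complex matrix. -/
def toC {ι κ : Type*} (M : Matrix ι κ ℝ) : Matrix ι κ ℂ := M.map Complex.ofReal

/-- The pair `(A, C)` is observable: no nonzero state is invisible in `C x, C A x, …, C A^(n-1) x`. -/
def IsObservable {n m : ℕ} (A : Matrix (Fin n) (Fin n) ℝ) (C : Matrix (Fin m) (Fin n) ℝ) : Prop :=
  ∀ x : Fin n → ℝ, (∀ k < n, (C * A ^ k) *ᵥ x = 0) → x = 0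

/-- The pair `(S, B)` is controllable: the columns of `B, S B, …, S^(n-1) B` span the space. -/
def IsControllable {n r : ℕ} (S : Matrix (Fin n) (Fin n) ℂ) (B : Matrix (Fin n) (Fin r) ℂ) : Prop :=
  Submodule.span ℂ (Set.range fun p : Fin n × Fin r => (S ^ (p.1 : ℕ) * B).col p.2) = ⊤

/-- Every complex eigenvalue of the real matrix `M` lies in the open unit disc. -/
def IsSchurStable {n : ℕ} (M : Matrix (Fin n) (Fin n) ℝ) : Prop :=
  ∀ μ ∈ (toC M).charpoly.roots, ‖μ‖ < 1

/-- The Mahler measure of a square matrix: the absolute value of the product of its unstable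
eigenvalues, counted with algebraic multiplicity. -/
def matrixMahler {n : ℕ} (S : Matrix (Fin n) (Fin n) ℂ) : ℝ :=
  (S.charpoly.roots.map fun μ => max 1 ‖μ‖).prod

/-- The Laplacian of the weighted graph with weights `a i j`. -/
def weightedLaplacian {m : ℕ} (a : Matrix (Fin m) (Fin m) ℝ) : Matrix (Fin m) (Fin m) ℝ :=
  Matrix.diagonal (fun i => ∑ j, a i j) - a

/-- The weights `a` are those of a connected undirected graph (`i` and `j` are joined by an edge
iff `a i j > 0`). -/
def IsConnectedNetwork {m : ℕ} (a : Matrix (Fin m) (Fin m) ℝ) : Prop :=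
  (∀ i j, 0 ≤ a i j) ∧ (∀ i j, a i j = a j i) ∧
    (SimpleGraph.fromRel fun i j => 0 < a i j).Connected

/-- `μ 0 ≤ μ 1 ≤ …` are the eigenvalues of `L`, in increasing order and with multiplicity. -/
def IsOrderedSpectrum {m : ℕ} (L : Matrix (Fin m) (Fin m) ℝ) (μ : Fin m → ℝ) : Prop :=
  Monotone μ ∧ L.charpoly = ∏ i, (Polynomial.X - Polynomial.C (μ i))

/-! ### The centralized Kalman filter -/

/-- Covariance of the innovation, for the prediction error covariance `X`. -/
def innovationCov {n m : ℕ} (C : Matrix (Fin m) (Fin n) ℝ) (R : Matrix (Fin m) (Fin m) ℝ)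
    (X : Matrix (Fin n) (Fin n) ℝ) : Matrix (Fin m) (Fin m) ℝ :=
  C * X * Cᵀ + R

/-- The Kalman gain for the prediction error covariance `X`. -/
def kalmanGain {n m : ℕ} (C : Matrix (Fin m) (Fin n) ℝ) (R : Matrix (Fin m) (Fin m) ℝ)
    (X : Matrix (Fin n) (Fin n) ℝ) : Matrix (Fin n) (Fin m) ℝ :=
  X * Cᵀ * (innovationCov C R X)⁻¹

/-- Error covariance after the measurement update, for the prediction error covariance `X`. -/
def filteredCov {n m : ℕ} (C : Matrix (Fin m) (Fin n) ℝ) (R : Matrix (Fin m) (Fin m) ℝ)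
    (X : Matrix (Fin n) (Fin n) ℝ) : Matrix (Fin n) (Fin n) ℝ :=
  X - kalmanGain C R X * C * X

/-- Prediction error covariances of the Kalman filter: `predictionCov … k` is the error covariance
of the optimal prediction of `x (k+1)` from `y 1, …, y k`, where `x 0` has covariance `Sig0`. -/
def predictionCov {n m : ℕ} (A : Matrix (Fin n) (Fin n) ℝ) (C : Matrix (Fin m) (Fin n) ℝ)
    (Q : Matrix (Fin n) (Fin n) ℝ) (R : Matrix (Fin m) (Fin m) ℝ)
    (Sig0 : Matrix (Fin n) (Fin n) ℝ) : ℕ → Matrix (Fin n) (Fin n) ℝ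
  | 0 => A * Sig0 * Aᵀ + Q
  | k + 1 => A * filteredCov C R (predictionCov A C Q R Sig0 k) * Aᵀ + Q

/-- The plant `x (k+1) = A x k + w k`. -/
def plantState {n : ℕ} (A : Matrix (Fin n) (Fin n) ℝ) (x₀ : Fin n → ℝ) (w : ℕ → Fin n → ℝ) :
    ℕ → Fin n → ℝ
  | 0 => x₀
  | k + 1 => A *ᵥ plantState A x₀ w k + w k

/-- The stacked measurements `y k = C x k + v k`. -/
def measurement {n m : ℕ} (C : Matrix (Fin m) (Fin n) ℝ) (x : ℕ → Fin n → ℝ)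
    (v : ℕ → Fin m → ℝ) (k : ℕ) : Fin m → ℝ :=
  C *ᵥ x k + v k

/-- The fixed-gain Kalman estimate `x̂ (k+1) = (A - K C A) x̂ k + K y (k+1)`, `x̂ 0 = 0`. -/
def kalmanEstimate {n m : ℕ} (A : Matrix (Fin n) (Fin n) ℝ) (C : Matrix (Fin m) (Fin n) ℝ)
    (K : Matrix (Fin n) (Fin m) ℝ) (y : ℕ → Fin m → ℝ) : ℕ → Fin n → ℝ
  | 0 => 0
  | k + 1 => (A - K * C * A) *ᵥ kalmanEstimate A C K y k + K *ᵥ y (k + 1)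

/-! ### Phase I: local filters -/

/-- `S = Λ + 1 βᵀ` with `Λ = diag lam`. -/
def filterMatrix {n : ℕ} (lam β : Fin n → ℂ) : Matrix (Fin n) (Fin n) ℂ :=
  Matrix.diagonal lam + Matrix.vecMulVec (fun _ => 1) β

/-- State `ξ̂_i` of the local filter of sensor `i`:
`ξ̂_i (k+1) = S ξ̂_i k + 1 (y_i (k+1) - βᵀ ξ̂_i k)`, `ξ̂_i 0 = 0`. -/
def localFilter {n m : ℕ} (lam β : Fin n → ℂ) (y : ℕ → Fin m → ℝ) (i : Fin m) : ℕ → Fin n → ℂ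
  | 0 => 0
  | k + 1 => filterMatrix lam β *ᵥ localFilter lam β y i k
      + fun _ => ((y (k + 1) i : ℝ) : ℂ) - β ⬝ᵥ localFilter lam β y i k

/-- Output `z_i k = y_i (k+1) - βᵀ ξ̂_i k` of the local filter of sensor `i`. -/
def localOutput {n m : ℕ} (lam β : Fin n → ℂ) (y : ℕ → Fin m → ℝ) (k : ℕ) (i : Fin m) : ℂ :=
  ((y (k + 1) i : ℝ) : ℂ) - β ⬝ᵥ localFilter lam β y i k

/-! ### Phase II: event-triggered synchronization -/

/-- State of the network: the local states `η_i`, and, for every sensor, the time of its most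
recent broadcast and the state it then sent. -/
structure SyncState (m n : ℕ) where
  eta : Fin m → Fin m × Fin n → ℂ
  lastTime : Fin m → ℕ
  lastSent : Fin m → Fin m × Fin n → ℂ

/-- `S̃ = I_m ⊗ S`. -/
def tildeS (m : ℕ) {n : ℕ} (S : Matrix (Fin n) (Fin n) ℂ) :
    Matrix (Fin m × Fin n) (Fin m × Fin n) ℂ :=
  (1 : Matrix (Fin m) (Fin m) ℂ) ⊗ₖ S

/-- `η̂_i k = S̃^(k - k_s) η_i (k_s)`, with `k_s` the time of the latest broadcast recorded
in `s`. -/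
def etaHat {m n : ℕ} (S : Matrix (Fin n) (Fin n) ℂ) (s : SyncState m n) (k : ℕ) (i : Fin m) :
    Fin m × Fin n → ℂ :=
  (tildeS m S ^ (k - s.lastTime i)) *ᵥ s.lastSent i

/-- `S̃ η_i + L̃_i z_i + B̃ Γ̃ ∑ j, a_ij (η̂_j - η̂_i)`, the state of sensor `i` at time `k + 1`. -/
def etaNext {m n : ℕ} (S : Matrix (Fin n) (Fin n) ℂ) (B : Matrix (Fin n) (Fin 1) ℂ)
    (Γ : Matrix (Fin 1) (Fin n) ℂ) (a : Matrix (Fin m) (Fin m) ℝ) (z : Fin m → ℂ)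
    (s : SyncState m n) (k : ℕ) (i : Fin m) : Fin m × Fin n → ℂ :=
  tildeS m S *ᵥ s.eta i + (fun p => if p.1 = i then z i else 0)
    + (((1 : Matrix (Fin m) (Fin m) ℂ) ⊗ₖ B) * ((1 : Matrix (Fin m) (Fin m) ℂ) ⊗ₖ Γ)) *ᵥ
        ∑ j, (a i j : ℂ) • (etaHat S s k j - etaHat S s k i)

open Classical in
/-- The event-triggered synchronization algorithm. All sensors broadcast at time `0`; later, sensor
`i` broadcasts at time `k` iff `‖η̂_i k - η_i k‖² - (c₀ + c₁ ϱ^k) ≥ 0` (Euclidean norm), where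
`η̂_i k` is computed from its previous broadcast. -/
def synchronize {m n : ℕ} (S : Matrix (Fin n) (Fin n) ℂ) (B : Matrix (Fin n) (Fin 1) ℂ)
    (Γ : Matrix (Fin 1) (Fin n) ℂ) (a : Matrix (Fin m) (Fin m) ℝ) (c₀ c₁ ϱ : ℝ)
    (z : ℕ → Fin m → ℂ) : ℕ → SyncState m n
  | 0 => { eta := 0, lastTime := 0, lastSent := 0 }
  | k + 1 =>
    let s := synchronize S B Γ a c₀ c₁ ϱ z k
    let new := etaNext S B Γ a (z k) s k
    let triggered : Fin m → Prop := fun i =>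
      0 ≤ (∑ p, ‖etaHat S s (k + 1) i p - new i p‖ ^ 2) - (c₀ + c₁ * ϱ ^ (k + 1))
    { eta := new
      lastTime := fun i => if triggered i then k + 1 else s.lastTime i
      lastSent := fun i => if triggered i then new i else s.lastSent i }

/-- The average of the local states. -/
def etaBar {m n : ℕ} (s : SyncState m n) : Fin m × Fin n → ℂ :=
  (1 / (m : ℂ)) • ∑ i, s.eta i

/-- `F = [F_1, …, F_m]` with `F_j = V diag (V⁻¹ K_j)`, `K_j` the `j`th column of `K`. -/
def fusionMatrix {n m : ℕ} (V : Matrix (Fin n) (Fin n) ℂ) (K : Matrix (Fin n) (Fin m) ℝ) :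
    Matrix (Fin n) (Fin m × Fin n) ℂ :=
  Matrix.of fun r p => (V * Matrix.diagonal (V⁻¹ *ᵥ (toC K).col p.1)) r p.2

/-- The local estimate `x̆_i = m F η_i`. -/
def localEstimate {m n : ℕ} (F : Matrix (Fin n) (Fin m × Fin n) ℂ) (s : SyncState m n)
    (i : Fin m) : Fin n → ℂ :=
  (m : ℂ) • (F *ᵥ s.eta i)

/-- The gain `Γ = 2 / (μ₂ + μ_m) • (Bᴴ 𝒫 S) / (Bᴴ 𝒫 B)`. -/
def syncGain {n : ℕ} (μ₂ μₘ : ℝ) (S : Matrix (Fin n) (Fin n) ℂ) (B : Matrix (Fin n) (Fin 1) ℂ)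
    (PP : Matrix (Fin n) (Fin n) ℂ) : Matrix (Fin 1) (Fin n) ℂ :=
  (((2 / (μ₂ + μₘ) : ℝ) : ℂ) / (Bᴴ * PP * B) 0 0) • (Bᴴ * PP * S)

/-- `PP > 0` and
`PP - Sᴴ PP S + (1 - ζ²) (Sᴴ PP B Bᴴ PP S) / (Bᴴ PP B) > 0`. -/
def SolvesRiccatiInequality {n : ℕ} (ζ : ℝ) (S : Matrix (Fin n) (Fin n) ℂ)
    (B : Matrix (Fin n) (Fin 1) ℂ) (PP : Matrix (Fin n) (Fin n) ℂ) : Prop :=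
  PP.PosDef ∧
    (PP - Sᴴ * PP * S
      + (((1 - ζ ^ 2 : ℝ) : ℂ) / (Bᴴ * PP * B) 0 0) • (Sᴴ * PP * B * Bᴴ * PP * S)).PosDef

/-! ### Covariances -/

/-- All coordinates of the random vector `X` are square integrable. -/
def IsSquareIntegrable {Ω ι : Type*} [MeasurableSpace Ω] (Pr : Measure Ω) (X : Ω → ι → ℂ) : Prop :=
  ∀ p, MemLp (fun ω => X ω p) 2 Pr

/-- The covariance matrix `E[(X - E X) (X - E X)ᴴ]` of a random vector. -/
def covMat {Ω ι : Type*} [MeasurableSpace Ω] (Pr : Measure Ω) (X : Ω → ι → ℂ) : Matrix ι ι ℂ :=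
  Matrix.of fun p q =>
    ∫ ω, (X ω p - ∫ ω', X ω' p ∂Pr) * star (X ω q - ∫ ω', X ω' q ∂Pr) ∂Pr

/-- The random vector `X` is square integrable and `cov X ≤ M` in the Loewner order. -/
def CovLE {Ω ι : Type*} [MeasurableSpace Ω] (Pr : Measure Ω) (X : Ω → ι → ℂ)
    (M : Matrix ι ι ℂ) : Prop :=
  IsSquareIntegrable Pr X ∧ (M - covMat Pr X).PosSemidef

end

/-! The error of sensor `i` splits as `e_i = mF δ_i + D + E`, where `D` is the fixed-gain Kalman
estimate minus the estimate `x°` of the filter with the optimal time-varying gain, and `E = x° - x`.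
The splitting rests on `mF η̄ = x̂`. The weights are symmetric, so the couplings cancel in `∑ η_i`,
and block `b` of this sum is the local filter of sensor `b` (`sum_eta_eq_localFilter`). In the
coordinates `V⁻¹` the Kalman recursion is a family of scalar filters with poles `λ_r`, and `F`
assembles it from the local filters (`kalmanEstimate_eq_fusion`). This also gives (1).

Both `δ_i` and `D` are functions of the measurements `y_1, …, y_k`. Triggering makes `δ_i` a
nonlinear function of them, so uncorrelatedness with `E` would not suffice. However, `E` is jointly
Gaussian with the measurements and uncorrelated with them, hence independent of them
(`indepFun_optimal_error`). Therefore `cov e_i = cov (mF δ_i + D) + cov E`. Here `cov E` follows the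
Riccati recursion and tends to `P⁺`. The closed loop is stable (`norm_eigenvalue_lt_one`) and the
gains converge, so `D` tends to zero in `L²` (`isL2Null_kalman_sub_optimal`). This yields the
asymptotic bound. In the steady-state start `D = 0` and `cov E = P⁺` at every time.

The deviations are bounded in `L²` because the noise-free synchronization step contracts the energy
`∑ δ_iᴴ 𝒫 δ_i`: the Laplacian bound on zero-sum vectors turns the modified Riccati inequality into a
decrease (`exists_syncStep_contraction`). The inputs of this contraction are the broadcast errors,
which the triggering rule bounds by `c₀ + c₁`, and the outputs `z_i`. The latter are bounded in `L²`
even for an unstable plant, since the equations for `G_i` and `β` eliminate the state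
(`isL2Bounded_localOutput`).

For the bound at all times, `cov E` may exceed `P⁺` during the transient. But `F` has a right
inverse, so `F Fᴴ` is positive definite and a large multiple of the identity serves as `Ξ`
(`exists_uniform_covLE`). -/

/-- The squared Euclidean norm of a complex vector. -/
noncomputable def sqNorm {ι : Type*} [Fintype ι] (u : ι → ℂ) : ℝ := ∑ i, ‖u i‖ ^ 2

/-! ### Euclidean norm inequalities. -/

section SqNorm

variable {ι κ : Type*} [Fintype ι] [Fintype κ]

lemma sqNorm_nonneg (u : ι → ℂ) : 0 ≤ sqNorm u :=
  Finset.sum_nonneg fun _ _ => by positivity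

lemma norm_sq_le_sqNorm (u : ι → ℂ) (i : ι) : ‖u i‖ ^ 2 ≤ sqNorm u :=
  Finset.single_le_sum (f := fun i => ‖u i‖ ^ 2) (fun _ _ => by positivity) (Finset.mem_univ i)

lemma star_dotProduct_self (u : ι → ℂ) : star u ⬝ᵥ u = (sqNorm u : ℂ) := by
  simp [sqNorm, dotProduct, ← Complex.normSq_eq_conj_mul_self, Complex.normSq_eq_norm_sq]

lemma norm_dotProduct_sq_le (u v : ι → ℂ) : ‖u ⬝ᵥ v‖ ^ 2 ≤ sqNorm u * sqNorm v := by
  have h1 : ‖u ⬝ᵥ v‖ ≤ ∑ i, ‖u i‖ * ‖v i‖ := by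
    refine (norm_sum_le _ _).trans (le_of_eq ?_)
    simp
  calc ‖u ⬝ᵥ v‖ ^ 2 ≤ (∑ i, ‖u i‖ * ‖v i‖) ^ 2 := by gcongr
    _ ≤ sqNorm u * sqNorm v := Finset.sum_mul_sq_le_sq_mul_sq _ _ _

lemma sqNorm_mulVec_le (M : Matrix κ ι ℂ) (v : ι → ℂ) :
    sqNorm (M *ᵥ v) ≤ (∑ k, sqNorm (M k)) * sqNorm v := by
  rw [Finset.sum_mul]
  exact Finset.sum_le_sum fun k _ => norm_dotProduct_sq_le _ _

lemma norm_quadForm_le (M : Matrix ι ι ℂ) (u : ι → ℂ) :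
    ‖star u ⬝ᵥ M *ᵥ u‖ ≤ (∑ i, ∑ j, ‖M i j‖) * sqNorm u := by
  simp only [dotProduct, mulVec, Finset.mul_sum, Finset.sum_mul]
  refine (norm_sum_le _ _).trans (Finset.sum_le_sum fun i _ => ?_)
  refine (norm_sum_le _ _).trans (Finset.sum_le_sum fun j _ => ?_)
  have hi := norm_sq_le_sqNorm u i
  have hj := norm_sq_le_sqNorm u j
  have h : ‖u i‖ * ‖u j‖ ≤ sqNorm u := by nlinarith [sq_nonneg (‖u i‖ - ‖u j‖)]
  calc ‖(star u) i * (M i j * u j)‖ = ‖M i j‖ * (‖u i‖ * ‖u j‖) := by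
        simp; ring
    _ ≤ ‖M i j‖ * sqNorm u := by gcongr

/-- Young's inequality. The free weight `τ` is later paid out of the contraction margin. -/
lemma sqNorm_add_le (τ : ℝ) (hτ : 0 < τ) (u v : ι → ℂ) :
    sqNorm (u + v) ≤ (1 + τ) * sqNorm u + (1 + 1 / τ) * sqNorm v := by
  simp only [sqNorm, Finset.mul_sum, ← Finset.sum_add_distrib]
  refine Finset.sum_le_sum fun i _ => ?_
  have h1 : ‖(u + v) i‖ ≤ ‖u i‖ + ‖v i‖ := norm_add_le _ _
  have h2 : ‖(u + v) i‖ ^ 2 ≤ (‖u i‖ + ‖v i‖) ^ 2 := by gcongr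
  have h3 : 0 ≤ (τ * ‖u i‖ - ‖v i‖) ^ 2 / τ := by positivity
  have h4 : (τ * ‖u i‖ - ‖v i‖) ^ 2 / τ
      = τ * ‖u i‖ ^ 2 - 2 * (‖u i‖ * ‖v i‖) + 1 / τ * ‖v i‖ ^ 2 := by
    field_simp; ring
  nlinarith

end SqNorm

/-! ### Quadratic forms in an eigenbasis. -/

section Spectral

variable {ι : Type*} [Fintype ι] [DecidableEq ι]

/-- Coordinates of `u` in the eigenbasis of a Hermitian matrix. -/
lemma sqNorm_star_eigenvectorUnitary_mulVec {M : Matrix ι ι ℂ} (hM : M.IsHermitian) (u : ι → ℂ) :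
    sqNorm ((star (hM.eigenvectorUnitary : Matrix ι ι ℂ)) *ᵥ u) = sqNorm u := by
  have h := star_dotProduct_self ((star (hM.eigenvectorUnitary : Matrix ι ι ℂ)) *ᵥ u)
  rw [star_mulVec, ← dotProduct_mulVec, mulVec_mulVec, star_eq_conjTranspose,
    conjTranspose_conjTranspose, ← star_eq_conjTranspose,
    Unitary.mul_star_self_of_mem hM.eigenvectorUnitary.2, one_mulVec, star_dotProduct_self] at h
  exact_mod_cast h.symm

lemma quadForm_eq_sum_eigenvalues {M : Matrix ι ι ℂ} (hM : M.IsHermitian) (u : ι → ℂ) :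
    (star u ⬝ᵥ M *ᵥ u).re = ∑ i, hM.eigenvalues i *
      ‖((star (hM.eigenvectorUnitary : Matrix ι ι ℂ)) *ᵥ u) i‖ ^ 2 := by
  set c := (star (hM.eigenvectorUnitary : Matrix ι ι ℂ)) *ᵥ u with hc
  have h : star u ⬝ᵥ M *ᵥ u = star c ⬝ᵥ (diagonal (RCLike.ofReal ∘ hM.eigenvalues) *ᵥ c) := by
    conv_lhs => rw [hM.spectral_theorem, Unitary.conjStarAlgAut_apply]
    rw [hc, star_mulVec, ← dotProduct_mulVec, mulVec_mulVec, mulVec_mulVec, star_eq_conjTranspose,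
      conjTranspose_conjTranspose]
  rw [h]
  simp only [dotProduct, mulVec_diagonal, Complex.re_sum]
  refine Finset.sum_congr rfl fun i _ => ?_
  simp [← Complex.normSq_eq_norm_sq, Complex.normSq_apply]
  ring

lemma Matrix.PosDef.exists_pos_le {M : Matrix ι ι ℂ} (hM : M.PosDef) :
    ∃ κ > 0, ∀ u, κ * sqNorm u ≤ (star u ⬝ᵥ M *ᵥ u).re := by
  obtain ⟨κ, hκ, hle⟩ : ∃ κ > 0, ∀ i, κ ≤ hM.1.eigenvalues i := by
    rcases isEmpty_or_nonempty ι with h | h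
    -- Without coordinates there is no smallest eigenvalue, and any positive constant works.
    · exact ⟨1, one_pos, fun i => h.elim i⟩
    · obtain ⟨i, hi⟩ := Finite.exists_min hM.1.eigenvalues
      exact ⟨_, hM.eigenvalues_pos i, hi⟩
  refine ⟨κ, hκ, fun u => ?_⟩
  rw [quadForm_eq_sum_eigenvalues hM.1, ← sqNorm_star_eigenvectorUnitary_mulVec hM.1, sqNorm, Finset.mul_sum]
  exact Finset.sum_le_sum fun i _ => by gcongr; exact hle i

lemma exists_conjTranspose_mul_self {M : Matrix ι ι ℂ} (hM : M.PosSemidef) :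
    ∃ N : Matrix ι ι ℂ, M = Nᴴ * N := by
  refine ⟨diagonal (fun i => ((Real.sqrt (hM.1.eigenvalues i) : ℝ) : ℂ)) *
    star (hM.1.eigenvectorUnitary : Matrix ι ι ℂ), ?_⟩
  conv_lhs => rw [hM.1.spectral_theorem, Unitary.conjStarAlgAut_apply]
  rw [conjTranspose_mul, ← star_eq_conjTranspose (star _), star_star, diagonal_conjTranspose, Matrix.mul_assoc,
    Matrix.mul_assoc, ← Matrix.mul_assoc (diagonal _) (diagonal _), diagonal_mul_diagonal]
  congr 3
  ext i
  simp [← Complex.ofReal_mul, Real.mul_self_sqrt (hM.eigenvalues_nonneg i)]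

end Spectral

/-! ### The graph Laplacian on zero-sum vectors. -/

section Laplacian

lemma star_eigenvectorUnitary_mulVec_mulVec {ι : Type*} [Fintype ι] [DecidableEq ι]
    {M : Matrix ι ι ℂ} (hM : M.IsHermitian) (u : ι → ℂ) (i : ι) :
    ((star (hM.eigenvectorUnitary : Matrix ι ι ℂ)) *ᵥ (M *ᵥ u)) i
      = hM.eigenvalues i * ((star (hM.eigenvectorUnitary : Matrix ι ι ℂ)) *ᵥ u) i := by
  have h : (star (hM.eigenvectorUnitary : Matrix ι ι ℂ)) * M
      = diagonal (RCLike.ofReal ∘ hM.eigenvalues) * star (hM.eigenvectorUnitary : Matrix ι ι ℂ) := by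
    have h := hM.spectral_theorem
    rw [Unitary.conjStarAlgAut_apply] at h
    have h' := congrArg (fun X => star (hM.eigenvectorUnitary : Matrix ι ι ℂ) * X) h
    simp only [← Matrix.mul_assoc] at h'
    rwa [Unitary.star_mul_self_of_mem hM.eigenvectorUnitary.2, Matrix.one_mul] at h'
  rw [mulVec_mulVec, h, ← mulVec_mulVec, mulVec_diagonal]
  rfl

variable {m : ℕ} {a : Matrix (Fin m) (Fin m) ℝ}

lemma toC_weightedLaplacian_mulVec (q : Fin m → ℂ) (i : Fin m) :
    (toC (weightedLaplacian a) *ᵥ q) i = ∑ j, (a i j : ℂ) * (q i - q j) := by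
  simp only [toC, weightedLaplacian, mulVec, dotProduct, map_apply, Matrix.sub_apply, diagonal_apply,
    Complex.ofReal_sub, sub_mul, mul_sub, Finset.sum_sub_distrib]
  congr 1
  simp [apply_ite Complex.ofReal, Finset.sum_mul]

lemma isHermitian_toC_weightedLaplacian (ha : ∀ i j, a i j = a j i) :
    (toC (weightedLaplacian a)).IsHermitian := by
  ext i j
  by_cases h : i = j
  · subst h; simp [toC, weightedLaplacian]
  · simp [toC, weightedLaplacian, h, Ne.symm h, ha i j]

lemma quadForm_weightedLaplacian (ha : ∀ i j, a i j = a j i) (q : Fin m → ℂ) :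
    (star q ⬝ᵥ toC (weightedLaplacian a) *ᵥ q).re
      = (∑ i, ∑ j, a i j * ‖q i - q j‖ ^ 2) / 2 := by
  have h1 : (star q ⬝ᵥ toC (weightedLaplacian a) *ᵥ q).re
      = ∑ i, ∑ j, a i j * (star (q i) * (q i - q j)).re := by
    simp only [dotProduct, toC_weightedLaplacian_mulVec, Finset.mul_sum, Complex.re_sum]
    refine Finset.sum_congr rfl fun i _ => Finset.sum_congr rfl fun j _ => ?_
    rw [← Complex.re_ofReal_mul, Pi.star_apply]
    ring_nf
  have h2 : ∑ i, ∑ j, a i j * (star (q i) * (q i - q j)).re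
      = ∑ i, ∑ j, a i j * (star (q j) * (q j - q i)).re := by
    rw [Finset.sum_comm]
    exact Finset.sum_congr rfl fun i _ => Finset.sum_congr rfl fun j _ => by rw [ha]
  have h3 : ∑ i, ∑ j, a i j * ‖q i - q j‖ ^ 2 =
      ∑ i, ∑ j, a i j * (star (q i) * (q i - q j)).re
      + ∑ i, ∑ j, a i j * (star (q j) * (q j - q i)).re := by
    simp only [← Finset.sum_add_distrib, ← mul_add]
    refine Finset.sum_congr rfl fun i _ => Finset.sum_congr rfl fun j _ => ?_
    congr 1
    simp [← Complex.normSq_eq_norm_sq, Complex.normSq_apply]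
    ring
  rw [h1, h3, ← h2]; ring

/-- The quadratic form is half the weighted sum of the squared differences. If it vanishes, the two
ends of every edge carry equal values, and walks spread this equality over the connected graph. -/
lemma eq_of_toC_weightedLaplacian_mulVec_eq_zero (ha : IsConnectedNetwork a) {q : Fin m → ℂ}
    (hq : toC (weightedLaplacian a) *ᵥ q = 0) (i j : Fin m) : q i = q j := by
  have h := quadForm_weightedLaplacian ha.2.1 q
  rw [hq, dotProduct_zero, Complex.zero_re] at h
  have h0 : ∑ i, ∑ j, a i j * ‖q i - q j‖ ^ 2 = 0 := by linarith
  have hnn : ∀ i j, 0 ≤ a i j * ‖q i - q j‖ ^ 2 := fun i j => by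
    have := ha.1 i j; positivity
  have hedge : ∀ i j, 0 < a i j → q i = q j := by
    intro i j hij
    rw [Finset.sum_eq_zero_iff_of_nonneg fun i _ => Finset.sum_nonneg fun j _ => hnn i j] at h0
    have h1 := h0 i (Finset.mem_univ i)
    rw [Finset.sum_eq_zero_iff_of_nonneg fun j _ => hnn i j] at h1
    have h2 := h1 j (Finset.mem_univ j)
    rcases mul_eq_zero.1 h2 with h3 | h3
    · exact absurd h3 hij.ne'
    · exact sub_eq_zero.1 (norm_eq_zero.1 (pow_eq_zero_iff two_ne_zero |>.1 h3))
  obtain ⟨p⟩ := ha.2.2.preconnected i j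
  induction p with
  | nil => rfl
  | cons hadj _ ih =>
    refine Eq.trans ?_ ih
    rw [SimpleGraph.fromRel_adj] at hadj
    rcases hadj.2 with h | h
    · exact hedge _ _ h
    · exact (hedge _ _ h).symm

/-- The step `r` centres the interval `[μ₂, μₘ]`, so `|1 - r ν|` is at most `(μₘ - μ₂) / (μₘ + μ₂)`.
With its denominators cleared, the hypothesis on `ζ` says that this ratio is at most `ζ`. -/
lemma laplacian_mode_contraction {r ν μ₂ μₘ ζ : ℝ} (hr : r = 2 / (μ₂ + μₘ)) (h2 : 0 < μ₂)
    (hν : μ₂ ≤ ν) (hν' : ν ≤ μₘ) (hζ : 0 < ζ) (hζ' : ζ⁻¹ * (1 - μ₂ / μₘ) ≤ 1 + μ₂ / μₘ) :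
    (1 - r * ν) ^ 2 ≤ ζ ^ 2 := by
  have hm : 0 < μₘ := by linarith
  have h1 : μₘ - μ₂ ≤ ζ * (μₘ + μ₂) := by
    have : ζ⁻¹ * (1 - μ₂ / μₘ) * (ζ * μₘ) ≤ (1 + μ₂ / μₘ) * (ζ * μₘ) := by gcongr
    have e1 : ζ⁻¹ * (1 - μ₂ / μₘ) * (ζ * μₘ) = μₘ - μ₂ := by field_simp
    have e2 : (1 + μ₂ / μₘ) * (ζ * μₘ) = ζ * (μₘ + μ₂) := by field_simp
    linarith
  have hs : 0 < μ₂ + μₘ := by linarith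
  have h3 : r * (μ₂ + μₘ) = 2 := by rw [hr]; field_simp
  have hr0 : 0 < r := by rw [hr]; positivity
  apply sq_le_sq'
  · have : (r * ν - 1) * (μ₂ + μₘ) ≤ ζ * (μ₂ + μₘ) := by nlinarith
    have := le_of_mul_le_mul_right this hs
    linarith
  · have : (1 - r * ν) * (μ₂ + μₘ) ≤ ζ * (μ₂ + μₘ) := by nlinarith
    exact le_of_mul_le_mul_right this hs

/-- In an eigenbasis of the Laplacian `L`, the map `1 - r L` multiplies each mode by `1 - r ν`.
Connectedness makes the zero eigenvalue simple with constant eigenvectors, so a zero-sum vector has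
no component there, and the other eigenvalues lie in `[μ₂, μₘ]`. -/
theorem sqNorm_sub_laplacian_le (hm : 2 ≤ m) (ha : IsConnectedNetwork a) {μ : Fin m → ℝ}
    (hμ : IsOrderedSpectrum (weightedLaplacian a) μ) {μ₂ μₘ : ℝ} {i₁ iₘ : Fin m}
    (hμ₂ : μ₂ = μ i₁) (hμₘ : μₘ = μ iₘ) (hi₁ : (i₁ : ℕ) = 1) (hiₘ : (iₘ : ℕ) = m - 1)
    {ζ : ℝ} (hζ : 0 < ζ)
    (hζ' : ζ⁻¹ * (1 - μ₂ / μₘ) ≤ 1 + μ₂ / μₘ) {q : Fin m → ℂ} (hq : ∑ i, q i = 0) :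
    sqNorm (q - ((2 / (μ₂ + μₘ) : ℝ) : ℂ) • toC (weightedLaplacian a) *ᵥ q) ≤ ζ ^ 2 * sqNorm q := by
  have hH := isHermitian_toC_weightedLaplacian ha.2.1
  set ev := hH.eigenvalues with hev
  -- The eigenvalues of the spectral theorem and the ordered list `μ` are compared only as
  -- multisets, both being the roots of the characteristic polynomial.
  have hmul : Multiset.map (fun i => (ev i : ℂ)) Finset.univ.val
      = Multiset.map (fun i => (μ i : ℂ)) Finset.univ.val := by
    have h1 := hH.roots_charpoly_eq_eigenvalues
    have h2 : (toC (weightedLaplacian a)).charpoly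
        = ∏ i, (Polynomial.X - Polynomial.C (μ i : ℂ)) := by
      have : toC (weightedLaplacian a) = (weightedLaplacian a).map Complex.ofRealHom := rfl
      rw [this, Matrix.charpoly_map, hμ.2, Polynomial.map_prod]
      simp
    rw [h2, Finset.prod_eq_multiset_prod, ← Function.comp_def (fun z : ℂ => Polynomial.X - Polynomial.C z),
      ← Multiset.map_map, Polynomial.roots_multiset_prod_X_sub_C] at h1
    exact h1.symm
  have hmulR : Multiset.map ev Finset.univ.val = Multiset.map μ Finset.univ.val := by
    apply Multiset.map_injective Complex.ofReal_injective
    simpa [Multiset.map_map, Function.comp_def] using hmul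
  have hevec : ∀ i, ev i = 0 → ∃ c : ℂ, ∀ j, (hH.eigenvectorBasis i : Fin m → ℂ) j = c := by
    intro i hi
    have h1 := hH.mulVec_eigenvectorBasis i
    rw [← hev, hi, zero_smul] at h1
    exact ⟨(hH.eigenvectorBasis i : Fin m → ℂ) ⟨0, by omega⟩,
      fun j => eq_of_toC_weightedLaplacian_mulVec_eq_zero ha h1 _ _⟩
  -- Two different basis vectors for the eigenvalue zero would be constant with values `c` and `d`;
  -- orthogonality then forces `c` or `d` to vanish, against unit length.
  have hsimple : ∀ i j, ev i = 0 → ev j = 0 → i = j := by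
    intro i j hi hj
    by_contra hne
    obtain ⟨c, hc⟩ := hevec i hi
    obtain ⟨d, hd⟩ := hevec j hj
    have ho : inner ℂ (hH.eigenvectorBasis i) (hH.eigenvectorBasis j) = 0 :=
      hH.eigenvectorBasis.orthonormal.2 hne
    have ni := hH.eigenvectorBasis.orthonormal.1 i
    have nj := hH.eigenvectorBasis.orthonormal.1 j
    rw [EuclideanSpace.inner_eq_star_dotProduct] at ho
    simp only [dotProduct, hc, hd, Pi.star_apply, Finset.sum_const, Finset.card_univ,
      Fintype.card_fin, nsmul_eq_mul] at ho
    have hm0 : (m : ℂ) ≠ 0 := by simp; omega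
    rcases mul_eq_zero.1 ho with h | h
    · exact hm0 h
    rcases mul_eq_zero.1 h with h | h
    · rw [EuclideanSpace.norm_eq] at nj
      simp [hd, h] at nj
    · rw [EuclideanSpace.norm_eq] at ni
      have : c = 0 := by simpa using h
      simp [hc, this] at ni
  have hnonneg : ∀ i, 0 ≤ ev i := by
    intro i
    have := hH.eigenvalues_eq i
    rw [hev, this]
    refine le_trans ?_ (le_of_eq (quadForm_weightedLaplacian ha.2.1 _).symm)
    have : ∀ i j, 0 ≤ a i j := ha.1
    have h' : ∀ i j : Fin m, ∀ x : ℝ, 0 ≤ a i j * x ^ 2 := fun i j x => by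
      have := ha.1 i j; positivity
    exact div_nonneg (Finset.sum_nonneg fun i _ => Finset.sum_nonneg fun j _ => h' _ _ _) (by norm_num)
  have hmemμ : ∀ i, ∃ j, μ j = ev i := by
    intro i
    have : ev i ∈ Multiset.map μ Finset.univ.val := by
      rw [← hmulR]; exact Multiset.mem_map_of_mem _ (Finset.mem_univ i)
    simpa using this
  have hmemev : ∀ i, ∃ j, ev j = μ i := by
    intro i
    have : μ i ∈ Multiset.map ev Finset.univ.val := by
      rw [hmulR]; exact Multiset.mem_map_of_mem _ (Finset.mem_univ i)
    simpa using this
  have hμnn : ∀ i, 0 ≤ μ i := fun i => by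
    obtain ⟨j, hj⟩ := hmemev i
    exact hj ▸ hnonneg j
  have hker : toC (weightedLaplacian a) *ᵥ (fun _ => 1) = 0 := by
    ext i; simp [toC_weightedLaplacian_mulVec]
  obtain ⟨p, hp⟩ : ∃ p, ev p = 0 := by
    have hdet : (toC (weightedLaplacian a)).det = 0 := by
      rw [← exists_mulVec_eq_zero_iff]
      refine ⟨fun _ => 1, fun h => one_ne_zero (congrFun h ⟨0, by omega⟩), hker⟩
    rw [hH.det_eq_prod_eigenvalues, Finset.prod_eq_zero_iff] at hdet
    obtain ⟨p, -, hp⟩ := hdet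
    exact ⟨p, by simpa using hp⟩
  have hμ0 : μ ⟨0, by omega⟩ = 0 := by
    obtain ⟨j, hj⟩ := hmemμ p
    have : μ ⟨0, by omega⟩ ≤ μ j := hμ.1 (Fin.mk_le_of_le_val (Nat.zero_le _))
    have := hμnn ⟨0, by omega⟩
    linarith
  -- Otherwise zero would occur at the indices `0` and `1` of `μ`, hence twice among the eigenvalues
  -- `ev`, contrary to simplicity.
  have hμ1 : 0 < μ i₁ := by
    refine lt_of_le_of_ne (hμnn _) fun h => ?_
    have hcount := congrArg (Multiset.count (0 : ℝ)) hmulR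
    rw [Multiset.count_map, Multiset.count_map, ← Finset.filter_val, ← Finset.filter_val,
      Finset.card_val, Finset.card_val] at hcount
    have h2 : 1 < (Finset.univ.filter fun i => 0 = μ i).card := by
      refine Finset.one_lt_card.2 ⟨⟨0, by omega⟩, by simp [hμ0], i₁, by simpa using h, ?_⟩
      exact fun h' => by simp [← h'] at hi₁
    rw [← hcount] at h2
    obtain ⟨i, hi, j, hj, hij⟩ := Finset.one_lt_card.1 h2
    simp only [Finset.mem_filter, Finset.mem_univ, true_and] at hi hj
    exact hij (hsimple i j hi.symm hj.symm)
  have hcoord : ∀ i, ev i = 0 → ((star (hH.eigenvectorUnitary : Matrix _ _ ℂ)) *ᵥ q) i = 0 := by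
    intro i hi
    obtain ⟨c, hc⟩ := hevec i hi
    simp only [mulVec, dotProduct, star_apply, IsHermitian.eigenvectorUnitary_apply, hc,
      ← Finset.mul_sum, hq, mul_zero]
  rw [← sqNorm_star_eigenvectorUnitary_mulVec hH, ← sqNorm_star_eigenvectorUnitary_mulVec hH q,
    mulVec_sub, mulVec_smul, sqNorm, sqNorm, Finset.mul_sum]
  refine Finset.sum_le_sum fun i _ => ?_
  rw [Pi.sub_apply, Pi.smul_apply, star_eigenvectorUnitary_mulVec_mulVec hH, ← hev]
  by_cases hi : ev i = 0
  · simp [hcoord i hi]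
  obtain ⟨j, hj⟩ := hmemμ i
  have hj0 : j ≠ ⟨0, by omega⟩ := by
    rintro rfl; exact hi (hj ▸ hμ0)
  have hle : μ i₁ ≤ μ j :=
    hμ.1 (Fin.le_def.2 (hi₁.le.trans (Nat.one_le_iff_ne_zero.2 fun h => hj0 (Fin.ext h))))
  have hle' : μ j ≤ μ iₘ := hμ.1 (Fin.le_def.2 (hiₘ ▸ Nat.le_sub_one_of_lt j.2))
  have hfac := laplacian_mode_contraction (ν := ev i) rfl (hμ₂ ▸ hμ1) (hj ▸ hμ₂ ▸ hle)
    (hj ▸ hμₘ ▸ hle') hζ hζ'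
  set c := ((star (hH.eigenvectorUnitary : Matrix _ _ ℂ)) *ᵥ q) i
  have : c - ((2 / (μ₂ + μₘ) : ℝ) : ℂ) • (↑(ev i) * c)
      = ((1 - 2 / (μ₂ + μₘ) * ev i : ℝ) : ℂ) * c := by
    push_cast; simp only [smul_eq_mul]; ring
  rw [this, norm_mul, Complex.norm_real, mul_pow, Real.norm_eq_abs, sq_abs]
  gcongr

end Laplacian

/-! ### Contraction of the synchronization dynamics. -/

section SyncContraction

variable {n m : ℕ}

/-- The quadratic form of `PP`, as a real number. -/
noncomputable def quadRe {ι : Type*} [Fintype ι] (PP : Matrix ι ι ℂ) (u : ι → ℂ) : ℝ :=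
  (star u ⬝ᵥ PP *ᵥ u).re

lemma Matrix.IsHermitian.star_dotProduct_mulVec {ι : Type*} [Fintype ι] {PP : Matrix ι ι ℂ}
    (h : PP.IsHermitian) (u v : ι → ℂ) : star (star u ⬝ᵥ PP *ᵥ v) = star v ⬝ᵥ PP *ᵥ u := by
  rw [← star_dotProduct_star, star_star, star_mulVec, h.eq, dotProduct_comm, dotProduct_mulVec,
    dotProduct_comm]

lemma quadRe_sub_smul {ι : Type*} [Fintype ι] {PP : Matrix ι ι ℂ} (h : PP.IsHermitian)
    (x b : ι → ℂ) (t : ℂ) :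
    quadRe PP (x - t • b) = quadRe PP x - 2 * (star t * (star b ⬝ᵥ PP *ᵥ x)).re
      + ‖t‖ ^ 2 * quadRe PP b := by
  have h1 := h.star_dotProduct_mulVec b x
  have h2 : (star (x - t • b)) ⬝ᵥ PP *ᵥ (x - t • b) = star x ⬝ᵥ PP *ᵥ x
      - (star t * (star b ⬝ᵥ PP *ᵥ x) + star (star t * (star b ⬝ᵥ PP *ᵥ x)))
      + (star t * t) * (star b ⬝ᵥ PP *ᵥ b) := by
    rw [star_mul', star_star, h1]
    simp only [star_sub, star_smul, mulVec_sub, mulVec_smul, sub_dotProduct, dotProduct_sub,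
      smul_dotProduct, dotProduct_smul, smul_eq_mul]
    ring
  have h3 : star t * t = ((‖t‖ ^ 2 : ℝ) : ℂ) := by
    rw [← Complex.normSq_eq_norm_sq]; exact Complex.normSq_eq_conj_mul_self.symm
  unfold quadRe
  rw [h2, h3, Complex.add_re, Complex.sub_re, Complex.add_re, Complex.re_ofReal_mul]
  simp only [Complex.star_def, Complex.conj_re]
  ring

lemma mulVec_fin_one (B : Matrix (Fin n) (Fin 1) ℂ) (v : Fin 1 → ℂ) : B *ᵥ v = v 0 • B.col 0 := by
  ext i; simp [mulVec, dotProduct, mul_comm]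

lemma conjTranspose_mul_mulVec_zero (B : Matrix (Fin n) (Fin 1) ℂ) (PP : Matrix (Fin n) (Fin n) ℂ)
    (x : Fin n → ℂ) : ((Bᴴ * PP) *ᵥ x) 0 = star (B.col 0) ⬝ᵥ PP *ᵥ x := by
  rw [← mulVec_mulVec]; rfl

lemma conjTranspose_mul_mul_zero (B : Matrix (Fin n) (Fin 1) ℂ) (PP : Matrix (Fin n) (Fin n) ℂ) :
    (Bᴴ * PP * B) 0 0 = star (B.col 0) ⬝ᵥ PP *ᵥ B.col 0 := by
  rw [← conjTranspose_mul_mulVec_zero]; rfl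

variable {S PP : Matrix (Fin n) (Fin n) ℂ} {B : Matrix (Fin n) (Fin 1) ℂ}

lemma conjTranspose_mul_mul_zero_eq_quadRe (hPP : PP.IsHermitian) :
    (Bᴴ * PP * B) 0 0 = (quadRe PP (B.col 0) : ℂ) := by
  rw [conjTranspose_mul_mul_zero, eq_comm]
  apply Complex.conj_eq_iff_re.1
  exact hPP.star_dotProduct_mulVec _ _

/-- The correction term has rank one, so its form at `u` is the squared modulus of the single scalar
`Bᴴ 𝒫 S u`, the quantity on which the gain acts. -/
lemma quadRe_riccati (hPP : PP.IsHermitian) (ζ : ℝ) (u : Fin n → ℂ) :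
    quadRe (PP - Sᴴ * PP * S
      + (((1 - ζ ^ 2 : ℝ) : ℂ) / (Bᴴ * PP * B) 0 0) • (Sᴴ * PP * B * Bᴴ * PP * S)) u
    = quadRe PP u - quadRe PP (S *ᵥ u)
      + (1 - ζ ^ 2) / quadRe PP (B.col 0) * ‖star (B.col 0) ⬝ᵥ PP *ᵥ (S *ᵥ u)‖ ^ 2 := by
  set q := star (B.col 0) ⬝ᵥ PP *ᵥ (S *ᵥ u) with hq
  have h1 : star u ⬝ᵥ (Sᴴ * PP * S) *ᵥ u = star (S *ᵥ u) ⬝ᵥ PP *ᵥ (S *ᵥ u) := by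
    rw [star_mulVec, ← dotProduct_mulVec, mulVec_mulVec, mulVec_mulVec, Matrix.mul_assoc]
  have h2 : star u ⬝ᵥ (Sᴴ * PP * B * Bᴴ * PP * S) *ᵥ u = star q * q := by
    have e1 : (Sᴴ * PP * B * Bᴴ * PP * S) *ᵥ u = (Sᴴ * PP) *ᵥ (B *ᵥ ((Bᴴ * PP) *ᵥ (S *ᵥ u))) := by
      simp only [mulVec_mulVec, Matrix.mul_assoc]
    rw [e1, mulVec_fin_one, conjTranspose_mul_mulVec_zero, ← hq, mulVec_smul, dotProduct_smul,
      ← mulVec_mulVec, dotProduct_mulVec, ← star_mulVec, hq,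
      hPP.star_dotProduct_mulVec, smul_eq_mul, mul_comm]
  have h3 : star q * q = ((‖q‖ ^ 2 : ℝ) : ℂ) := by
    rw [← Complex.normSq_eq_norm_sq]; exact Complex.normSq_eq_conj_mul_self.symm
  unfold quadRe
  rw [add_mulVec, sub_mulVec, smul_mulVec, dotProduct_add, dotProduct_sub, dotProduct_smul, h1, h2,
    h3, conjTranspose_mul_mul_zero_eq_quadRe hPP, smul_eq_mul, ← Complex.ofReal_div,
    ← Complex.ofReal_mul, Complex.add_re, Complex.sub_re, Complex.ofReal_re]
  rfl

/-- One step of the noise-free synchronization dynamics with continuous communication. -/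
noncomputable def syncStep (S : Matrix (Fin n) (Fin n) ℂ) (M : Matrix (Fin n) (Fin n) ℂ)
    (a : Matrix (Fin m) (Fin m) ℝ) (D : Fin m → Fin n → ℂ) (i : Fin m) : Fin n → ℂ :=
  S *ᵥ D i + M *ᵥ ∑ j, (a i j : ℂ) • (D j - D i)

lemma mul_syncGain_mulVec (r : ℝ) (hPP : PP.IsHermitian) (X : Fin n → ℂ) :
    (B * ((((r : ℝ) : ℂ) / (Bᴴ * PP * B) 0 0) • (Bᴴ * PP * S))) *ᵥ X
      = (((r / quadRe PP (B.col 0) : ℝ) : ℂ) * (star (B.col 0) ⬝ᵥ PP *ᵥ (S *ᵥ X))) • B.col 0 := by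
  rw [← mulVec_mulVec, mulVec_fin_one, smul_mulVec, Pi.smul_apply, ← mulVec_mulVec,
    conjTranspose_mul_mulVec_zero, conjTranspose_mul_mul_zero_eq_quadRe hPP, ← Complex.ofReal_div,
    smul_eq_mul]

/-- The feedback acts only along `B`. With `q_i = Bᴴ 𝒫 S D_i` and `c = Bᴴ 𝒫 B`, completing the
square gives the energy of step `i` as that of `S D_i` plus `c⁻¹ (|(q - r L q)_i|² - |q_i|²)`. Since
`q` sums to zero, the Laplacian bound makes the total at most `∑ 𝒫(S D_i) - (1 - ζ²) c⁻¹ ∑ |q_i|²`,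
which the Riccati inequality puts strictly below `∑ 𝒫(D_i)`. -/
theorem exists_syncStep_contraction (hm : 2 ≤ m) {a : Matrix (Fin m) (Fin m) ℝ}
    (ha : IsConnectedNetwork a) {μ : Fin m → ℝ}
    (hμ : IsOrderedSpectrum (weightedLaplacian a) μ) {μ₂ μₘ : ℝ} {i₁ iₘ : Fin m}
    (hμ₂ : μ₂ = μ i₁) (hμₘ : μₘ = μ iₘ) (hi₁ : (i₁ : ℕ) = 1) (hiₘ : (iₘ : ℕ) = m - 1)
    {ζ : ℝ} (hζ : 0 < ζ)
    (hζ' : ζ⁻¹ * (1 - μ₂ / μₘ) ≤ 1 + μ₂ / μₘ) (hPP : SolvesRiccatiInequality ζ S B PP) :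
    ∃ θ, 0 ≤ θ ∧ θ < 1 ∧ ∀ D : Fin m → Fin n → ℂ, ∑ i, D i = 0 →
      ∑ i, quadRe PP (syncStep S (B * syncGain μ₂ μₘ S B PP) a D i) ≤ θ * ∑ i, quadRe PP (D i) := by
  obtain ⟨κ, hκ, hle⟩ := hPP.2.exists_pos_le
  have hH := hPP.1.1
  -- The summand `1` keeps `C` positive even if there are no coordinates.
  set C : ℝ := 1 + ∑ i, ∑ j, ‖PP i j‖ with hC
  have hCpos : 0 < C := by positivity
  have hCle : ∀ u, quadRe PP u ≤ C * sqNorm u := fun u => by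
    refine ((Complex.re_le_norm _).trans (norm_quadForm_le PP u)).trans ?_
    have := sqNorm_nonneg u
    gcongr; linarith
  have hnn : ∀ u, 0 ≤ quadRe PP u := fun u => hPP.1.posSemidef.re_dotProduct_nonneg u
  have hκC : 0 < κ / C := by positivity
  -- The Riccati matrix dominates `κ` and `𝒫` is at most `C`, whence the rate `1 - κ / C`; the
  -- maximum with `0` secures nonnegativity.
  refine ⟨max (1 - κ / C) 0, le_max_right _ _, max_lt (by linarith) one_pos, fun D hD => ?_⟩
  set r := 2 / (μ₂ + μₘ) with hr
  set c := quadRe PP (B.col 0) with hc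
  have hcnn : 0 ≤ c := hnn _
  set q : Fin m → ℂ := fun i => star (B.col 0) ⬝ᵥ PP *ᵥ (S *ᵥ D i) with hq
  have hqsum : ∑ i, q i = 0 := by
    simp only [hq]
    rw [← dotProduct_sum, ← mulVec_sum, ← mulVec_sum, hD]; simp
  have hstep : ∀ i, quadRe PP (syncStep S (B * syncGain μ₂ μₘ S B PP) a D i)
      = quadRe PP (S *ᵥ D i)
        + c⁻¹ * (‖(q - (r : ℂ) • toC (weightedLaplacian a) *ᵥ q) i‖ ^ 2 - ‖q i‖ ^ 2) := by
    intro i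
    set l := (toC (weightedLaplacian a) *ᵥ q) i with hl
    have h1 : star (B.col 0) ⬝ᵥ PP *ᵥ (S *ᵥ ∑ j, (a i j : ℂ) • (D j - D i)) = -l := by
      rw [hl, toC_weightedLaplacian_mulVec]
      simp only [mulVec_sum, dotProduct_sum, mulVec_smul, mulVec_sub, dotProduct_smul,
        dotProduct_sub, hq, smul_eq_mul, ← Finset.sum_neg_distrib]
      exact Finset.sum_congr rfl fun j _ => by ring
    have h2 : syncStep S (B * syncGain μ₂ μₘ S B PP) a D i
        = S *ᵥ D i - (((r / c : ℝ) : ℂ) * l) • B.col 0 := by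
      rw [syncStep, syncGain, mul_syncGain_mulVec _ hH, h1, mul_neg, neg_smul, ← sub_eq_add_neg]
    rw [h2, quadRe_sub_smul hH]
    have h3 : ‖(q - (r : ℂ) • toC (weightedLaplacian a) *ᵥ q) i‖ ^ 2 - ‖q i‖ ^ 2
        = - 2 * r * (star l * q i).re + r ^ 2 * ‖l‖ ^ 2 := by
      rw [Pi.sub_apply, Pi.smul_apply, ← hl, ← Complex.normSq_eq_norm_sq,
        ← Complex.normSq_eq_norm_sq, ← Complex.normSq_eq_norm_sq]
      simp [Complex.normSq_apply]; ring
    have h4 : (star (((r / c : ℝ) : ℂ) * l) * q i).re = r * c⁻¹ * (star l * q i).re := by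
      rw [star_mul', mul_assoc, Complex.star_def, Complex.conj_ofReal, Complex.re_ofReal_mul,
        div_eq_mul_inv]
    have h5 : ‖((r / c : ℝ) : ℂ) * l‖ ^ 2 * c = c⁻¹ * r ^ 2 * ‖l‖ ^ 2 := by
      rw [norm_mul, Complex.norm_real, mul_pow, Real.norm_eq_abs, sq_abs]
      -- If `c = 0`, division by zero makes the gain zero and both sides vanish.
      rcases eq_or_ne c 0 with h | h
      · simp [h]
      · field_simp
    rw [h4, h3, ← hc, h5]
    ring
  have hlap := sqNorm_sub_laplacian_le hm ha hμ hμ₂ hμₘ hi₁ hiₘ hζ hζ' hqsum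
  rw [← hr] at hlap
  have hsum : ∑ i, quadRe PP (syncStep S (B * syncGain μ₂ μₘ S B PP) a D i)
      ≤ ∑ i, quadRe PP (S *ᵥ D i) - (1 - ζ ^ 2) / c * ∑ i, ‖q i‖ ^ 2 := by
    simp only [hstep, Finset.sum_add_distrib, ← Finset.mul_sum, Finset.sum_sub_distrib]
    have h1 : c⁻¹ * (∑ i, ‖(q - (r : ℂ) • toC (weightedLaplacian a) *ᵥ q) i‖ ^ 2 - ∑ i, ‖q i‖ ^ 2)
        ≤ c⁻¹ * (ζ ^ 2 * ∑ i, ‖q i‖ ^ 2 - ∑ i, ‖q i‖ ^ 2) := by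
      have := inv_nonneg.2 hcnn
      gcongr
      exact hlap
    have h2 : c⁻¹ * (ζ ^ 2 * ∑ i, ‖q i‖ ^ 2 - ∑ i, ‖q i‖ ^ 2)
        = - ((1 - ζ ^ 2) / c * ∑ i, ‖q i‖ ^ 2) := by
      rw [div_eq_mul_inv]; ring
    linarith
  have hric : ∀ i, κ / C * quadRe PP (D i) ≤ quadRe PP (D i) - quadRe PP (S *ᵥ D i)
      + (1 - ζ ^ 2) / c * ‖q i‖ ^ 2 := by
    intro i
    rw [hc, hq, ← quadRe_riccati hH]
    refine le_trans ?_ (hle (D i))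
    rw [div_mul_eq_mul_div, div_le_iff₀ hCpos]
    nlinarith [hCle (D i)]
  have hric' := Finset.sum_le_sum fun i (_ : i ∈ Finset.univ) => hric i
  simp only [Finset.sum_add_distrib, ← Finset.mul_sum, Finset.sum_sub_distrib] at hric'
  have hW : 0 ≤ ∑ i, quadRe PP (D i) := Finset.sum_nonneg fun i _ => hnn _
  calc _ ≤ (1 - κ / C) * ∑ i, quadRe PP (D i) := by linarith
    _ ≤ _ := by gcongr; exact le_max_left _ _

end SyncContraction

/-! ### Real matrices regarded as complex ones. -/

section Complexification

variable {ι κ ν : Type*}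

lemma toC_mul [Fintype κ] (M : Matrix ι κ ℝ) (N : Matrix κ ν ℝ) : toC (M * N) = toC M * toC N :=
  Matrix.map_mul (f := Complex.ofRealHom)

lemma toC_add (M N : Matrix ι κ ℝ) : toC (M + N) = toC M + toC N := by
  ext; simp [toC]

lemma toC_sub (M N : Matrix ι κ ℝ) : toC (M - N) = toC M - toC N := by
  ext; simp [toC]

lemma toC_transpose (M : Matrix ι κ ℝ) : toC Mᵀ = (toC M)ᴴ := by
  ext; simp [toC]

lemma exists_transpose_mul_self [Fintype ι] [DecidableEq ι] {M : Matrix ι ι ℝ}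
    (hM : M.PosSemidef) : ∃ N : Matrix ι ι ℝ, M = Nᵀ * N := by
  refine ⟨diagonal (fun i => Real.sqrt (hM.1.eigenvalues i)) *
    star (hM.1.eigenvectorUnitary : Matrix ι ι ℝ), ?_⟩
  conv_lhs => rw [hM.1.spectral_theorem, Unitary.conjStarAlgAut_apply]
  rw [← conjTranspose_eq_transpose_of_trivial, conjTranspose_mul, ← star_eq_conjTranspose (star _),
    star_star, diagonal_conjTranspose, Matrix.mul_assoc,
    Matrix.mul_assoc, ← Matrix.mul_assoc (diagonal _) (diagonal _), diagonal_mul_diagonal]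
  congr 3
  ext i
  simp [Real.mul_self_sqrt (hM.eigenvalues_nonneg i)]

/-- Real positivity tests real vectors only. A factorization `Nᵀ N` carries it over to complex ones.
-/
lemma toC_posSemidef [Fintype ι] {M : Matrix ι ι ℝ} (hM : M.PosSemidef) : (toC M).PosSemidef := by
  classical
  obtain ⟨N, rfl⟩ := exists_transpose_mul_self hM
  rw [toC_mul, toC_transpose]
  exact posSemidef_conjTranspose_mul_self _

lemma toC_posDef [Fintype ι] [DecidableEq ι] {M : Matrix ι ι ℝ} (hM : M.PosDef) :
    (toC M).PosDef := by
  obtain ⟨N, hN⟩ := exists_transpose_mul_self hM.posSemidef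
  have h1 : IsUnit (N.det * N.det) := by
    have := (Matrix.isUnit_iff_isUnit_det _).1 hM.isUnit
    rwa [hN, det_mul, det_transpose] at this
  have h2 : N.det ≠ 0 := fun h => by simp [h] at h1
  have h3 : (toC N).det ≠ 0 := by
    have : (toC N).det = (N.det : ℂ) := (RingHom.map_det Complex.ofRealHom N).symm
    rw [this]; exact_mod_cast h2
  rw [hN, toC_mul, toC_transpose]
  exact Matrix.PosDef.conjTranspose_mul_self _ (mulVec_injective_iff_isUnit.2
    ((Matrix.isUnit_iff_isUnit_det _).2 (isUnit_iff_ne_zero.2 h3)))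

lemma quadRe_mul_mul_conjTranspose [Fintype ι] [Fintype κ] (M : Matrix ι κ ℂ) (X : Matrix κ κ ℂ)
    (u : ι → ℂ) : quadRe (M * X * Mᴴ) u = quadRe X (Mᴴ *ᵥ u) := by
  unfold quadRe
  rw [star_mulVec, conjTranspose_conjTranspose, ← dotProduct_mulVec, mulVec_mulVec, mulVec_mulVec,
    Matrix.mul_assoc]

lemma quadRe_add [Fintype ι] (M N : Matrix ι ι ℂ) (u : ι → ℂ) :
    quadRe (M + N) u = quadRe M u + quadRe N u := by
  simp [quadRe, add_mulVec, dotProduct_add]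

lemma quadRe_sub [Fintype ι] (M N : Matrix ι ι ℂ) (u : ι → ℂ) :
    quadRe (M - N) u = quadRe M u - quadRe N u := by
  simp [quadRe, sub_mulVec, dotProduct_sub]

lemma quadRe_smul [Fintype ι] (M : Matrix ι ι ℂ) (c : ℂ) (u : ι → ℂ) :
    quadRe M (c • u) = ‖c‖ ^ 2 * quadRe M u := by
  have h3 : star c * c = ((‖c‖ ^ 2 : ℝ) : ℂ) := by
    rw [← Complex.normSq_eq_norm_sq]; exact Complex.normSq_eq_conj_mul_self.symm
  unfold quadRe
  rw [mulVec_smul, star_smul, smul_dotProduct, dotProduct_smul, smul_smul, h3, smul_eq_mul,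
    Complex.re_ofReal_mul]

lemma quadRe_nonneg [Fintype ι] {M : Matrix ι ι ℂ} (hM : M.PosSemidef) (u : ι → ℂ) :
    0 ≤ quadRe M u := hM.re_dotProduct_nonneg u

end Complexification

/-! ### The Riccati recursion and the spectrum of the closed loop. -/

section Riccati

variable {n m : ℕ} {A : Matrix (Fin n) (Fin n) ℝ} {C : Matrix (Fin m) (Fin n) ℝ}
  {Q : Matrix (Fin n) (Fin n) ℝ} {R : Matrix (Fin m) (Fin m) ℝ} {Sig0 : Matrix (Fin n) (Fin n) ℝ}
  {X P : Matrix (Fin n) (Fin n) ℝ}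

lemma kalmanGain_mul_innovationCov (hX : IsUnit (innovationCov C R X).det) :
    kalmanGain C R X * (C * X * Cᵀ + R) = X * Cᵀ := by
  have : C * X * Cᵀ + R = innovationCov C R X := rfl
  rw [this, kalmanGain, Matrix.mul_assoc, nonsing_inv_mul _ hX, Matrix.mul_one]

/-- The Joseph form of the measurement update. -/
lemma filteredCov_eq_joseph (hX : IsUnit (innovationCov C R X).det) :
    filteredCov C R X = (1 - kalmanGain C R X * C) * X * (1 - kalmanGain C R X * C)ᵀ
      + kalmanGain C R X * R * (kalmanGain C R X)ᵀ := by
  have h := congrArg (· * (kalmanGain C R X)ᵀ) (kalmanGain_mul_innovationCov hX)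
  set L := kalmanGain C R X with hL
  simp only [Matrix.mul_add, Matrix.add_mul, Matrix.mul_assoc] at h
  simp only [filteredCov, ← hL, transpose_sub, transpose_one, transpose_mul, Matrix.sub_mul,
    Matrix.mul_sub, Matrix.one_mul, Matrix.mul_one, Matrix.mul_assoc]
  rw [eq_sub_of_add_eq' h]; abel

lemma posSemidef_mul_mul_transpose {ι κ : Type*} [Fintype ι] [Fintype κ] {X : Matrix ι ι ℝ}
    (hX : X.PosSemidef) (M : Matrix κ ι ℝ) :
    (M * X * Mᵀ).PosSemidef := by
  rw [← conjTranspose_eq_transpose_of_trivial]; exact hX.mul_mul_conjTranspose_same M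

lemma filteredCov_posSemidef (hX : IsUnit (innovationCov C R X).det) (hXp : X.PosSemidef)
    (hR : R.PosSemidef) : (filteredCov C R X).PosSemidef := by
  rw [filteredCov_eq_joseph hX]
  exact (posSemidef_mul_mul_transpose hXp _).add (posSemidef_mul_mul_transpose hR _)

lemma predictionCov_posSemidef (hQ : Q.PosSemidef) (hR : R.PosSemidef) (hSig0 : Sig0.PosSemidef)
    (hinv : ∀ k, IsUnit (innovationCov C R (predictionCov A C Q R Sig0 k)).det) (k : ℕ) :
    (predictionCov A C Q R Sig0 k).PosSemidef := by
  induction k with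
  | zero => exact (posSemidef_mul_mul_transpose hSig0 A).add hQ
  | succ k ih =>
    exact (posSemidef_mul_mul_transpose (filteredCov_posSemidef (hinv k) ih hR) A).add hQ

lemma posSemidef_of_tendsto {ι : Type*} [Fintype ι] {f : ℕ → Matrix ι ι ℝ} {X : Matrix ι ι ℝ}
    (hf : ∀ k, (f k).PosSemidef) (h : Tendsto f atTop (𝓝 X)) : X.PosSemidef := by
  refine PosSemidef.of_dotProduct_mulVec_nonneg ?_ fun x => ?_
  · have h1 : Tendsto (fun k => (f k)ᴴ) atTop (𝓝 Xᴴ) := (continuous_id.matrix_conjTranspose.tendsto X).comp h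
    have h2 : (fun k => (f k)ᴴ) = f := funext fun k => (hf k).1
    rw [h2] at h1
    exact tendsto_nhds_unique h1 h
  · have hc : Continuous fun M : Matrix ι ι ℝ => star x ⬝ᵥ M *ᵥ x := by fun_prop
    exact ge_of_tendsto ((hc.tendsto X).comp h) (Eventually.of_forall fun k =>
      (hf k).dotProduct_mulVec_nonneg x)

lemma tendsto_matrix_inv {ι : Type*} [Fintype ι] [DecidableEq ι] {f : ℕ → Matrix ι ι ℝ}
    {X : Matrix ι ι ℝ} (h : Tendsto f atTop (𝓝 X)) (hX : IsUnit X.det) :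
    Tendsto (fun k => (f k)⁻¹) atTop (𝓝 X⁻¹) := by
  have h1 : Continuous fun M : Matrix ι ι ℝ => M.det := by fun_prop
  have h2 : Continuous fun M : Matrix ι ι ℝ => M.adjugate := by fun_prop
  simp only [Matrix.inv_def, Ring.inverse_eq_inv']
  exact (((h1.tendsto X).comp h).inv₀ hX.ne_zero).smul ((h2.tendsto X).comp h)

lemma tendsto_kalmanGain {f : ℕ → Matrix (Fin n) (Fin n) ℝ} (h : Tendsto f atTop (𝓝 P))
    (hP : IsUnit (innovationCov C R P).det) :
    Tendsto (fun k => kalmanGain C R (f k)) atTop (𝓝 (kalmanGain C R P)) := by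
  have hc : Continuous fun X : Matrix (Fin n) (Fin n) ℝ => innovationCov C R X := by
    unfold innovationCov; fun_prop
  have h2 := tendsto_matrix_inv ((hc.tendsto P).comp h) hP
  have hc' : Continuous fun p : Matrix (Fin n) (Fin n) ℝ × Matrix (Fin m) (Fin m) ℝ =>
      p.1 * Cᵀ * p.2 := by fun_prop
  have h3 := (hc'.tendsto (P, (innovationCov C R P)⁻¹)).comp (h.prodMk_nhds h2)
  exact h3

lemma tendsto_filteredCov {f : ℕ → Matrix (Fin n) (Fin n) ℝ} (h : Tendsto f atTop (𝓝 P))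
    (hP : IsUnit (innovationCov C R P).det) :
    Tendsto (fun k => filteredCov C R (f k)) atTop (𝓝 (filteredCov C R P)) := by
  have hc : Continuous fun p : Matrix (Fin n) (Fin n) ℝ × Matrix (Fin n) (Fin m) ℝ =>
      p.1 - p.2 * C * p.1 := by fun_prop
  simp only [filteredCov]
  exact (hc.tendsto (P, kalmanGain C R P)).comp (h.prodMk_nhds (tendsto_kalmanGain h hP))

lemma riccati_fixed_point (hP : Tendsto (predictionCov A C Q R Sig0) atTop (𝓝 P))
    (hPinv : IsUnit (innovationCov C R P).det) : P = A * filteredCov C R P * Aᵀ + Q := by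
  have hc : Continuous fun X : Matrix (Fin n) (Fin n) ℝ => A * X * Aᵀ + Q := by fun_prop
  have h1 := (hc.tendsto _).comp (tendsto_filteredCov hP hPinv)
  exact tendsto_nhds_unique ((tendsto_add_atTop_iff_nat 1).2 hP) h1

lemma predictionCov_eq_of_steady (hP : P = A * filteredCov C R P * Aᵀ + Q)
    (h : Sig0 = filteredCov C R P) (k : ℕ) : predictionCov A C Q R Sig0 k = P := by
  induction k with
  | zero => rw [predictionCov, h, ← hP]
  | succ k ih => rw [predictionCov, ih, ← hP]

/-- The difference is `P Cᵀ (C P Cᵀ + R)⁻¹ C P`, a congruence of a positive semidefinite matrix. -/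
lemma sub_filteredCov_posSemidef (hP : P.PosSemidef) (hR : R.PosSemidef) :
    (P - filteredCov C R P).PosSemidef := by
  have h1 : P - filteredCov C R P = P * Cᵀ * (innovationCov C R P)⁻¹ * (P * Cᵀ)ᵀ := by
    have : Pᵀ = P := hP.1
    rw [filteredCov, sub_sub_cancel, kalmanGain, transpose_mul, transpose_transpose, this]
    simp only [Matrix.mul_assoc]
  rw [h1]
  exact posSemidef_mul_mul_transpose ((posSemidef_mul_mul_transpose hP C).add hR).inv _

lemma mem_roots_charpoly_of_vecMul {ι : Type*} [Fintype ι] [DecidableEq ι] {M : Matrix ι ι ℂ}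
    {u : ι → ℂ} {l : ℂ} (hu : u ≠ 0) (h : u ᵥ* M = l • u) : l ∈ M.charpoly.roots := by
  rw [Polynomial.mem_roots M.charpoly_monic.ne_zero, Polynomial.IsRoot, Matrix.eval_charpoly,
    ← exists_vecMul_eq_zero_iff]
  refine ⟨u, hu, ?_⟩
  rw [vecMul_sub, h, scalar_apply, ← smul_one_eq_diagonal, vecMul_smul, vecMul_one, sub_self]

variable {K : Matrix (Fin n) (Fin m) ℝ} {V : Matrix (Fin n) (Fin n) ℂ} {lam : Fin n → ℂ}

lemma row_inv_vecMul (hV : IsUnit V.det)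
    (hdiag : toC (A - K * C * A) = V * Matrix.diagonal lam * V⁻¹) (r : Fin n) :
    V⁻¹.row r ᵥ* toC (A - K * C * A) = lam r • V⁻¹.row r := by
  have h : V⁻¹ * toC (A - K * C * A) = Matrix.diagonal lam * V⁻¹ := by
    rw [hdiag, Matrix.mul_assoc, ← Matrix.mul_assoc, nonsing_inv_mul _ hV, Matrix.one_mul]
  ext j
  have := congrFun (congrFun h r) j
  rw [diagonal_mul] at this
  exact this

lemma row_inv_ne_zero (hV : IsUnit V.det) (r : Fin n) : V⁻¹.row r ≠ 0 := by
  intro h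
  have h1 : (V⁻¹ * V) r r = 0 := by
    rw [mul_apply]; exact Finset.sum_eq_zero fun j _ => by
      have : V⁻¹ r j = 0 := congrFun h j
      rw [this, zero_mul]
  rw [nonsing_inv_mul _ hV, one_apply_eq] at h1
  exact one_ne_zero h1

/-- A left eigenvector of `A - K C A` that annihilates `K` does not see the correction term, so it
is a left eigenvector of `A` for the same eigenvalue. The disjoint spectra exclude this. -/
lemma row_inv_vecMul_gain_ne_zero (hV : IsUnit V.det)
    (hdisjoint : Disjoint (toC (A - K * C * A)).charpoly.roots (toC A).charpoly.roots)
    (hdiag : toC (A - K * C * A) = V * Matrix.diagonal lam * V⁻¹) (r : Fin n) :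
    V⁻¹.row r ᵥ* toC K ≠ 0 := by
  intro h
  have h1 := row_inv_vecMul hV hdiag r
  have h2 : V⁻¹.row r ᵥ* toC A = lam r • V⁻¹.row r := by
    rw [← h1, toC_sub, toC_mul, toC_mul, vecMul_sub, ← vecMul_vecMul, ← vecMul_vecMul, h,
      zero_vecMul, zero_vecMul, sub_zero]
  have hne := row_inv_ne_zero hV r
  exact Multiset.disjoint_left.1 hdisjoint (mem_roots_charpoly_of_vecMul hne h1)
    (mem_roots_charpoly_of_vecMul hne h2)

/-- For `R > 0`, evaluate the Lyapunov equation of `P⁺` at a left eigenvector `u`: the number `(1 -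
|λ|²) u P⁺ uᴴ` equals a nonnegative term from `Q` plus `(u K) R (u K)ᴴ`, which is positive because
`u K ≠ 0`. Hence `|λ| < 1`. -/
theorem norm_eigenvalue_lt_one (hQ : Q.PosSemidef) (hR : R.PosSemidef) (hP : P.PosSemidef)
    (hfix : P = A * filteredCov C R P * Aᵀ + Q) (hPinv : IsUnit (innovationCov C R P).det)
    (hK : K = kalmanGain C R P) (hstable : R.PosDef ∨ IsSchurStable (A - K * C * A))
    (hdisjoint : Disjoint (toC (A - K * C * A)).charpoly.roots (toC A).charpoly.roots)
    (hV : IsUnit V.det) (hdiag : toC (A - K * C * A) = V * Matrix.diagonal lam * V⁻¹)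
    (r : Fin n) : ‖lam r‖ < 1 := by
  have h1 := row_inv_vecMul hV hdiag r
  rcases hstable with hRp | hs
  swap
  · exact hs _ (mem_roots_charpoly_of_vecMul (row_inv_ne_zero hV r) h1)
  by_contra! hlam
  have hne := row_inv_vecMul_gain_ne_zero hV hdisjoint hdiag r
  set u := V⁻¹.row r
  have hlyap : toC (filteredCov C R P) = toC (A - K * C * A) * toC (filteredCov C R P)
        * (toC (A - K * C * A))ᴴ + toC (1 - K * C) * toC Q * (toC (1 - K * C))ᴴ
        + toC K * toC R * (toC K)ᴴ := by
    simp only [← toC_transpose, ← toC_mul, ← toC_add]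
    have h2 : A - K * C * A = (1 - K * C) * A := by rw [Matrix.sub_mul, Matrix.one_mul]
    have h3 := filteredCov_eq_joseph hPinv
    rw [← hK] at h3
    conv_lhs => rw [h3]
    -- Only the middle factor `P` of the Joseph form is replaced, since the fixed-point equation
    -- again contains `P`.
    conv_lhs => arg 1; arg 1; arg 1; arg 2; rw [hfix]
    rw [h2, Matrix.mul_add, Matrix.add_mul, transpose_mul]
    simp only [Matrix.mul_assoc]
  have hcon : ∀ {k : ℕ} (M : Matrix (Fin n) (Fin k) ℂ), Mᴴ *ᵥ star u = star (u ᵥ* M) := fun M =>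
    (star_vecMul _ _).symm
  have hq := congrArg (quadRe · (star u)) hlyap
  simp only [quadRe_add, quadRe_mul_mul_conjTranspose, hcon, h1, star_smul, quadRe_smul,
    norm_star] at hq
  have hp := quadRe_nonneg (toC_posSemidef (filteredCov_posSemidef hPinv hP hR)) (star u)
  have hQn := quadRe_nonneg (toC_posSemidef hQ) (star (u ᵥ* toC (1 - K * C)))
  have hRn : 0 < quadRe (toC R) (star (u ᵥ* toC K)) :=
    (toC_posDef hRp).re_dotProduct_pos (star_ne_zero.2 hne)
  have : 1 ≤ ‖lam r‖ ^ 2 := one_le_pow₀ hlam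
  nlinarith

/-- Every row `r` of `V⁻¹ K` has a nonzero entry, say in column `j r`. The right inverse feeds mode
`r` through the coordinate `(j r, r)` alone, rescaled by that entry. -/
lemma exists_fusionMatrix_mul_eq_one (hV : IsUnit V.det)
    (hdisjoint : Disjoint (toC (A - K * C * A)).charpoly.roots (toC A).charpoly.roots)
    (hdiag : toC (A - K * C * A) = V * Matrix.diagonal lam * V⁻¹) :
    ∃ G : Matrix (Fin m × Fin n) (Fin n) ℂ, fusionMatrix V K * G = 1 := by
  have h : ∀ r, ∃ j, (V⁻¹ *ᵥ (toC K).col j) r ≠ 0 := by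
    intro r
    by_contra! h
    exact row_inv_vecMul_gain_ne_zero hV hdisjoint hdiag r (funext fun j => h j)
  choose j hj using h
  refine ⟨Matrix.of fun p q => if p.1 = j p.2 then
    ((V⁻¹ *ᵥ (toC K).col (j p.2)) p.2)⁻¹ * V⁻¹ p.2 q else 0, ?_⟩
  rw [← mul_nonsing_inv _ hV]
  ext q p
  simp only [mul_apply, fusionMatrix, of_apply, diagonal_apply, Fintype.sum_prod_type_right]
  refine Finset.sum_congr rfl fun r _ => ?_
  simp [mul_assoc, mul_inv_cancel_left₀ (hj r)]

end Riccati

/-! ### The local filters and their fusion. -/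

section LocalFilters

variable {n m : ℕ}

lemma toC_mulVec_ofReal {ι κ : Type*} [Fintype κ] (M : Matrix ι κ ℝ) (u : κ → ℝ) :
    (toC M *ᵥ fun j => (u j : ℂ)) = fun i => ((M *ᵥ u) i : ℂ) := by
  ext i; simp [toC, mulVec, dotProduct]

lemma one_kronecker_mulVec_apply {ι κ ν : Type*} [Fintype ι] [DecidableEq ι] [Fintype ν]
    (M : Matrix κ ν ℂ) (u : ι × ν → ℂ) (b : ι) (r : κ) :
    (((1 : Matrix ι ι ℂ) ⊗ₖ M) *ᵥ u) (b, r) = (M *ᵥ fun r' => u (b, r')) r := by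
  simp [mulVec, dotProduct, Fintype.sum_prod_type, one_apply]

lemma localFilter_succ_eq_output (lam β : Fin n → ℂ) (y : ℕ → Fin m → ℝ) (i : Fin m) (k : ℕ) :
    localFilter lam β y i (k + 1)
      = filterMatrix lam β *ᵥ localFilter lam β y i k + fun _ => localOutput lam β y k i := rfl

/-- The term `1 βᵀ` of `S` cancels against the `β` term of the output, leaving `n` uncoupled scalar
filters with poles `λ_r`, all driven by the raw measurement. -/
lemma localFilter_succ_apply (lam β : Fin n → ℂ) (y : ℕ → Fin m → ℝ) (i : Fin m) (k : ℕ)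
    (r : Fin n) :
    localFilter lam β y i (k + 1) r = lam r * localFilter lam β y i k r + (y (k + 1) i : ℂ) := by
  simp only [localFilter, filterMatrix, add_mulVec, Pi.add_apply, mulVec_diagonal,
    vecMulVec_mulVec]
  simp

lemma fusionMatrix_apply (V : Matrix (Fin n) (Fin n) ℂ) (K : Matrix (Fin n) (Fin m) ℝ)
    (q r : Fin n) (b : Fin m) : fusionMatrix V K q (b, r) = V q r * (V⁻¹ * toC K) r b := by
  rw [fusionMatrix, of_apply, mul_diagonal]
  rfl

lemma fusionMatrix_mulVec (V : Matrix (Fin n) (Fin n) ℂ) (K : Matrix (Fin n) (Fin m) ℝ)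
    (u : Fin m × Fin n → ℂ) :
    fusionMatrix V K *ᵥ u = V *ᵥ fun r => ∑ b, (V⁻¹ * toC K) r b * u (b, r) := by
  ext q
  rw [mulVec, dotProduct, mulVec, dotProduct, Fintype.sum_prod_type_right]
  refine Finset.sum_congr rfl fun r _ => ?_
  rw [Finset.mul_sum]
  exact Finset.sum_congr rfl fun b _ => by rw [fusionMatrix_apply, mul_assoc]

/-- In the coordinates `V⁻¹`, mode `r` of the Kalman estimate is a scalar filter with pole `λ_r` and
input `∑ b, (V⁻¹ K)_{rb} y_b`. By linearity it is the same combination of the `r`th coordinates of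
the local filters. -/
lemma kalmanEstimate_eq_fusion {A : Matrix (Fin n) (Fin n) ℝ} {C : Matrix (Fin m) (Fin n) ℝ}
    {K : Matrix (Fin n) (Fin m) ℝ} {V : Matrix (Fin n) (Fin n) ℂ} {lam : Fin n → ℂ}
    (hV : IsUnit V.det) (hdiag : toC (A - K * C * A) = V * Matrix.diagonal lam * V⁻¹)
    (β : Fin n → ℂ) (y : ℕ → Fin m → ℝ) (k : ℕ) :
    (fusionMatrix V K *ᵥ fun p => localFilter lam β y p.1 k p.2)
      = fun r => (kalmanEstimate A C K y k r : ℂ) := by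
  induction k with
  | zero => ext r; simp [localFilter, kalmanEstimate, mulVec, dotProduct]
  | succ k ih =>
    have h1 : (fun r => ((kalmanEstimate A C K y (k + 1)) r : ℂ))
        = toC (A - K * C * A) *ᵥ (fun r => (kalmanEstimate A C K y k r : ℂ))
          + toC K *ᵥ fun b => (y (k + 1) b : ℂ) := by
      rw [toC_mulVec_ofReal, toC_mulVec_ofReal]
      ext r; simp [kalmanEstimate]
    rw [h1, ← ih, fusionMatrix_mulVec, fusionMatrix_mulVec, hdiag, mulVec_mulVec,
      nonsing_inv_mul_cancel_right _ _ hV, ← mulVec_mulVec]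
    have h2 : toC K *ᵥ (fun b => (y (k + 1) b : ℂ))
        = V *ᵥ ((V⁻¹ * toC K) *ᵥ fun b => (y (k + 1) b : ℂ)) := by
      rw [mulVec_mulVec, ← Matrix.mul_assoc, mul_nonsing_inv _ hV, Matrix.one_mul]
    rw [h2, ← mulVec_add]
    congr 1
    ext r
    simp only [localFilter_succ_apply, Pi.add_apply, mulVec_diagonal, mul_add,
      Finset.sum_add_distrib, Finset.mul_sum]
    congr 1
    exact Finset.sum_congr rfl fun b _ => by ring

/-- Deviation of the local filter of sensor `i` from its target `G_i x`. -/
noncomputable def localError (lam β : Fin n → ℂ) (G : Matrix (Fin n) (Fin n) ℂ)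
    (x : ℕ → Fin n → ℝ) (y : ℕ → Fin m → ℝ) (i : Fin m) (k : ℕ) : Fin n → ℂ :=
  localFilter lam β y i k - G *ᵥ fun r => (x k r : ℂ)

variable {A : Matrix (Fin n) (Fin n) ℝ} {C : Matrix (Fin m) (Fin n) ℝ} {lam β : Fin n → ℂ}
  {G : Matrix (Fin n) (Fin n) ℂ} {x : ℕ → Fin n → ℝ} {w : ℕ → Fin n → ℝ} {v y : ℕ → Fin m → ℝ}
  {i : Fin m}

lemma ofReal_measurement_succ (hx : ∀ k, x (k + 1) = A *ᵥ x k + w k)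
    (hy : ∀ k, y k = C *ᵥ x k + v k) (k : ℕ) :
    (y (k + 1) i : ℂ) = ((toC C).row i ᵥ* toC A) ⬝ᵥ (fun r => (x k r : ℂ))
      + ((C *ᵥ w k) i + v (k + 1) i : ℝ) := by
  have h1 : ((toC C).row i ᵥ* toC A) ⬝ᵥ (fun r => (x k r : ℂ)) = ((C *ᵥ (A *ᵥ x k)) i : ℂ) := by
    rw [← dotProduct_mulVec, toC_mulVec_ofReal]
    exact congrFun (toC_mulVec_ofReal C (A *ᵥ x k)) i
  rw [h1, hy, hx, Pi.add_apply, mulVec_add, Pi.add_apply]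
  push_cast; ring

/-- The equation for `G` makes `G x` follow the recursion of the local filter up to noise. The plant
state cancels from the difference, which is stable as soon as `|λ_r| < 1`. -/
lemma localError_succ (hx : ∀ k, x (k + 1) = A *ᵥ x k + w k)
    (hy : ∀ k, y k = C *ᵥ x k + v k)
    (hG : (G - Matrix.vecMulVec (fun _ => 1) ((toC C).row i)) * toC A = Matrix.diagonal lam * G)
    (k : ℕ) (r : Fin n) :
    localError lam β G x y i (k + 1) r = lam r * localError lam β G x y i k r
      + (((C *ᵥ w k) i + v (k + 1) i : ℝ) - (G *ᵥ fun r => (w k r : ℂ)) r) := by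
  have h1 : (G *ᵥ fun r => (x (k + 1) r : ℂ)) r = lam r * (G *ᵥ fun r => (x k r : ℂ)) r
      + ((toC C).row i ᵥ* toC A) ⬝ᵥ (fun r => (x k r : ℂ)) + (G *ᵥ fun r => (w k r : ℂ)) r := by
    have h2 : (fun r => (x (k + 1) r : ℂ))
        = (toC A *ᵥ fun r => (x k r : ℂ)) + fun r => (w k r : ℂ) := by
      rw [toC_mulVec_ofReal, hx]; ext r; simp
    have h3 : G * toC A = Matrix.diagonal lam * G
        + Matrix.vecMulVec (fun _ => 1) ((toC C).row i) * toC A := by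
      rw [← hG, Matrix.sub_mul, sub_add_cancel]
    rw [h2, mulVec_add, mulVec_mulVec, h3, add_mulVec, ← mulVec_mulVec, vecMulVec_mul,
      vecMulVec_mulVec, Pi.add_apply, Pi.add_apply, mulVec_diagonal]
    simp
  simp only [localError, Pi.sub_apply, localFilter_succ_apply, h1, ofReal_measurement_succ hx hy]
  ring

/-- The relation `βᵀ G_i = C_i A` removes the plant state from the output; only noise and the local
error remain. -/
lemma localOutput_eq_localError (hx : ∀ k, x (k + 1) = A *ᵥ x k + w k)
    (hy : ∀ k, y k = C *ᵥ x k + v k) (hβ : β ᵥ* G = (toC C).row i ᵥ* toC A) (k : ℕ) :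
    localOutput lam β y k i = ((C *ᵥ w k) i + v (k + 1) i : ℝ)
      - β ⬝ᵥ localError lam β G x y i k := by
  rw [localOutput, ofReal_measurement_succ hx hy, localError, dotProduct_sub, dotProduct_mulVec, hβ]
  ring

end LocalFilters

/-! ### Conservation of the sum and the triggering rule. -/

section EventTriggered

variable {n m : ℕ} {S : Matrix (Fin n) (Fin n) ℂ} {B : Matrix (Fin n) (Fin 1) ℂ}
  {Γ : Matrix (Fin 1) (Fin n) ℂ} {a : Matrix (Fin m) (Fin m) ℝ} {c₀ c₁ ϱ : ℝ}
  {z : ℕ → Fin m → ℂ}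

lemma sum_weighted_diff_eq_zero {M : Type*} [AddCommGroup M] [Module ℂ M]
    (ha : ∀ i j, a i j = a j i) (h : Fin m → M) :
    ∑ i, ∑ j, (a i j : ℂ) • (h j - h i) = 0 := by
  simp only [smul_sub, Finset.sum_sub_distrib]
  rw [sub_eq_zero, Finset.sum_comm]
  exact Finset.sum_congr rfl fun i _ => Finset.sum_congr rfl fun j _ => by rw [ha]

lemma eta_succ (k : ℕ) (i : Fin m) :
    (synchronize S B Γ a c₀ c₁ ϱ z (k + 1)).eta i
      = etaNext S B Γ a (z k) (synchronize S B Γ a c₀ c₁ ϱ z k) k i := rfl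

/-- All Kronecker products have the identity as left factor, so each block `b` evolves on its own,
and `z` enters block `b` at sensor `b` only. -/
lemma etaNext_apply (zk : Fin m → ℂ) (s : SyncState m n) (k : ℕ) (i b : Fin m) (r : Fin n) :
    etaNext S B Γ a zk s k i (b, r) = (S *ᵥ fun r' => s.eta i (b, r')) r
      + (if b = i then zk i else 0)
      + ((B * Γ) *ᵥ ∑ j, (a i j : ℂ) •
          ((fun r' => etaHat S s k j (b, r')) - fun r' => etaHat S s k i (b, r'))) r := by
  simp only [etaNext, Pi.add_apply, tildeS, ← mul_kronecker_mul, Matrix.one_mul,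
    one_kronecker_mulVec_apply]
  congr 3
  ext r'
  simp

/-- Whatever was broadcast, symmetric weights make the couplings cancel in the sum over the sensors.
Block `b` of the sum is then driven by `z_b` alone, which is the recursion of the local filter. -/
lemma sum_eta_eq_localFilter (ha : ∀ i j, a i j = a j i) (lam β : Fin n → ℂ) (y : ℕ → Fin m → ℝ)
    (k : ℕ) (b : Fin m) (r : Fin n) :
    ∑ i, (synchronize (filterMatrix lam β) B Γ a c₀ c₁ ϱ (localOutput lam β y) k).eta i (b, r)
      = localFilter lam β y b k r := by
  induction k generalizing r with
  | zero => simp [synchronize, localFilter]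
  | succ k ih =>
    simp only [eta_succ, etaNext_apply, Finset.sum_add_distrib, localFilter_succ_eq_output,
      Pi.add_apply]
    have h1 : ∀ s : SyncState m n, ∑ i, ((B * Γ) *ᵥ ∑ j, (a i j : ℂ) •
          ((fun r' => etaHat (filterMatrix lam β) s k j (b, r'))
            - fun r' => etaHat (filterMatrix lam β) s k i (b, r'))) r = 0 := by
      intro s
      rw [← Finset.sum_apply, ← mulVec_sum,
        sum_weighted_diff_eq_zero ha fun i r' => etaHat (filterMatrix lam β) s k i (b, r')]
      simp
    rw [h1, add_zero]
    congr 1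
    · rw [← Finset.sum_apply, ← mulVec_sum]
      congr 2
      ext r'
      rw [Finset.sum_apply]; exact ih r'
    · simp

lemma lastTime_le (k : ℕ) (i : Fin m) :
    (synchronize S B Γ a c₀ c₁ ϱ z k).lastTime i ≤ k := by
  induction k with
  | zero => simp [synchronize]
  | succ k ih =>
    simp only [synchronize]
    split_ifs
    · exact le_rfl
    · exact ih.trans (Nat.le_succ k)

/-- The bound on `lastTime` is what makes the truncated subtraction in the exponent grow by one. -/
lemma etaHat_succ_of_le {s : SyncState m n} {k : ℕ} {i : Fin m} (h : s.lastTime i ≤ k) :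
    etaHat S s (k + 1) i = tildeS m S *ᵥ etaHat S s k i := by
  rw [etaHat, etaHat, Nat.succ_sub h, pow_succ', mulVec_mulVec]

-- The bookkeeping of times and sent states is traded for a recursion of `η̂`: it is reset to `η` at
-- a broadcast and propagated by `S̃` otherwise.
open Classical in
lemma etaHat_succ (k : ℕ) (i : Fin m) :
    etaHat S (synchronize S B Γ a c₀ c₁ ϱ z (k + 1)) (k + 1) i
      = if 0 ≤ (∑ p, ‖(tildeS m S *ᵥ etaHat S (synchronize S B Γ a c₀ c₁ ϱ z k) k i) p
            - (synchronize S B Γ a c₀ c₁ ϱ z (k + 1)).eta i p‖ ^ 2) - (c₀ + c₁ * ϱ ^ (k + 1))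
        then (synchronize S B Γ a c₀ c₁ ϱ z (k + 1)).eta i
        else tildeS m S *ᵥ etaHat S (synchronize S B Γ a c₀ c₁ ϱ z k) k i := by
  rw [← etaHat_succ_of_le (lastTime_le k i)]
  conv_lhs => rw [etaHat]
  have h : (0 ≤ (∑ p, ‖etaHat S (synchronize S B Γ a c₀ c₁ ϱ z k) (k + 1) i p
            - (synchronize S B Γ a c₀ c₁ ϱ z (k + 1)).eta i p‖ ^ 2) - (c₀ + c₁ * ϱ ^ (k + 1))) ↔
      (0 ≤ (∑ p, ‖etaHat S (synchronize S B Γ a c₀ c₁ ϱ z k) (k + 1) i p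
            - etaNext S B Γ a (z k) (synchronize S B Γ a c₀ c₁ ϱ z k) k i p‖ ^ 2)
            - (c₀ + c₁ * ϱ ^ (k + 1))) := Iff.rfl
  by_cases h0 : 0 ≤ (∑ p, ‖etaHat S (synchronize S B Γ a c₀ c₁ ϱ z k) (k + 1) i p
            - etaNext S B Γ a (z k) (synchronize S B Γ a c₀ c₁ ϱ z k) k i p‖ ^ 2)
            - (c₀ + c₁ * ϱ ^ (k + 1))
  · rw [if_pos (h.2 h0)]
    simp only [synchronize, if_pos h0]
    simp
  · rw [if_neg (mt h.1 h0)]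
    simp only [synchronize, if_neg h0]
    rfl

/-- After the decision the error is zero if there was a broadcast, and below the threshold
otherwise. The bound holds on every path, with no probability involved. -/
lemma sqNorm_etaHat_sub_le (hc₀ : 0 < c₀) (hc₁ : 0 < c₁) (hϱ : 0 < ϱ) (hϱ' : ϱ < 1) (k : ℕ)
    (i : Fin m) :
    sqNorm (etaHat S (synchronize S B Γ a c₀ c₁ ϱ z k) k i
      - (synchronize S B Γ a c₀ c₁ ϱ z k).eta i) ≤ c₀ + c₁ := by
  cases k with
  | zero =>
    simp [etaHat, synchronize, sqNorm]; positivity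
  | succ k =>
    rw [etaHat_succ]
    split_ifs with h
    · simp [sqNorm]; positivity
    · have h1 : ϱ ^ (k + 1) ≤ 1 := pow_le_one₀ hϱ.le hϱ'.le
      have h2 : c₁ * ϱ ^ (k + 1) ≤ c₁ * 1 := by gcongr
      simp only [sqNorm, Pi.sub_apply]
      linarith

end EventTriggered

/-! ### Pathwise bound on the deviations from the average. -/

section Deviation

variable {n m : ℕ} {S : Matrix (Fin n) (Fin n) ℂ} {B : Matrix (Fin n) (Fin 1) ℂ}
  {Γ : Matrix (Fin 1) (Fin n) ℂ} {a : Matrix (Fin m) (Fin m) ℝ} {c₀ c₁ ϱ : ℝ}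
  {z : ℕ → Fin m → ℂ}

/-- Block `b` of the deviations of the local states from their average. -/
noncomputable def deviation (s : SyncState m n) (b i : Fin m) : Fin n → ℂ :=
  fun r => s.eta i (b, r) - etaBar s (b, r)

/-- Block `b` of the communication errors. -/
noncomputable def broadcastError (S : Matrix (Fin n) (Fin n) ℂ) (s : SyncState m n) (k : ℕ)
    (b i : Fin m) : Fin n → ℂ :=
  fun r => etaHat S s k i (b, r) - s.eta i (b, r)

/-- The inputs that drive block `b` of the deviations. -/
noncomputable def deviationInput (S M : Matrix (Fin n) (Fin n) ℂ) (a : Matrix (Fin m) (Fin m) ℝ)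
    (zk : Fin m → ℂ) (s : SyncState m n) (k : ℕ) (b i : Fin m) : Fin n → ℂ :=
  (fun _ => ((if b = i then 1 else 0) - 1 / (m : ℂ)) * zk b)
    + M *ᵥ ∑ j, (a i j : ℂ) • (broadcastError S s k b j - broadcastError S s k b i)

lemma etaBar_apply (s : SyncState m n) (p : Fin m × Fin n) :
    etaBar s p = 1 / (m : ℂ) * ∑ i, s.eta i p := by
  simp [etaBar]

lemma sum_deviation_eq_zero (hm : m ≠ 0) (s : SyncState m n) (b : Fin m) :
    ∑ i, deviation s b i = 0 := by
  ext r
  have : (m : ℂ) ≠ 0 := by exact_mod_cast hm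
  simp [deviation, etaBar_apply, Finset.sum_apply]
  field_simp
  ring

lemma etaBar_succ (ha : ∀ i j, a i j = a j i) (k : ℕ) (b : Fin m) (r : Fin n) :
    etaBar (synchronize S B Γ a c₀ c₁ ϱ z (k + 1)) (b, r)
      = (S *ᵥ fun r' => etaBar (synchronize S B Γ a c₀ c₁ ϱ z k) (b, r')) r
        + 1 / (m : ℂ) * z k b := by
  set s := synchronize S B Γ a c₀ c₁ ϱ z k with hs
  have h1 : ∑ i, ((B * Γ) *ᵥ ∑ j, (a i j : ℂ) •
      ((fun r' => etaHat S s k j (b, r')) - fun r' => etaHat S s k i (b, r'))) r = 0 := by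
    rw [← Finset.sum_apply, ← mulVec_sum,
      sum_weighted_diff_eq_zero ha fun i r' => etaHat S s k i (b, r')]
    simp
  have h2 : (fun r' => etaBar s (b, r')) = (1 / (m : ℂ)) • ∑ i, fun r' => s.eta i (b, r') := by
    ext r'; simp [etaBar_apply]
  rw [etaBar_apply, h2, mulVec_smul, mulVec_sum, Pi.smul_apply, smul_eq_mul, ← mul_add,
    Finset.sum_apply]
  simp only [eta_succ, ← hs, etaNext_apply, Finset.sum_add_distrib, h1]
  simp

/-- Each `η̂` is a local state plus a broadcast error. The average drops out of the differences of
local states, so the coupling of the deviations separates from that of the errors. -/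
lemma deviation_succ (ha : ∀ i j, a i j = a j i) (k : ℕ) (b i : Fin m) :
    deviation (synchronize S B Γ a c₀ c₁ ϱ z (k + 1)) b i
      = syncStep S (B * Γ) a (deviation (synchronize S B Γ a c₀ c₁ ϱ z k) b) i
        + deviationInput S (B * Γ) a (z k) (synchronize S B Γ a c₀ c₁ ϱ z k) k b i := by
  set s := synchronize S B Γ a c₀ c₁ ϱ z k with hs
  have h1 : (∑ j, (a i j : ℂ) •
      ((fun r' => etaHat S s k j (b, r')) - fun r' => etaHat S s k i (b, r')))
      = (∑ j, (a i j : ℂ) • (deviation s b j - deviation s b i))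
        + ∑ j, (a i j : ℂ) • (broadcastError S s k b j - broadcastError S s k b i) := by
    rw [← Finset.sum_add_distrib]
    refine Finset.sum_congr rfl fun j _ => ?_
    ext r'
    simp [deviation, broadcastError]; ring
  have h2 : deviation s b i
      = (fun r' => s.eta i (b, r')) - fun r' => etaBar s (b, r') := rfl
  ext r
  rw [deviation, eta_succ, ← hs, etaNext_apply, etaBar_succ ha, ← hs, h1, mulVec_add, Pi.add_apply,
    Pi.add_apply, syncStep, Pi.add_apply, deviationInput, Pi.add_apply, h2, mulVec_sub,
    Pi.sub_apply]
  by_cases hb : b = i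
  · subst hb; simp only [if_true]; ring
  · simp only [if_neg hb]; ring

lemma quadRe_conjTranspose_mul_self {ι : Type*} [Fintype ι] (N : Matrix ι ι ℂ) (u : ι → ℂ) :
    quadRe (Nᴴ * N) u = sqNorm (N *ᵥ u) := by
  rw [quadRe, ← mulVec_mulVec, dotProduct_mulVec, ← star_mulVec, star_dotProduct_self,
    Complex.ofReal_re]

lemma quadRe_add_le {ι : Type*} [Fintype ι] [DecidableEq ι] {PP : Matrix ι ι ℂ}
    (hPP : PP.PosSemidef) {τ : ℝ} (hτ : 0 < τ) (u v : ι → ℂ) :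
    quadRe PP (u + v) ≤ (1 + τ) * quadRe PP u + (1 + 1 / τ) * quadRe PP v := by
  obtain ⟨N, rfl⟩ := exists_conjTranspose_mul_self hPP
  simp only [quadRe_conjTranspose_mul_self, mulVec_add]
  exact sqNorm_add_le τ hτ _ _

lemma quadRe_le {ι : Type*} [Fintype ι] (PP : Matrix ι ι ℂ) (u : ι → ℂ) :
    quadRe PP u ≤ (∑ i, ∑ j, ‖PP i j‖) * sqNorm u :=
  (Complex.re_le_norm _).trans (norm_quadForm_le PP u)

/-- The constant is fixed before `z`, the state and the time are given, so the estimate can later be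
integrated over all paths. -/
lemma sqNorm_deviationInput_le (hm : m ≠ 0) (ha : ∀ i j, 0 ≤ a i j) (M : Matrix (Fin n) (Fin n) ℂ) {E : ℝ}
    (hE : 0 ≤ E) : ∃ c, 0 ≤ c ∧ ∀ (zk : Fin m → ℂ) (s : SyncState m n) (k : ℕ),
      (∀ i, sqNorm (etaHat S s k i - s.eta i) ≤ E) → ∀ b i,
        sqNorm (deviationInput S M a zk s k b i) ≤ c * (1 + ‖zk b‖ ^ 2) := by
  set T : ℝ := ∑ i, ∑ j, a i j with hT
  set N : ℝ := ∑ k, sqNorm (M k) with hN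
  have hN0 : 0 ≤ N := Finset.sum_nonneg fun _ _ => sqNorm_nonneg _
  -- Young's inequality with `τ = 1` doubles two bounds: `4 n |z_b|²`, as the coefficient of `z_b`
  -- has modulus at most `2`, and `N n (2 T √E)²` for the coupling of the broadcast errors.
  refine ⟨8 * n + 2 * (N * (n * (4 * T ^ 2 * E))), by positivity, fun zk s k hs b i => ?_⟩
  have h1 : sqNorm (fun _ : Fin n => ((if b = i then 1 else 0) - 1 / (m : ℂ)) * zk b)
      ≤ 4 * n * ‖zk b‖ ^ 2 := by
    have h2 : ‖(if b = i then 1 else 0) - 1 / (m : ℂ)‖ ≤ 2 := by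
      refine (norm_sub_le _ _).trans ?_
      have : ‖(if b = i then (1 : ℂ) else 0)‖ ≤ 1 := by split_ifs <;> simp
      have : ‖1 / (m : ℂ)‖ ≤ 1 := by
        rw [norm_div, norm_one, Complex.norm_natCast]
        exact div_le_one_of_le₀ (by exact_mod_cast Nat.one_le_iff_ne_zero.2 hm) (by positivity)
      linarith
    simp only [sqNorm, Finset.sum_const, Finset.card_univ, Fintype.card_fin, nsmul_eq_mul, norm_mul,
      mul_pow]
    have : ‖(if b = i then 1 else 0) - 1 / (m : ℂ)‖ ^ 2 ≤ 2 ^ 2 := by gcongr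
    calc _ ≤ (n : ℝ) * (2 ^ 2 * ‖zk b‖ ^ 2) := by gcongr
      _ = _ := by ring
  have hEr : ∀ j r, ‖broadcastError S s k b j r‖ ≤ Real.sqrt E := fun j r =>
    Real.le_sqrt_of_sq_le ((norm_sq_le_sqNorm (etaHat S s k j - s.eta j) (b, r)).trans (hs j))
  have hTi : ∑ j, a i j ≤ T :=
    Finset.single_le_sum (f := fun i => ∑ j, a i j) (fun i _ => Finset.sum_nonneg fun j _ => ha i j)
      (Finset.mem_univ i)
  have h3 : sqNorm (∑ j, (a i j : ℂ) • (broadcastError S s k b j - broadcastError S s k b i))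
      ≤ n * (4 * T ^ 2 * E) := by
    have h4 : ∀ r, ‖(∑ j, (a i j : ℂ) • (broadcastError S s k b j - broadcastError S s k b i)) r‖
        ≤ T * (2 * Real.sqrt E) := by
      intro r
      rw [Finset.sum_apply]
      refine (norm_sum_le _ _).trans ?_
      calc _ ≤ ∑ j, a i j * (2 * Real.sqrt E) := Finset.sum_le_sum fun j _ => by
            rw [Pi.smul_apply, norm_smul, Complex.norm_real, Real.norm_of_nonneg (ha i j)]
            have := ha i j
            gcongr
            refine (norm_sub_le _ _).trans ?_
            linarith [hEr j r, hEr i r]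
        _ = (∑ j, a i j) * (2 * Real.sqrt E) := by rw [Finset.sum_mul]
        _ ≤ _ := by gcongr
    calc _ ≤ ∑ _r : Fin n, (T * (2 * Real.sqrt E)) ^ 2 :=
          Finset.sum_le_sum fun r _ => by gcongr; exact h4 r
      _ = _ := by
          rw [Finset.sum_const, Finset.card_univ, Fintype.card_fin, nsmul_eq_mul, mul_pow, mul_pow,
            Real.sq_sqrt hE]
          ring
  have h5 := sqNorm_add_le 1 one_pos
    (fun _ : Fin n => ((if b = i then 1 else 0) - 1 / (m : ℂ)) * zk b)
    (M *ᵥ ∑ j, (a i j : ℂ) • (broadcastError S s k b j - broadcastError S s k b i))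
  have h6 := sqNorm_mulVec_le M
    (∑ j, (a i j : ℂ) • (broadcastError S s k b j - broadcastError S s k b i))
  have h7 := h6.trans (mul_le_mul_of_nonneg_left h3 hN0)
  rw [deviationInput]
  have h8 : 0 ≤ N * (n * (4 * T ^ 2 * E)) := by positivity
  have h9 : 0 ≤ (n : ℝ) := by positivity
  have h10 : 0 ≤ ‖zk b‖ ^ 2 := by positivity
  nlinarith [mul_nonneg h8 h10]

/-- The solution of `Φ (k+1) = ρ Φ k + c (1 + g k)`, `Φ 0 = 0`. -/
def geomFilter (ρ c : ℝ) (g : ℕ → ℝ) : ℕ → ℝ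
  | 0 => 0
  | k + 1 => ρ * geomFilter ρ c g k + c * (1 + g k)

/-- Contraction in the energy of `𝒫`, perturbed by the inputs through Young's inequality. The
numbers `ρ` and `c` do not depend on `z`, so expectations can be taken afterwards. -/
theorem exists_sqNorm_deviation_le (hm : 2 ≤ m) (ha : IsConnectedNetwork a) {μ : Fin m → ℝ}
    (hμ : IsOrderedSpectrum (weightedLaplacian a) μ) {μ₂ μₘ : ℝ} {i₁ iₘ : Fin m}
    (hμ₂ : μ₂ = μ i₁) (hμₘ : μₘ = μ iₘ) (hi₁ : (i₁ : ℕ) = 1) (hiₘ : (iₘ : ℕ) = m - 1)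
    {ζ : ℝ} (hζ : 0 < ζ)
    (hζ' : ζ⁻¹ * (1 - μ₂ / μₘ) ≤ 1 + μ₂ / μₘ) {PP : Matrix (Fin n) (Fin n) ℂ}
    (hPP : SolvesRiccatiInequality ζ S B PP) (hΓ : Γ = syncGain μ₂ μₘ S B PP)
    (hc₀ : 0 < c₀) (hc₁ : 0 < c₁) (hϱ : 0 < ϱ) (hϱ' : ϱ < 1) :
    ∃ ρ c, 0 ≤ ρ ∧ ρ < 1 ∧ 0 ≤ c ∧ ∀ (z : ℕ → Fin m → ℂ) (k : ℕ) (i : Fin m),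
      sqNorm ((synchronize S B Γ a c₀ c₁ ϱ z k).eta i - etaBar (synchronize S B Γ a c₀ c₁ ϱ z k))
        ≤ geomFilter ρ c (fun k => ∑ b, ‖z k b‖ ^ 2) k := by
  obtain ⟨θ, hθ, hθ', hcontr⟩ := exists_syncStep_contraction hm ha hμ hμ₂ hμₘ hi₁ hiₘ hζ hζ' hPP
  obtain ⟨c, hc, hU⟩ := sqNorm_deviationInput_le (S := S) (by omega : m ≠ 0) ha.1 (B * Γ)
    (by positivity : 0 ≤ c₀ + c₁)
  obtain ⟨κ, hκ, hle⟩ := hPP.1.exists_pos_le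
  -- With this weight, `(1 + τ) θ ≤ (1 + θ) / 2 < 1`.
  set τ : ℝ := (1 - θ) / 2 with hτ
  have hτ0 : 0 < τ := by rw [hτ]; linarith
  set p : ℝ := ∑ i, ∑ j, ‖PP i j‖ with hp
  have hp0 : 0 ≤ p := by positivity
  -- The factor `κ⁻¹` returns from the energy to the Euclidean norm, `p` bounds the form of `𝒫`, and
  -- `m * m` counts the pairs of block and sensor.
  refine ⟨(1 + θ) / 2, κ⁻¹ * ((1 + 1 / τ) * (m * m * (p * c))), by linarith, by linarith,
    by positivity, fun z k i => ?_⟩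
  set s := synchronize S B Γ a c₀ c₁ ϱ z with hs
  have hquad : ∀ u, 0 ≤ quadRe PP u := fun u => quadRe_nonneg hPP.1.posSemidef u
  have hmain : ∀ k, κ⁻¹ * ∑ b, ∑ i, quadRe PP (deviation (s k) b i)
      ≤ geomFilter ((1 + θ) / 2) (κ⁻¹ * ((1 + 1 / τ) * (m * m * (p * c))))
          (fun k => ∑ b, ‖z k b‖ ^ 2) k := by
    intro k
    induction k with
    | zero =>
      have : ∀ b i, deviation (s 0) b i = 0 := fun b i => by
        ext r; simp [deviation, hs, synchronize, etaBar_apply]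
      simp [geomFilter, this, quadRe]
    | succ k ih =>
      have h1 : ∀ b i, quadRe PP (deviation (s (k + 1)) b i)
          ≤ (1 + τ) * quadRe PP (syncStep S (B * Γ) a (deviation (s k) b) i)
            + (1 + 1 / τ) * (p * (c * (1 + ∑ b, ‖z k b‖ ^ 2))) := by
        intro b i
        rw [hs, deviation_succ ha.2.1]
        refine (quadRe_add_le hPP.1.posSemidef hτ0 _ _).trans ?_
        gcongr
        refine (quadRe_le _ _).trans ?_
        gcongr
        refine (hU (z k) (s k) k (fun i => sqNorm_etaHat_sub_le hc₀ hc₁ hϱ hϱ' k i) b i).trans ?_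
        gcongr
        exact Finset.single_le_sum (f := fun b => ‖z k b‖ ^ 2) (fun _ _ => by positivity)
          (Finset.mem_univ b)
      have h2 : ∀ b, ∑ i, quadRe PP (deviation (s (k + 1)) b i)
          ≤ (1 + τ) * (θ * ∑ i, quadRe PP (deviation (s k) b i))
            + m * ((1 + 1 / τ) * (p * (c * (1 + ∑ b, ‖z k b‖ ^ 2)))) := by
        intro b
        refine (Finset.sum_le_sum fun i _ => h1 b i).trans ?_
        rw [Finset.sum_add_distrib, ← Finset.mul_sum, Finset.sum_const, Finset.card_univ,
          Fintype.card_fin, nsmul_eq_mul]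
        gcongr
        rw [hΓ]
        exact hcontr _ (sum_deviation_eq_zero (by omega) _ b)
      have h3 : ∑ b, ∑ i, quadRe PP (deviation (s (k + 1)) b i)
          ≤ (1 + θ) / 2 * ∑ b, ∑ i, quadRe PP (deviation (s k) b i)
            + m * (m * ((1 + 1 / τ) * (p * (c * (1 + ∑ b, ‖z k b‖ ^ 2))))) := by
        refine (Finset.sum_le_sum fun b _ => h2 b).trans ?_
        rw [Finset.sum_add_distrib, ← Finset.mul_sum, ← Finset.mul_sum, Finset.sum_const,
          Finset.card_univ, Fintype.card_fin, nsmul_eq_mul, ← mul_assoc (1 + τ)]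
        have hnn : 0 ≤ ∑ b, ∑ i, quadRe PP (deviation (s k) b i) :=
          Finset.sum_nonneg fun b _ => Finset.sum_nonneg fun i _ => hquad _
        gcongr
        rw [hτ]; nlinarith
      have hκ' : 0 ≤ κ⁻¹ := by positivity
      calc _ ≤ κ⁻¹ * ((1 + θ) / 2 * ∑ b, ∑ i, quadRe PP (deviation (s k) b i)
            + m * (m * ((1 + 1 / τ) * (p * (c * (1 + ∑ b, ‖z k b‖ ^ 2)))))) := by gcongr
        _ = (1 + θ) / 2 * (κ⁻¹ * ∑ b, ∑ i, quadRe PP (deviation (s k) b i))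
            + κ⁻¹ * ((1 + 1 / τ) * (m * m * (p * c))) * (1 + ∑ b, ‖z k b‖ ^ 2) := by ring
        _ ≤ _ := by
          rw [geomFilter]
          gcongr
  refine le_trans ?_ (hmain k)
  have h1 : sqNorm ((s k).eta i - etaBar (s k)) = ∑ b, sqNorm (deviation (s k) b i) := by
    simp only [sqNorm, Fintype.sum_prod_type]; rfl
  have h2 : ∀ b, sqNorm (deviation (s k) b i) ≤ κ⁻¹ * quadRe PP (deviation (s k) b i) := fun b => by
    rw [← div_eq_inv_mul, le_div_iff₀ hκ, mul_comm]; exact hle _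
  rw [h1, Finset.mul_sum]
  refine Finset.sum_le_sum fun b _ => (h2 b).trans ?_
  gcongr
  exact Finset.single_le_sum (f := fun i => quadRe PP (deviation (s k) b i)) (fun _ _ => hquad _)
    (Finset.mem_univ i)

end Deviation

/-! ### Measurability with respect to the past measurements. -/

section Measurability

variable {n m : ℕ} {Ω : Type*} [MeasurableSpace Ω]

lemma measurable_mulVec {ι κ : Type*} [Fintype ι] [Fintype κ] (M : Matrix ι κ ℂ)
    {u : Ω → κ → ℂ} (hu : Measurable u) : Measurable fun ω => M *ᵥ u ω :=
  (Continuous.matrix_mulVec continuous_const continuous_id).measurable.comp hu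

lemma measurable_mulVec_real {ι κ : Type*} [Fintype ι] [Fintype κ] (M : Matrix ι κ ℝ)
    {u : Ω → κ → ℝ} (hu : Measurable u) : Measurable fun ω => M *ᵥ u ω :=
  (Continuous.matrix_mulVec continuous_const continuous_id).measurable.comp hu

/-- Measurability is required of `y_1, …, y_N` only, so that the statement also applies to the
σ-algebra they generate. -/
lemma measurable_localFilter (lam β : Fin n → ℂ) {y : ℕ → Ω → Fin m → ℝ} {N : ℕ}
    (hy : ∀ j, 1 ≤ j → j ≤ N → Measurable (y j)) (i : Fin m) {k : ℕ} (hk : k ≤ N) :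
    Measurable fun ω => localFilter lam β (fun t => y t ω) i k := by
  induction k with
  | zero => exact measurable_const
  | succ k ih =>
    have h1 := ih (by omega)
    refine measurable_pi_iff.2 fun r => ?_
    simp only [localFilter_succ_apply]
    have h2 := (measurable_pi_apply i).comp (hy (k + 1) (by omega) hk)
    have h3 := (measurable_pi_apply r).comp h1
    exact (h3.const_mul _).add (Complex.measurable_ofReal.comp h2)

lemma measurable_localOutput (lam β : Fin n → ℂ) {y : ℕ → Ω → Fin m → ℝ} {N : ℕ}
    (hy : ∀ j, 1 ≤ j → j ≤ N → Measurable (y j)) (i : Fin m) {k : ℕ} (hk : k < N) :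
    Measurable fun ω => localOutput lam β (fun t => y t ω) k i := by
  have h1 := measurable_localFilter lam β hy i hk.le
  have h2 := (measurable_pi_apply i).comp (hy (k + 1) (by omega) hk)
  refine (Complex.measurable_ofReal.comp h2).sub ?_
  simp only [dotProduct]
  exact Finset.measurable_sum _ fun r _ => ((measurable_pi_apply r).comp h1).const_mul _

/-- The state and its prediction are carried through the induction together: the triggering event
compares them, and the next state uses both. The output at time `k` contains `y_{k+1}`, hence the
strict bound on the times in `hz`. -/
lemma measurable_synchronize (S : Matrix (Fin n) (Fin n) ℂ) (B : Matrix (Fin n) (Fin 1) ℂ)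
    (Γ : Matrix (Fin 1) (Fin n) ℂ) (a : Matrix (Fin m) (Fin m) ℝ) (c₀ c₁ ϱ : ℝ)
    {z : Ω → ℕ → Fin m → ℂ} {N : ℕ} (hz : ∀ k < N, ∀ i, Measurable fun ω => z ω k i)
    {k : ℕ} (hk : k ≤ N) (i : Fin m) :
    Measurable (fun ω => (synchronize S B Γ a c₀ c₁ ϱ (z ω) k).eta i) ∧
    Measurable (fun ω => etaHat S (synchronize S B Γ a c₀ c₁ ϱ (z ω) k) k i) := by
  classical
  induction k generalizing i with
  | zero =>
    simp only [synchronize, etaHat]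
    exact ⟨measurable_const, measurable_const⟩
  | succ k ih =>
    have ih := ih (by omega)
    have h1 : Measurable (fun ω => (synchronize S B Γ a c₀ c₁ ϱ (z ω) (k + 1)).eta i) := by
      simp only [eta_succ, etaNext]
      refine ((measurable_mulVec _ (ih i).1).add ?_).add (measurable_mulVec _ ?_)
      · refine measurable_pi_iff.2 fun p => ?_
        split_ifs
        · exact hz k (by omega) i
        · exact measurable_const
      · exact Finset.measurable_sum _ fun j _ =>
          ((ih j).2.sub (ih i).2).const_smul (a i j : ℂ)
    refine ⟨h1, ?_⟩
    have h2 := measurable_mulVec (tildeS m S) (ih i).2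
    simp only [etaHat_succ]
    refine Measurable.ite ?_ h1 h2
    refine measurableSet_le measurable_const (Measurable.sub_const ?_ _)
    exact Finset.measurable_sum _ fun p _ =>
      ((((measurable_pi_apply p).comp h2).sub ((measurable_pi_apply p).comp h1)).norm).pow_const 2

lemma measurable_deviation (S : Matrix (Fin n) (Fin n) ℂ) (B : Matrix (Fin n) (Fin 1) ℂ)
    (Γ : Matrix (Fin 1) (Fin n) ℂ) (a : Matrix (Fin m) (Fin m) ℝ) (c₀ c₁ ϱ : ℝ)
    {z : Ω → ℕ → Fin m → ℂ} {k : ℕ} (hz : ∀ j < k, ∀ i, Measurable fun ω => z ω j i)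
    (i : Fin m) : Measurable fun ω => (synchronize S B Γ a c₀ c₁ ϱ (z ω) k).eta i
      - etaBar (synchronize S B Γ a c₀ c₁ ϱ (z ω) k) := by
  have h := fun i => (measurable_synchronize S B Γ a c₀ c₁ ϱ hz le_rfl i).1
  exact (h i).sub ((Finset.measurable_sum _ fun i _ => h i).const_smul (1 / (m : ℂ)))

end Measurability

/-! ### Cross covariances and Gaussian families. -/

section CrossCov

variable {Ω ι κ ν : Type*} [MeasurableSpace Ω] {Pr : Measure Ω}

/-- The matrix of covariances of the coordinates of two real random vectors. -/
noncomputable def crossCov (Pr : Measure Ω) (X : Ω → ι → ℝ) (Y : Ω → κ → ℝ) : Matrix ι κ ℝ :=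
  Matrix.of fun i j => cov[fun ω => X ω i, fun ω => Y ω j; Pr]

lemma crossCov_transpose (X : Ω → ι → ℝ) (Y : Ω → κ → ℝ) :
    (crossCov Pr X Y)ᵀ = crossCov Pr Y X := by
  ext i j; exact covariance_comm _ _

lemma memLp_mulVec [Fintype κ] (M : Matrix ι κ ℝ) {X : Ω → κ → ℝ}
    (hX : ∀ i, MemLp (fun ω => X ω i) 2 Pr) (i : ι) : MemLp (fun ω => (M *ᵥ X ω) i) 2 Pr := by
  simp only [mulVec, dotProduct]
  exact memLp_finsetSum _ fun j _ => (hX j).const_mul _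

/-- Finite linear combinations of jointly Gaussian variables are jointly Gaussian. For the plant and
the filters it then suffices to locate their coordinates in a span. -/
lemma isGaussianProcess_of_mem_span {T S : Type*} {Z : T → Ω → ℝ} (hZ : IsGaussianProcess Z Pr)
    {Y : S → Ω → ℝ} (hY : ∀ s, Y s ∈ Submodule.span ℝ (Set.range Z)) :
    IsGaussianProcess Y Pr := by
  refine hZ.of_isGaussianProcess fun s => ?_
  obtain ⟨c, hc⟩ := (Finsupp.mem_span_range_iff_exists_finsupp).1 (hY s)
  refine ⟨c.support, ∑ i : c.support, c i • ContinuousLinearMap.proj i, fun ω => ?_⟩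
  rw [← hc, Finsupp.sum]
  simp only [Finset.sum_apply, Pi.smul_apply, _root_.sum_apply,
    _root_.smul_apply, ContinuousLinearMap.proj_apply, Finset.restrict]
  exact (Finset.sum_coe_sort c.support fun i => c i • Z i ω).symm

variable [IsProbabilityMeasure Pr]

lemma crossCov_mulVec_left [Fintype κ] (M : Matrix ι κ ℝ) {X : Ω → κ → ℝ} {Y : Ω → ν → ℝ}
    (hX : ∀ i, MemLp (fun ω => X ω i) 2 Pr) (hY : ∀ i, MemLp (fun ω => Y ω i) 2 Pr) :
    crossCov Pr (fun ω => M *ᵥ X ω) Y = M * crossCov Pr X Y := by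
  ext i j
  simp only [crossCov, of_apply, mulVec, dotProduct, mul_apply]
  rw [covariance_fun_sum_left (fun k => (hX k).const_mul (M i k)) (hY j)]
  simp only [covariance_const_mul_left]

lemma crossCov_mulVec_right [Fintype κ] (M : Matrix ι κ ℝ) {X : Ω → κ → ℝ} {Y : Ω → ν → ℝ}
    (hX : ∀ i, MemLp (fun ω => X ω i) 2 Pr) (hY : ∀ i, MemLp (fun ω => Y ω i) 2 Pr) :
    crossCov Pr Y (fun ω => M *ᵥ X ω) = crossCov Pr Y X * Mᵀ := by
  rw [← crossCov_transpose, crossCov_mulVec_left M hX hY, transpose_mul, crossCov_transpose]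

lemma crossCov_add_left {X X' : Ω → ι → ℝ} {Y : Ω → κ → ℝ}
    (hX : ∀ i, MemLp (fun ω => X ω i) 2 Pr) (hX' : ∀ i, MemLp (fun ω => X' ω i) 2 Pr)
    (hY : ∀ i, MemLp (fun ω => Y ω i) 2 Pr) :
    crossCov Pr (fun ω => X ω + X' ω) Y = crossCov Pr X Y + crossCov Pr X' Y := by
  ext i j
  exact covariance_add_left (hX i) (hX' i) (hY j)

lemma crossCov_add_right {X X' : Ω → ι → ℝ} {Y : Ω → κ → ℝ}
    (hX : ∀ i, MemLp (fun ω => X ω i) 2 Pr) (hX' : ∀ i, MemLp (fun ω => X' ω i) 2 Pr)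
    (hY : ∀ i, MemLp (fun ω => Y ω i) 2 Pr) :
    crossCov Pr Y (fun ω => X ω + X' ω) = crossCov Pr Y X + crossCov Pr Y X' := by
  ext i j
  exact covariance_add_right (hY i) (hX j) (hX' j)

lemma covariance_eq_zero_of_mem_span {S T : Set (Ω → ℝ)} (hS : ∀ X ∈ S, MemLp X 2 Pr)
    (hT : ∀ X ∈ T, MemLp X 2 Pr) (h : ∀ X ∈ S, ∀ Y ∈ T, cov[X, Y; Pr] = 0)
    {X Y : Ω → ℝ} (hX : X ∈ Submodule.span ℝ S) (hY : Y ∈ Submodule.span ℝ T) :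
    cov[X, Y; Pr] = 0 := by
  -- Square integrability accompanies the vanishing covariance, since additivity of the covariance
  -- needs it.
  have key : ∀ {S : Set (Ω → ℝ)} {Y : Ω → ℝ}, (∀ X ∈ S, MemLp X 2 Pr) → MemLp Y 2 Pr →
      (∀ X ∈ S, cov[X, Y; Pr] = 0) → ∀ X ∈ Submodule.span ℝ S,
      MemLp X 2 Pr ∧ cov[X, Y; Pr] = 0 := by
    intro S Y hS hY h X hX
    induction hX using Submodule.span_induction with
    | mem X hX => exact ⟨hS X hX, h X hX⟩
    | zero => exact ⟨MemLp.zero, by simp⟩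
    | add X X' _ _ h1 h2 =>
      exact ⟨h1.1.add h2.1, by rw [covariance_add_left h1.1 h2.1 hY, h1.2, h2.2, add_zero]⟩
    | smul c X _ h1 => exact ⟨h1.1.const_smul c, by rw [covariance_smul_left, h1.2, mul_zero]⟩
  have hYm : MemLp Y 2 Pr := (key hT (Y := 0) MemLp.zero (by simp) Y hY).1
  refine (key hS hYm (fun X hX => ?_) X hX).2
  rw [covariance_comm]
  exact (key hT (hS X hX) (fun Y hY => by rw [covariance_comm]; exact h X hX Y hY) Y hY).2

end CrossCov

/-! ### Joint Gaussianity of the initial state and the noises. -/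

section NoiseModel

variable {n m : ℕ} {Ω : Type*} [MeasurableSpace Ω]

/-- All coordinates of the initial state and of the noises. -/
def noiseCoord (x₀ : Ω → Fin n → ℝ) (w : ℕ → Ω → Fin n → ℝ) (v : ℕ → Ω → Fin m → ℝ) :
    Fin n ⊕ (ℕ × Fin n) ⊕ (ℕ × Fin m) → Ω → ℝ :=
  Sum.elim (fun i ω => x₀ ω i) (Sum.elim (fun p ω => w p.1 ω p.2) fun p ω => v p.1 ω p.2)

/-- Jointly Gaussian, centered, mutually uncorrelated initial state and noises. -/
structure IsGaussianNoise (Pr : Measure Ω) (Sig0 Q : Matrix (Fin n) (Fin n) ℝ)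
    (R : Matrix (Fin m) (Fin m) ℝ) (x₀ : Ω → Fin n → ℝ) (w : ℕ → Ω → Fin n → ℝ)
    (v : ℕ → Ω → Fin m → ℝ) : Prop where
  measurable_init : Measurable x₀
  measurable_w : ∀ k, Measurable (w k)
  measurable_v : ∀ k, Measurable (v k)
  gaussian : IsGaussianProcess (noiseCoord x₀ w v) Pr
  mean : ∀ t, ∫ ω, noiseCoord x₀ w v t ω ∂Pr = 0
  cov_init : crossCov Pr x₀ x₀ = Sig0
  cov_w : ∀ k, crossCov Pr (w k) (w k) = Q
  cov_v : ∀ k, crossCov Pr (v k) (v k) = R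
  cov_w_w : ∀ j k, j ≠ k → crossCov Pr (w j) (w k) = 0
  cov_v_v : ∀ j k, j ≠ k → crossCov Pr (v j) (v k) = 0
  cov_init_w : ∀ k, crossCov Pr x₀ (w k) = 0
  cov_v_init : ∀ k, crossCov Pr (v k) x₀ = 0
  cov_v_w : ∀ j k, crossCov Pr (v j) (w k) = 0

lemma ProbabilityTheory.HasLaw.memLp_coord {ι : Type*} [Fintype ι] [DecidableEq ι] {Pr : Measure Ω}
    [IsProbabilityMeasure Pr] {M : Matrix ι ι ℝ} {X : Ω → EuclideanSpace ℝ ι}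
    (hX : HasLaw X (multivariateGaussian 0 M) Pr) (i : ι) : MemLp (fun ω => X ω i) 2 Pr :=
  (hX.hasGaussianLaw.map_fun (EuclideanSpace.proj i)).memLp_two

lemma ProbabilityTheory.HasLaw.integral_coord {ι : Type*} [Fintype ι] [DecidableEq ι] {Pr : Measure Ω}
    [IsProbabilityMeasure Pr] {M : Matrix ι ι ℝ} {X : Ω → EuclideanSpace ℝ ι}
    (hX : HasLaw X (multivariateGaussian 0 M) Pr) (i : ι) : ∫ ω, X ω i ∂Pr = 0 := by
  have h1 := hX.integral_comp (f := fun x : EuclideanSpace ℝ ι => x i) (by fun_prop)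
  have h2 : ∫ x : EuclideanSpace ℝ ι, x i ∂(multivariateGaussian 0 M)
      = EuclideanSpace.proj (𝕜 := ℝ) i (∫ x, x ∂(multivariateGaussian (0 : EuclideanSpace ℝ ι) M)) :=
    (EuclideanSpace.proj (𝕜 := ℝ) i).integral_comp_comm IsGaussian.integrable_fun_id
  rw [integral_id_multivariateGaussian] at h2
  simpa [h2] using h1

lemma ProbabilityTheory.HasLaw.crossCov_self {ι : Type*} [Fintype ι] [DecidableEq ι] {Pr : Measure Ω}
    [IsProbabilityMeasure Pr] {M : Matrix ι ι ℝ} (hM : M.PosSemidef) {X : Ω → EuclideanSpace ℝ ι}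
    (hX : HasLaw X (multivariateGaussian 0 M) Pr) :
    crossCov Pr (fun ω i => X ω i) (fun ω i => X ω i) = M := by
  ext i j
  rw [← covariance_eval_multivariateGaussian (μ := 0) hM i j, ← hX.map_eq,
    covariance_map (by fun_prop) (by fun_prop) hX.aemeasurable]
  rfl

lemma ProbabilityTheory.IndepFun.crossCov_eq_zero {ι κ : Type*} [Fintype ι] [Fintype κ] {Pr : Measure Ω}
    [IsProbabilityMeasure Pr] {X : Ω → EuclideanSpace ℝ ι} {Y : Ω → EuclideanSpace ℝ κ}
    (h : IndepFun X Y Pr) (hX : ∀ i, MemLp (fun ω => X ω i) 2 Pr)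
    (hY : ∀ i, MemLp (fun ω => Y ω i) 2 Pr) :
    crossCov Pr (fun ω i => X ω i) (fun ω i => Y ω i) = 0 := by
  ext i j
  exact (h.comp (φ := fun x : EuclideanSpace ℝ ι => x i) (ψ := fun x : EuclideanSpace ℝ κ => x j)
    (by fun_prop) (by fun_prop)).covariance_eq_zero (hX i) (hY j)

variable {Pr : Measure Ω} {Sig0 Q : Matrix (Fin n) (Fin n) ℝ}
  {R : Matrix (Fin m) (Fin m) ℝ}
  {x₀ : Ω → EuclideanSpace ℝ (Fin n)} {w : ℕ → Ω → EuclideanSpace ℝ (Fin n)}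
  {v : ℕ → Ω → EuclideanSpace ℝ (Fin m)}

/-- Finitely many coordinates involve finitely many times. Independent Gaussian blocks are jointly
Gaussian, and the coordinates are a continuous linear image of the resulting vector. -/
lemma isGaussianProcess_noiseCoord
    (hx₀ : HasGaussianLaw x₀ Pr) (hw : ∀ k, HasGaussianLaw (w k) Pr)
    (hv : ∀ k, HasGaussianLaw (v k) Pr)
    (hw_indep : iIndepFun w Pr) (hv_indep : iIndepFun v Pr)
    (hx₀w_indep : IndepFun x₀ (fun ω k => w k ω) Pr)
    (hv_indep_x₀w : IndepFun (fun ω k => v k ω) (fun ω => (x₀ ω, fun k => w k ω)) Pr) :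
    IsGaussianProcess (noiseCoord (fun ω i => x₀ ω i) (fun k ω i => w k ω i)
      fun k ω i => v k ω i) Pr where
  hasGaussianLaw I := by
    obtain ⟨N, hN⟩ : ∃ N : ℕ, ∀ t ∈ I, (t.elim (fun _ => 0) (Sum.elim Prod.fst Prod.fst) : ℕ) < N :=
      ⟨I.sup (fun t => t.elim (fun _ => 0) (Sum.elim Prod.fst Prod.fst)) + 1, fun t ht =>
        Nat.lt_succ_of_le (Finset.le_sup (f := fun t : Fin n ⊕ (ℕ × Fin n) ⊕ (ℕ × Fin m) =>
          (t.elim (fun _ => 0) (Sum.elim Prod.fst Prod.fst) : ℕ)) ht)⟩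
    have hW : HasGaussianLaw (fun ω (k : Fin N) => w k ω) Pr :=
      (hw_indep.precomp Fin.val_injective).hasGaussianLaw fun k => hw k
    have hVl : HasGaussianLaw (fun ω (k : Fin N) => v k ω) Pr :=
      (hv_indep.precomp Fin.val_injective).hasGaussianLaw fun k => hv k
    have hr1 : Measurable fun (f : ℕ → EuclideanSpace ℝ (Fin n)) (k : Fin N) => f k := by fun_prop
    have hr2 : Measurable fun (f : ℕ → EuclideanSpace ℝ (Fin m)) (k : Fin N) => f k := by fun_prop
    have hxw : HasGaussianLaw (fun ω => (x₀ ω, fun k : Fin N => w k ω)) Pr :=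
      (hx₀w_indep.comp measurable_id hr1).hasGaussianLaw hx₀ hW
    have hall : HasGaussianLaw (fun ω => ((fun k : Fin N => v k ω),
        (x₀ ω, fun k : Fin N => w k ω))) Pr :=
      (show IndepFun (fun ω (k : Fin N) => v k ω) (fun ω => (x₀ ω, fun k : Fin N => w k ω)) Pr from
        hv_indep_x₀w.comp (φ := fun (f : ℕ → EuclideanSpace ℝ (Fin m)) (k : Fin N) => f k)
        (ψ := fun p : EuclideanSpace ℝ (Fin n) × (ℕ → EuclideanSpace ℝ (Fin n)) =>
          (p.1, fun k : Fin N => p.2 k)) hr2 (by fun_prop)).hasGaussianLaw hVl hxw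
    let L : (i : I) → ((Fin N → EuclideanSpace ℝ (Fin m)) × (EuclideanSpace ℝ (Fin n) ×
        (Fin N → EuclideanSpace ℝ (Fin n)))) →L[ℝ] ℝ := fun i =>
      match i with
      | ⟨.inl r, _⟩ => (EuclideanSpace.proj r).comp
          ((ContinuousLinearMap.fst ℝ _ _).comp (ContinuousLinearMap.snd ℝ _ _))
      | ⟨.inr (.inl p), h⟩ => (EuclideanSpace.proj p.2).comp
          ((ContinuousLinearMap.proj (R := ℝ) (φ := fun _ : Fin N => EuclideanSpace ℝ (Fin n))
            ⟨p.1, hN _ h⟩).comp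
          ((ContinuousLinearMap.snd ℝ _ _).comp (ContinuousLinearMap.snd ℝ _ _)))
      | ⟨.inr (.inr p), h⟩ => (EuclideanSpace.proj p.2).comp
          ((ContinuousLinearMap.proj (R := ℝ) (φ := fun _ : Fin N => EuclideanSpace ℝ (Fin m))
            ⟨p.1, hN _ h⟩).comp
          (ContinuousLinearMap.fst ℝ _ _))
    have := hall.map_fun (ContinuousLinearMap.pi L)
    convert! this using 2 with ω
    ext ⟨i, hi⟩
    rcases i with r | p | p <;> rfl

theorem isGaussianNoise [IsProbabilityMeasure Pr]
    (hQ : Q.PosSemidef) (hR : R.PosSemidef) (hSig0 : Sig0.PosSemidef)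
    (hx₀_meas : Measurable x₀) (hw_meas : ∀ k, Measurable (w k)) (hv_meas : ∀ k, Measurable (v k))
    (hx₀_law : HasLaw x₀ (multivariateGaussian 0 Sig0) Pr)
    (hw_law : ∀ k, HasLaw (w k) (multivariateGaussian 0 Q) Pr)
    (hv_law : ∀ k, HasLaw (v k) (multivariateGaussian 0 R) Pr)
    (hw_indep : iIndepFun w Pr) (hv_indep : iIndepFun v Pr)
    (hx₀w_indep : IndepFun x₀ (fun ω k => w k ω) Pr)
    (hv_indep_x₀w : IndepFun (fun ω k => v k ω) (fun ω => (x₀ ω, fun k => w k ω)) Pr) :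
    IsGaussianNoise Pr Sig0 Q R (fun ω i => x₀ ω i) (fun k ω i => w k ω i)
      (fun k ω i => v k ω i) where
  measurable_init := by fun_prop
  measurable_w k := by fun_prop
  measurable_v k := by fun_prop
  gaussian := isGaussianProcess_noiseCoord hx₀_law.hasGaussianLaw
    (fun k => (hw_law k).hasGaussianLaw) (fun k => (hv_law k).hasGaussianLaw)
    hw_indep hv_indep hx₀w_indep hv_indep_x₀w
  mean t := by
    rcases t with r | p | p
    · exact hx₀_law.integral_coord r
    · exact (hw_law p.1).integral_coord p.2
    · exact (hv_law p.1).integral_coord p.2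
  cov_init := hx₀_law.crossCov_self hSig0
  cov_w k := (hw_law k).crossCov_self hQ
  cov_v k := (hv_law k).crossCov_self hR
  cov_w_w j k h := IndepFun.crossCov_eq_zero (hw_indep.indepFun h) (hw_law j).memLp_coord
    (hw_law k).memLp_coord
  cov_v_v j k h := IndepFun.crossCov_eq_zero (hv_indep.indepFun h) (hv_law j).memLp_coord
    (hv_law k).memLp_coord
  cov_init_w k := IndepFun.crossCov_eq_zero
    (hx₀w_indep.comp measurable_id (measurable_pi_apply k)) hx₀_law.memLp_coord
    (hw_law k).memLp_coord
  cov_v_init k := IndepFun.crossCov_eq_zero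
    (hv_indep_x₀w.comp (measurable_pi_apply k) measurable_fst) (hv_law k).memLp_coord
    hx₀_law.memLp_coord
  cov_v_w j k := IndepFun.crossCov_eq_zero
    (hv_indep_x₀w.comp (measurable_pi_apply j) ((measurable_pi_apply k).comp measurable_snd))
    (hv_law j).memLp_coord (hw_law k).memLp_coord

end NoiseModel

/-! ### The optimal filter: error covariance and independence. -/

section KalmanFilter

lemma memLp_vec_add {Ω ι : Type*} [MeasurableSpace Ω] {Pr : Measure Ω} {X W : Ω → ι → ℝ}
    (hX : ∀ i, MemLp (fun ω => X ω i) 2 Pr) (hW : ∀ i, MemLp (fun ω => W ω i) 2 Pr) (i : ι) :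
    MemLp (fun ω => (X ω + W ω) i) 2 Pr :=
  (hX i).add (hW i)

variable {n m : ℕ} {Ω : Type*}

/-- A linear plant with its measurements. -/
structure IsLinearPlant (A : Matrix (Fin n) (Fin n) ℝ) (C : Matrix (Fin m) (Fin n) ℝ)
    (x₀ : Ω → Fin n → ℝ) (w : ℕ → Ω → Fin n → ℝ) (v : ℕ → Ω → Fin m → ℝ)
    (x : ℕ → Ω → Fin n → ℝ) (y : ℕ → Ω → Fin m → ℝ) : Prop where
  init : x 0 = x₀
  succ : ∀ k ω, x (k + 1) ω = A *ᵥ x k ω + w k ω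
  meas : ∀ k ω, y k ω = C *ᵥ x k ω + v k ω

/-- The filter `x̂ (k+1) = (A - L_k C A) x̂ k + L_k y (k+1)`, `x̂ 0 = 0`, with time-varying gain. -/
def gainEstimate (A : Matrix (Fin n) (Fin n) ℝ) (C : Matrix (Fin m) (Fin n) ℝ)
    (L : ℕ → Matrix (Fin n) (Fin m) ℝ) (y : ℕ → Ω → Fin m → ℝ) : ℕ → Ω → Fin n → ℝ
  | 0 => 0
  | k + 1 => fun ω => (A - L k * C * A) *ᵥ gainEstimate A C L y k ω + L k *ᵥ y (k + 1) ω

lemma kalmanEstimate_eq_gainEstimate (A : Matrix (Fin n) (Fin n) ℝ) (C : Matrix (Fin m) (Fin n) ℝ)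
    (K : Matrix (Fin n) (Fin m) ℝ) (y : ℕ → Ω → Fin m → ℝ) (k : ℕ) (ω : Ω) :
    kalmanEstimate A C K (fun t => y t ω) k = gainEstimate A C (fun _ => K) y k ω := by
  induction k with
  | zero => rfl
  | succ k ih => rw [kalmanEstimate, gainEstimate, ih]

lemma mulVec_coord_mem (W : Submodule ℝ (Ω → ℝ)) {ι κ : Type*} [Fintype κ] (M : Matrix ι κ ℝ)
    {X : Ω → κ → ℝ} (hX : ∀ j, (fun ω => X ω j) ∈ W) (i : ι) : (fun ω => (M *ᵥ X ω) i) ∈ W := by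
  have : (fun ω => (M *ᵥ X ω) i) = ∑ j, M i j • fun ω => X ω j := by
    ext ω; simp [mulVec, dotProduct]
  rw [this]
  exact W.sum_mem fun j _ => W.smul_mem _ (hX j)

/-- The coordinates of the initial state and of the noises up to time `k`. -/
def pastNoise (x₀ : Ω → Fin n → ℝ) (w : ℕ → Ω → Fin n → ℝ) (v : ℕ → Ω → Fin m → ℝ) (k : ℕ) :
    Set (Ω → ℝ) :=
  {X | (∃ i, X = fun ω => x₀ ω i) ∨ (∃ j < k, ∃ i, X = fun ω => w j ω i) ∨
    ∃ j ≤ k, ∃ i, X = fun ω => v j ω i}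

/-- The coordinates of the measurements at the times `1, …, k`. -/
def pastMeasurements (y : ℕ → Ω → Fin m → ℝ) (k : ℕ) : Set (Ω → ℝ) :=
  {X | ∃ j i, 1 ≤ j ∧ j ≤ k ∧ X = fun ω => y j ω i}

variable {A : Matrix (Fin n) (Fin n) ℝ} {C : Matrix (Fin m) (Fin n) ℝ}
  {x₀ : Ω → Fin n → ℝ} {w : ℕ → Ω → Fin n → ℝ} {v : ℕ → Ω → Fin m → ℝ}
  {x : ℕ → Ω → Fin n → ℝ} {y : ℕ → Ω → Fin m → ℝ} {L : ℕ → Matrix (Fin n) (Fin m) ℝ}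

/-- The filter with the optimal, time-varying Kalman gain. -/
noncomputable def optimalEstimate (A : Matrix (Fin n) (Fin n) ℝ) (C : Matrix (Fin m) (Fin n) ℝ)
    (Q : Matrix (Fin n) (Fin n) ℝ) (R : Matrix (Fin m) (Fin m) ℝ) (Sig0 : Matrix (Fin n) (Fin n) ℝ)
    (y : ℕ → Ω → Fin m → ℝ) : ℕ → Ω → Fin n → ℝ :=
  gainEstimate A C (fun k => kalmanGain C R (predictionCov A C Q R Sig0 k)) y

/-- Error covariance of the optimal filter. -/
noncomputable def estimationCov (A : Matrix (Fin n) (Fin n) ℝ) (C : Matrix (Fin m) (Fin n) ℝ)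
    (Q : Matrix (Fin n) (Fin n) ℝ) (R : Matrix (Fin m) (Fin m) ℝ)
    (Sig0 : Matrix (Fin n) (Fin n) ℝ) : ℕ → Matrix (Fin n) (Fin n) ℝ
  | 0 => Sig0
  | k + 1 => filteredCov C R (predictionCov A C Q R Sig0 k)

lemma predictionCov_eq_estimationCov {Q Sig0 : Matrix (Fin n) (Fin n) ℝ} {R : Matrix (Fin m) (Fin m) ℝ}
    (k : ℕ) :
    predictionCov A C Q R Sig0 k = A * estimationCov A C Q R Sig0 k * Aᵀ + Q := by
  cases k <;> rfl

lemma pastNoise_mono : Monotone (pastNoise x₀ w v) := by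
  rintro j k hjk X (h | ⟨l, hl, h⟩ | ⟨l, hl, h⟩)
  · exact Or.inl h
  · exact Or.inr (Or.inl ⟨l, hl.trans_le hjk, h⟩)
  · exact Or.inr (Or.inr ⟨l, hl.trans hjk, h⟩)

lemma pastMeasurements_mono : Monotone (pastMeasurements y) := by
  rintro j k hjk X ⟨l, i, h1, h2, h3⟩
  exact ⟨l, i, h1, h2.trans hjk, h3⟩

lemma pastNoise_subset_range (k : ℕ) : pastNoise x₀ w v k ⊆ Set.range (noiseCoord x₀ w v) := by
  rintro X (⟨i, rfl⟩ | ⟨l, hl, i, rfl⟩ | ⟨l, hl, i, rfl⟩)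
  · exact ⟨.inl i, rfl⟩
  · exact ⟨.inr (.inl (l, i)), rfl⟩
  · exact ⟨.inr (.inr (l, i)), rfl⟩

lemma span_pastNoise_le (k : ℕ) : Submodule.span ℝ (pastNoise x₀ w v k)
    ≤ Submodule.span ℝ (Set.range (noiseCoord x₀ w v)) :=
  Submodule.span_mono (pastNoise_subset_range k)

namespace IsLinearPlant

lemma state_mem (hP : IsLinearPlant A C x₀ w v x y) (k : ℕ) (i : Fin n) :
    (fun ω => x k ω i) ∈ Submodule.span ℝ (pastNoise x₀ w v k) := by
  induction k generalizing i with
  | zero => exact Submodule.subset_span (Or.inl ⟨i, by rw [hP.init]⟩)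
  | succ k ih =>
    simp only [hP.succ, Pi.add_apply]
    have h1 := mulVec_coord_mem _ A ih i
    exact Submodule.add_mem _ (Submodule.span_mono (pastNoise_mono k.le_succ) h1)
      (Submodule.subset_span (Or.inr (Or.inl ⟨k, k.lt_succ_self, i, rfl⟩)))

lemma measurement_mem (hP : IsLinearPlant A C x₀ w v x y) (k : ℕ) (i : Fin m) :
    (fun ω => y k ω i) ∈ Submodule.span ℝ (pastNoise x₀ w v k) := by
  simp only [hP.meas, Pi.add_apply]
  exact Submodule.add_mem _ (mulVec_coord_mem _ C (hP.state_mem k) i)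
    (Submodule.subset_span (Or.inr (Or.inr ⟨k, le_rfl, i, rfl⟩)))

lemma pastMeasurements_subset (hP : IsLinearPlant A C x₀ w v x y) (k : ℕ) :
    pastMeasurements y k ⊆ Submodule.span ℝ (pastNoise x₀ w v k) := by
  rintro X ⟨j, i, -, hj, rfl⟩
  exact Submodule.span_mono (pastNoise_mono hj) (hP.measurement_mem j i)

end IsLinearPlant

lemma gainEstimate_mem (k : ℕ) (i : Fin n) :
    (fun ω => gainEstimate A C L y k ω i) ∈ Submodule.span ℝ (pastMeasurements y k) := by
  induction k generalizing i with
  | zero => exact Submodule.zero_mem _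
  | succ k ih =>
    simp only [gainEstimate, Pi.add_apply]
    refine Submodule.add_mem _ (Submodule.span_mono (pastMeasurements_mono k.le_succ)
      (mulVec_coord_mem _ _ ih i)) (mulVec_coord_mem _ _ (fun j => Submodule.subset_span ?_) i)
    exact ⟨k + 1, j, by omega, le_rfl, rfl⟩

lemma IsLinearPlant.error_mem (hP : IsLinearPlant A C x₀ w v x y) (k : ℕ) (i : Fin n) :
    (fun ω => (gainEstimate A C L y k ω - x k ω) i)
      ∈ Submodule.span ℝ (pastNoise x₀ w v k) :=
  Submodule.sub_mem _ (Submodule.span_le.2 (hP.pastMeasurements_subset k) (gainEstimate_mem k i))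
    (hP.state_mem k i)

lemma IsLinearPlant.error_succ (hP : IsLinearPlant A C x₀ w v x y) (k : ℕ) (ω : Ω) :
    gainEstimate A C L y (k + 1) ω - x (k + 1) ω
      = ((1 - L k * C) * A) *ᵥ (gainEstimate A C L y k ω - x k ω)
        + (-(1 - L k * C)) *ᵥ w k ω + L k *ᵥ v (k + 1) ω := by
  simp only [gainEstimate, hP.meas, hP.succ, Matrix.sub_mul, Matrix.one_mul, sub_mulVec,
    mulVec_sub, mulVec_add, mulVec_mulVec,
    neg_mulVec, one_mulVec, Matrix.mul_assoc]
  abel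

variable [MeasurableSpace Ω] {Pr : Measure Ω}
  {Sig0 Q : Matrix (Fin n) (Fin n) ℝ} {R : Matrix (Fin m) (Fin m) ℝ}

namespace IsGaussianNoise

lemma memLp_noiseCoord (hN : IsGaussianNoise Pr Sig0 Q R x₀ w v) {X : Ω → ℝ}
    (hX : X ∈ Set.range (noiseCoord x₀ w v)) : MemLp X 2 Pr := by
  obtain ⟨t, rfl⟩ := hX
  exact (hN.gaussian.hasGaussianLaw_eval t).memLp_two

lemma memLp_w (hN : IsGaussianNoise Pr Sig0 Q R x₀ w v) (k : ℕ) (i : Fin n) :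
    MemLp (fun ω => w k ω i) 2 Pr := hN.memLp_noiseCoord ⟨.inr (.inl (k, i)), rfl⟩

lemma memLp_v (hN : IsGaussianNoise Pr Sig0 Q R x₀ w v) (k : ℕ) (i : Fin m) :
    MemLp (fun ω => v k ω i) 2 Pr := hN.memLp_noiseCoord ⟨.inr (.inr (k, i)), rfl⟩

variable [IsProbabilityMeasure Pr]

lemma memLp_and_integral_eq_zero (hN : IsGaussianNoise Pr Sig0 Q R x₀ w v) {X : Ω → ℝ}
    (hX : X ∈ Submodule.span ℝ (Set.range (noiseCoord x₀ w v))) :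
    MemLp X 2 Pr ∧ ∫ ω, X ω ∂Pr = 0 := by
  induction hX using Submodule.span_induction with
  | mem X hX =>
    refine ⟨hN.memLp_noiseCoord hX, ?_⟩
    obtain ⟨t, rfl⟩ := hX
    exact hN.mean t
  | zero => exact ⟨MemLp.zero, by simp⟩
  | add X X' _ _ h1 h2 =>
    refine ⟨h1.1.add h2.1, ?_⟩
    simp only [Pi.add_apply]
    rw [integral_add (h1.1.integrable one_le_two) (h2.1.integrable one_le_two), h1.2, h2.2, add_zero]
  | smul c X _ h1 =>
    refine ⟨h1.1.const_smul c, ?_⟩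
    simp only [Pi.smul_apply, smul_eq_mul]
    rw [integral_const_mul, h1.2, mul_zero]

lemma memLp (hN : IsGaussianNoise Pr Sig0 Q R x₀ w v) {k : ℕ} {X : Ω → ℝ}
    (hX : X ∈ Submodule.span ℝ (pastNoise x₀ w v k)) : MemLp X 2 Pr :=
  (hN.memLp_and_integral_eq_zero (span_pastNoise_le k hX)).1

lemma crossCov_w_past (hN : IsGaussianNoise Pr Sig0 Q R x₀ w v) {κ : Type*} {k : ℕ}
    {X : Ω → κ → ℝ} (hX : ∀ i, (fun ω => X ω i) ∈ Submodule.span ℝ (pastNoise x₀ w v k)) :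
    crossCov Pr (w k) X = 0 := by
  ext r j
  refine covariance_eq_zero_of_mem_span (S := {fun ω => w k ω r}) ?_
    (fun X hX => hN.memLp_noiseCoord (pastNoise_subset_range k hX)) ?_
    (Submodule.mem_span_singleton_self _) (hX j)
  · rintro X rfl; exact hN.memLp_w k r
  · rintro X rfl Y (⟨i, rfl⟩ | ⟨l, hl, i, rfl⟩ | ⟨l, hl, i, rfl⟩)
    · rw [covariance_comm]; exact congrFun (congrFun (hN.cov_init_w k) i) r
    · exact congrFun (congrFun (hN.cov_w_w k l hl.ne') r) i
    · rw [covariance_comm]; exact congrFun (congrFun (hN.cov_v_w l k) i) r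

lemma crossCov_v_past (hN : IsGaussianNoise Pr Sig0 Q R x₀ w v) {κ : Type*} {k : ℕ}
    {X : Ω → κ → ℝ} (hX : ∀ i, (fun ω => X ω i) ∈ Submodule.span ℝ (pastNoise x₀ w v k)) :
    crossCov Pr (v (k + 1)) X = 0 := by
  ext r j
  refine covariance_eq_zero_of_mem_span (S := {fun ω => v (k + 1) ω r}) ?_
    (fun X hX => hN.memLp_noiseCoord (pastNoise_subset_range k hX)) ?_
    (Submodule.mem_span_singleton_self _) (hX j)
  · rintro X rfl; exact hN.memLp_v _ r
  · rintro X rfl Y (⟨i, rfl⟩ | ⟨l, hl, i, rfl⟩ | ⟨l, hl, i, rfl⟩)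
    · exact congrFun (congrFun (hN.cov_v_init (k + 1)) r) i
    · exact congrFun (congrFun (hN.cov_v_w (k + 1) l) r) i
    · exact congrFun (congrFun (hN.cov_v_v (k + 1) l (by omega)) r) i

end IsGaussianNoise

variable [IsProbabilityMeasure Pr]

lemma crossCov_add_add_self {ι : Type*} {X W : Ω → ι → ℝ}
    (hX : ∀ i, MemLp (fun ω => X ω i) 2 Pr) (hW : ∀ i, MemLp (fun ω => W ω i) 2 Pr)
    (h : crossCov Pr W X = 0) :
    crossCov Pr (fun ω => X ω + W ω) (fun ω => X ω + W ω) = crossCov Pr X X + crossCov Pr W W := by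
  have h' : crossCov Pr X W = 0 := by rw [← crossCov_transpose, h, transpose_zero]
  rw [crossCov_add_left hX hW (memLp_vec_add hX hW), crossCov_add_right hX hW hX,
    crossCov_add_right hX hW hW, h, h', add_zero, zero_add]

/-- The new error combines the old error, `w k` and `v (k+1)`, which are mutually uncorrelated. The
three covariances add up to the Joseph form. -/
lemma crossCov_optimal_error (hN : IsGaussianNoise Pr Sig0 Q R x₀ w v)
    (hP : IsLinearPlant A C x₀ w v x y)
    (hinv : ∀ k, IsUnit (innovationCov C R (predictionCov A C Q R Sig0 k)).det) (k : ℕ) :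
    crossCov Pr (fun ω => optimalEstimate A C Q R Sig0 y k ω - x k ω)
      (fun ω => optimalEstimate A C Q R Sig0 y k ω - x k ω) = estimationCov A C Q R Sig0 k := by
  induction k with
  | zero =>
    have h1 : crossCov Pr (fun ω => optimalEstimate A C Q R Sig0 y 0 ω - x 0 ω)
      (fun ω => optimalEstimate A C Q R Sig0 y 0 ω - x 0 ω) = crossCov Pr x₀ x₀ := by
      ext i j
      simp [crossCov, optimalEstimate, gainEstimate, hP.init]
    rw [h1, hN.cov_init, estimationCov]
  | succ k ih =>
    set Lk := kalmanGain C R (predictionCov A C Q R Sig0 k) with hL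
    have hmem := hP.error_mem (L := fun k => kalmanGain C R (predictionCov A C Q R Sig0 k)) k
    have he := fun i => hN.memLp (hmem i)
    have hw := hN.memLp_w k
    have hv := hN.memLp_v (k + 1)
    simp only [optimalEstimate] at ih ⊢
    simp only [hP.error_succ, ← hL]
    have he' := memLp_mulVec ((1 - Lk * C) * A) he
    have hw' := memLp_mulVec (-(1 - Lk * C)) hw
    have hv' := memLp_mulVec Lk hv
    have hmem' : ∀ i, (fun ω => ((((1 - Lk * C) * A) *ᵥ
        (gainEstimate A C (fun k => kalmanGain C R (predictionCov A C Q R Sig0 k)) y k ω - x k ω)))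
        i) ∈ Submodule.span ℝ (pastNoise x₀ w v k) := mulVec_coord_mem _ _ hmem
    rw [crossCov_add_add_self (memLp_vec_add he' hw') hv',
      crossCov_add_add_self he' hw', crossCov_mulVec_left _ he he',
      crossCov_mulVec_right _ he he, ih, crossCov_mulVec_left _ hw hw',
      crossCov_mulVec_right _ hw hw, hN.cov_w, crossCov_mulVec_left _ hv hv',
      crossCov_mulVec_right _ hv hv, hN.cov_v, estimationCov, filteredCov_eq_joseph (hinv k), ← hL,
      predictionCov_eq_estimationCov]
    · simp only [transpose_mul, transpose_neg, Matrix.mul_add, Matrix.add_mul, Matrix.mul_neg,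
        Matrix.neg_mul, neg_neg, Matrix.mul_assoc]
    · rw [crossCov_mulVec_left _ hw he', hN.crossCov_w_past hmem', Matrix.mul_zero]
    · rw [crossCov_mulVec_left _ hv (memLp_vec_add he' hw'),
        crossCov_add_right he' hw' hv, hN.crossCov_v_past hmem', crossCov_mulVec_right _ hw hv,
        hN.cov_v_w, Matrix.zero_mul, add_zero, Matrix.mul_zero]

/-- The optimal error is uncorrelated with the measurements used by the filter. -/
lemma crossCov_optimal_error_measurement (hN : IsGaussianNoise Pr Sig0 Q R x₀ w v)
    (hP : IsLinearPlant A C x₀ w v x y)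
    (hinv : ∀ k, IsUnit (innovationCov C R (predictionCov A C Q R Sig0 k)).det) (k : ℕ) :
    ∀ j, 1 ≤ j → j ≤ k →
      crossCov Pr (fun ω => optimalEstimate A C Q R Sig0 y k ω - x k ω) (y j) = 0 := by
  induction k with
  | zero => intro j h1 h2; omega
  | succ k ih =>
    intro j hj1 hj2
    have hcov := crossCov_optimal_error hN hP hinv k
    set Lk := kalmanGain C R (predictionCov A C Q R Sig0 k) with hL
    simp only [optimalEstimate] at ih hcov ⊢
    have hmem := hP.error_mem (L := fun k => kalmanGain C R (predictionCov A C Q R Sig0 k)) k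
    simp only [hP.error_succ, ← hL]
    set xo := gainEstimate A C (fun k => kalmanGain C R (predictionCov A C Q R Sig0 k)) y with hxo
    have he := fun i => hN.memLp (hmem i)
    have hw := hN.memLp_w k
    have hv := hN.memLp_v (k + 1)
    have he' := memLp_mulVec ((1 - Lk * C) * A) he
    have hw' := memLp_mulVec (-(1 - Lk * C)) hw
    have hv' := memLp_mulVec Lk hv
    have hy := fun i => hN.memLp (hP.measurement_mem j i)
    rw [crossCov_add_left (memLp_vec_add he' hw') hv' hy, crossCov_add_left he' hw' hy,
      crossCov_mulVec_left _ he hy, crossCov_mulVec_left _ hw hy, crossCov_mulVec_left _ hv hy]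
    -- Older measurements are orthogonal to the three terms by induction and by whiteness; only the
    -- newest one, `j = k + 1`, uses the choice of the gain.
    rcases Nat.lt_or_ge k j with hkj | hkj
    · obtain rfl : j = k + 1 := by omega
      have hx := fun i => hN.memLp (hP.state_mem k i)
      have hxom : ∀ i, (fun ω => xo k ω i) ∈ Submodule.span ℝ (pastMeasurements y k) :=
        gainEstimate_mem k
      have hxo2 := fun i => hN.memLp
        (Submodule.span_le.2 (hP.pastMeasurements_subset k) (hxom i))
      -- The estimate is linear in measurements to which the error is already orthogonal.
      have hexo : crossCov Pr (fun ω => xo k ω - x k ω) (xo k) = 0 := by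
        ext i l
        refine covariance_eq_zero_of_mem_span (S := {fun ω => (xo k ω - x k ω) i})
          (T := pastMeasurements y k) ?_ ?_ ?_ (Submodule.mem_span_singleton_self _) (hxom l)
        · rintro X rfl; exact he i
        · intro X hX; exact hN.memLp (hP.pastMeasurements_subset k hX)
        · rintro X rfl Y ⟨j, i', h1, h2, rfl⟩
          exact congrFun (congrFun (ih j h1 h2) i) i'
      -- Since `x = x° - (x° - x)` and the error is orthogonal to `x°`, only minus its own
      -- covariance remains.
      have hex : crossCov Pr (fun ω => xo k ω - x k ω) (x k)
          = - estimationCov A C Q R Sig0 k := by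
        have h1 : xo k = fun ω => (xo k ω - x k ω) + x k ω := by ext; simp
        rw [h1] at hexo
        have h2 := crossCov_add_right (Pr := Pr) he hx he
        simp only [sub_add_cancel] at hexo h2
        rw [hcov] at h2
        rw [eq_neg_iff_add_eq_zero, add_comm, ← h2]
        exact hexo
      have hyk : y (k + 1) = fun ω => (C * A) *ᵥ x k ω + C *ᵥ w k ω + v (k + 1) ω := by
        ext1 ω
        rw [hP.meas, hP.succ, mulVec_add, mulVec_mulVec]
      have hx' := memLp_mulVec (C * A) hx
      have hcw := memLp_mulVec C hw
      have hmemx : ∀ i, (fun ω => ((C * A) *ᵥ x k ω) i) ∈ Submodule.span ℝ (pastNoise x₀ w v k) :=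
        mulVec_coord_mem _ _ (hP.state_mem k)
      have e1 : crossCov Pr (fun ω => xo k ω - x k ω) (y (k + 1))
          = - estimationCov A C Q R Sig0 k * (C * A)ᵀ := by
        rw [hyk, crossCov_add_right (memLp_vec_add hx' hcw) hv he,
          crossCov_add_right hx' hcw he, crossCov_mulVec_right _ hx he, crossCov_mulVec_right _ hw he,
          hex, ← crossCov_transpose (w k), hN.crossCov_w_past hmem, ← crossCov_transpose (v (k + 1)),
          hN.crossCov_v_past hmem]
        simp
      have e2 : crossCov Pr (w k) (y (k + 1)) = Q * Cᵀ := by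
        rw [hyk, crossCov_add_right (memLp_vec_add hx' hcw) hv hw,
          crossCov_add_right hx' hcw hw, hN.crossCov_w_past hmemx, crossCov_mulVec_right _ hw hw,
          hN.cov_w, ← crossCov_transpose (v (k + 1)), hN.cov_v_w]
        simp
      have e3 : crossCov Pr (v (k + 1)) (y (k + 1)) = R := by
        rw [hyk, crossCov_add_right (memLp_vec_add hx' hcw) hv hv,
          crossCov_add_right hx' hcw hv, hN.crossCov_v_past hmemx, crossCov_mulVec_right _ hw hv,
          hN.cov_v, hN.cov_v_w]
        simp
      have hgain := kalmanGain_mul_innovationCov (hinv k)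
      rw [← hL] at hgain
      -- The equation of the Kalman gain, solved for `L R`, is exactly what makes the three
      -- contributions cancel.
      have hR : Lk * R = predictionCov A C Q R Sig0 k * Cᵀ
          - Lk * (C * predictionCov A C Q R Sig0 k * Cᵀ) := by
        rw [← hgain, Matrix.mul_add]; abel
      rw [e1, e2, e3, hR, predictionCov_eq_estimationCov]
      simp only [transpose_mul, Matrix.mul_add, Matrix.add_mul, Matrix.mul_neg, Matrix.neg_mul,
        Matrix.sub_mul, Matrix.one_mul, Matrix.mul_assoc]
      abel
    · have hyj : ∀ i, (fun ω => y j ω i) ∈ Submodule.span ℝ (pastNoise x₀ w v k) := fun i =>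
        hP.pastMeasurements_subset k ⟨j, i, hj1, hkj, rfl⟩
      rw [ih j hj1 hkj, hN.crossCov_w_past hyj, hN.crossCov_v_past hyj]
      simp

/-- Error and measurements are jointly Gaussian, as linear combinations of the noises, so zero
covariance becomes independence. The shift `p.1 + 1` leaves out `y_0`, which the filter does not
use. -/
theorem indepFun_optimal_error (hN : IsGaussianNoise Pr Sig0 Q R x₀ w v)
    (hP : IsLinearPlant A C x₀ w v x y)
    (hinv : ∀ k, IsUnit (innovationCov C R (predictionCov A C Q R Sig0 k)).det) (k : ℕ) :
    IndepFun (fun ω => optimalEstimate A C Q R Sig0 y k ω - x k ω)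
      (fun ω (p : Fin k × Fin m) => y (p.1 + 1) ω p.2) Pr := by
  have hmem := hP.error_mem (L := fun k => kalmanGain C R (predictionCov A C Q R Sig0 k)) k
  have hmemy : ∀ p : Fin k × Fin m, (fun ω => y (p.1 + 1) ω p.2)
      ∈ Submodule.span ℝ (pastNoise x₀ w v k) := fun p =>
    hP.pastMeasurements_subset k ⟨p.1 + 1, p.2, by omega, by omega, rfl⟩
  refine IsGaussianProcess.indepFun_of_covariance_eq_zero
    (X := fun i ω => (optimalEstimate A C Q R Sig0 y k ω - x k ω) i)
    (Y := fun (p : Fin k × Fin m) ω => y (p.1 + 1) ω p.2) ?_ ?_ ?_ ?_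
  · refine isGaussianProcess_of_mem_span hN.gaussian ?_
    rintro (i | p)
    · exact span_pastNoise_le k (hmem i)
    · exact span_pastNoise_le k (hmemy p)
  · exact fun i => (hN.memLp (hmem i)).1.aemeasurable
  · exact fun p => (hN.memLp (hmemy p)).1.aemeasurable
  · intro i p
    exact congrFun (congrFun (crossCov_optimal_error_measurement hN hP hinv k (p.1 + 1) (by omega)
      (by omega)) i) p.2

end KalmanFilter

/-! ### Scalar contractive recursions. -/

lemma exists_bound_of_le_mul_add {θ M : ℝ} (hθ : 0 ≤ θ) (hθ' : θ < 1) {α : ℕ → ℝ}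
    (h : ∀ k, α (k + 1) ≤ θ * α k + M) : ∃ M', ∀ k, α k ≤ M' := by
  -- The number `M / (1 - θ)` is the fixed point of the recursion, so no value from it upwards can
  -- be exceeded later.
  refine ⟨max (α 0) (M / (1 - θ)), fun k => ?_⟩
  induction k with
  | zero => exact le_max_left _ _
  | succ k ih =>
    set b := max (α 0) (M / (1 - θ)) with hb
    have h1 : M ≤ b * (1 - θ) := (div_le_iff₀ (by linarith)).1 (le_max_right _ _)
    nlinarith [h k, mul_le_mul_of_nonneg_left ih hθ]

/-- Once `c` stays below `ε / 2 * (1 - θ)`, the recursion gives `θ ^ j * α N + ε / 2` after `j` more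
steps. -/
lemma tendsto_zero_of_le_mul_add {θ : ℝ} (hθ : 0 ≤ θ) (hθ' : θ < 1) {α c : ℕ → ℝ}
    (hα : ∀ k, 0 ≤ α k) (hc : Tendsto c atTop (𝓝 0)) (h : ∀ k, α (k + 1) ≤ θ * α k + c k) :
    Tendsto α atTop (𝓝 0) := by
  rw [Metric.tendsto_atTop]
  intro ε hε
  have hε' : 0 < ε / 2 * (1 - θ) := mul_pos (by linarith) (by linarith)
  obtain ⟨N, hN⟩ := eventually_atTop.1 (hc.eventually (gt_mem_nhds hε'))
  have h1 : ∀ j, α (N + j) ≤ θ ^ j * α N + ε / 2 := by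
    intro j
    induction j with
    | zero => simp; linarith
    | succ j ih =>
      have h2 := h (N + j)
      have h3 := hN (N + j) (by omega)
      rw [← add_assoc, pow_succ]
      nlinarith [mul_le_mul_of_nonneg_left ih hθ]
  have h2 : Tendsto (fun j => θ ^ j * α N) atTop (𝓝 0) := by
    simpa using (tendsto_pow_atTop_nhds_zero_of_lt_one hθ hθ').mul_const (α N)
  obtain ⟨J, hJ⟩ := eventually_atTop.1 (h2.eventually (gt_mem_nhds (half_pos hε)))
  refine ⟨N + J, fun k hk => ?_⟩
  obtain ⟨j, rfl⟩ := Nat.exists_eq_add_of_le (show N ≤ k by omega)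
  rw [Real.dist_eq, sub_zero, abs_of_nonneg (hα _)]
  linarith [h1 j, hJ j (by omega)]

/-! ### Sequences bounded or vanishing in `L²`. -/

section L2

variable {Ω : Type*} [MeasurableSpace Ω] {Pr : Measure Ω}

lemma lpNorm_two_sq {E : Type*} [NormedAddCommGroup E] {f : Ω → E} (hf : MemLp f 2 Pr) :
    lpNorm f 2 Pr ^ 2 = ∫ ω, ‖f ω‖ ^ 2 ∂Pr := by
  rw [lpNorm_eq_integral_norm_rpow_toReal (by norm_num) (by norm_num) hf.1, ← Real.rpow_natCast,
    ← Real.rpow_mul (integral_nonneg fun _ => by positivity)]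
  norm_num

lemma lpNorm_const_mul_le (c : ℂ) (f : Ω → ℂ) :
    lpNorm (fun ω => c * f ω) 2 Pr = ‖c‖ * lpNorm f 2 Pr :=
  lpNorm_const_smul c f Pr

/-- The sequence of random variables is bounded in `L²`. -/
def IsL2Bounded (Pr : Measure Ω) (f : ℕ → Ω → ℂ) : Prop :=
  ∃ M, ∀ k, MemLp (f k) 2 Pr ∧ lpNorm (f k) 2 Pr ≤ M

/-- The sequence of random variables tends to zero in `L²`. -/
def IsL2Null (Pr : Measure Ω) (f : ℕ → Ω → ℂ) : Prop :=
  (∀ k, MemLp (f k) 2 Pr) ∧ Tendsto (fun k => lpNorm (f k) 2 Pr) atTop (𝓝 0)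

namespace IsL2Bounded

variable {f g : ℕ → Ω → ℂ}

lemma memLp (hf : IsL2Bounded Pr f) (k : ℕ) : MemLp (f k) 2 Pr := hf.choose_spec k |>.1

lemma add (hf : IsL2Bounded Pr f) (hg : IsL2Bounded Pr g) :
    IsL2Bounded Pr fun k ω => f k ω + g k ω := by
  obtain ⟨M, hM⟩ := hf
  obtain ⟨N, hN⟩ := hg
  exact ⟨M + N, fun k => ⟨(hM k).1.add (hN k).1,
    (lpNorm_add_le (hM k).1 one_le_two).trans (add_le_add (hM k).2 (hN k).2)⟩⟩

lemma const_mul (hf : IsL2Bounded Pr f) (c : ℂ) : IsL2Bounded Pr fun k ω => c * f k ω := by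
  obtain ⟨M, hM⟩ := hf
  refine ⟨‖c‖ * M, fun k => ⟨(hM k).1.const_mul c, ?_⟩⟩
  rw [lpNorm_const_mul_le]
  exact mul_le_mul_of_nonneg_left (hM k).2 (norm_nonneg c)

lemma sub (hf : IsL2Bounded Pr f) (hg : IsL2Bounded Pr g) :
    IsL2Bounded Pr fun k ω => f k ω - g k ω := by
  simpa [sub_eq_add_neg] using hf.add (hg.const_mul (-1))

lemma sum {ι : Type*} (s : Finset ι) {f : ι → ℕ → Ω → ℂ} (hf : ∀ i, IsL2Bounded Pr (f i)) :
    IsL2Bounded Pr fun k ω => ∑ i ∈ s, f i k ω := by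
  classical
  induction s using Finset.induction_on with
  | empty => exact ⟨0, fun k => by simp⟩
  | insert a s ha ih => simpa [Finset.sum_insert ha] using (hf a).add ih

lemma mulVec {ι κ : Type*} [Fintype κ] (M : Matrix ι κ ℂ) {u : ℕ → Ω → κ → ℂ}
    (hu : ∀ j, IsL2Bounded Pr fun k ω => u k ω j) (i : ι) :
    IsL2Bounded Pr fun k ω => (M *ᵥ u k ω) i := by
  simp only [Matrix.mulVec, dotProduct]
  exact sum _ fun j => (hu j).const_mul _

lemma of_stable_recursion {c : ℂ} (hc : ‖c‖ < 1) (h0 : MemLp (f 0) 2 Pr) (hg : IsL2Bounded Pr g)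
    (h : ∀ k ω, f (k + 1) ω = c * f k ω + g k ω) : IsL2Bounded Pr f := by
  obtain ⟨M, hM⟩ := hg
  have hmem : ∀ k, MemLp (f k) 2 Pr := by
    intro k
    induction k with
    | zero => exact h0
    | succ k ih => rw [funext (h k)]; exact (ih.const_mul c).add (hM k).1
  obtain ⟨M', hM'⟩ := exists_bound_of_le_mul_add (norm_nonneg c) hc (M := M)
    (α := fun k => lpNorm (f k) 2 Pr) (fun k => by
      rw [funext (h k), ← lpNorm_const_mul_le]
      exact (lpNorm_add_le ((hmem k).const_mul c) one_le_two).trans (by gcongr; exact (hM k).2))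
  exact ⟨M', fun k => ⟨hmem k, hM' k⟩⟩

lemma of_integral_le {M : ℝ} (hf : ∀ k, MemLp (f k) 2 Pr) (h : ∀ k, ∫ ω, ‖f k ω‖ ^ 2 ∂Pr ≤ M) :
    IsL2Bounded Pr f :=
  ⟨Real.sqrt M, fun k => ⟨hf k, Real.le_sqrt_of_sq_le ((lpNorm_two_sq (hf k)).trans_le (h k))⟩⟩

lemma exists_integral_le (hf : IsL2Bounded Pr f) : ∃ M, ∀ k, ∫ ω, ‖f k ω‖ ^ 2 ∂Pr ≤ M := by
  obtain ⟨M, hM⟩ := hf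
  refine ⟨M ^ 2, fun k => ?_⟩
  rw [← lpNorm_two_sq (hM k).1]
  exact pow_le_pow_left₀ lpNorm_nonneg (hM k).2 2

end IsL2Bounded

namespace IsL2Null

variable {f g : ℕ → Ω → ℂ}

lemma add (hf : IsL2Null Pr f) (hg : IsL2Null Pr g) : IsL2Null Pr fun k ω => f k ω + g k ω := by
  refine ⟨fun k => (hf.1 k).add (hg.1 k), squeeze_zero (fun k => lpNorm_nonneg)
    (fun k => lpNorm_add_le (hf.1 k) one_le_two) ?_⟩
  simpa using hf.2.add hg.2

lemma const_mul (hf : IsL2Null Pr f) (c : ℂ) : IsL2Null Pr fun k ω => c * f k ω := by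
  refine ⟨fun k => (hf.1 k).const_mul c, ?_⟩
  simp only [lpNorm_const_mul_le]
  simpa using hf.2.const_mul ‖c‖

lemma of_tendsto_mul {c : ℕ → ℂ} (hc : Tendsto c atTop (𝓝 0)) (hf : IsL2Bounded Pr f) :
    IsL2Null Pr fun k ω => c k * f k ω := by
  obtain ⟨M, hM⟩ := hf
  refine ⟨fun k => (hM k).1.const_mul _, ?_⟩
  simp only [lpNorm_const_mul_le]
  refine squeeze_zero (fun k => mul_nonneg (norm_nonneg _) lpNorm_nonneg)
    (fun k => mul_le_mul_of_nonneg_left (hM k).2 (norm_nonneg _)) ?_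
  simpa using hc.norm.mul_const M

lemma sum {ι : Type*} (s : Finset ι) {f : ι → ℕ → Ω → ℂ} (hf : ∀ i, IsL2Null Pr (f i)) :
    IsL2Null Pr fun k ω => ∑ i ∈ s, f i k ω := by
  classical
  induction s using Finset.induction_on with
  | empty => exact ⟨fun k => by simp, by simp⟩
  | insert a s ha ih => simpa [Finset.sum_insert ha] using (hf a).add ih

lemma isL2Bounded (hf : IsL2Null Pr f) : IsL2Bounded Pr f := by
  obtain ⟨M, hM⟩ := hf.2.bddAbove_range
  exact ⟨M, fun k => ⟨hf.1 k, hM ⟨k, rfl⟩⟩⟩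

lemma of_stable_recursion {c : ℂ} (hc : ‖c‖ < 1) (h0 : MemLp (f 0) 2 Pr) (hg : IsL2Null Pr g)
    (h : ∀ k ω, f (k + 1) ω = c * f k ω + g k ω) : IsL2Null Pr f := by
  have hmem := (IsL2Bounded.of_stable_recursion hc h0 hg.isL2Bounded h).memLp
  refine ⟨hmem, tendsto_zero_of_le_mul_add (norm_nonneg c) hc (fun k => lpNorm_nonneg) hg.2
    fun k => ?_⟩
  rw [funext (h k), ← lpNorm_const_mul_le]
  exact lpNorm_add_le ((hmem k).const_mul c) one_le_two

end IsL2Null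

lemma isL2Bounded_ofReal {f : ℕ → Ω → ℝ} {M : ℝ} (hf : ∀ k, MemLp (f k) 2 Pr)
    (h : ∀ k, ∫ ω, f k ω ^ 2 ∂Pr ≤ M) : IsL2Bounded Pr fun k ω => (f k ω : ℂ) :=
  IsL2Bounded.of_integral_le (fun k => (hf k).ofReal) (by simpa using h)

/-- The filter is linear in its input, so its expectation satisfies the same recursion with the
expected input. -/
lemma exists_integral_geomFilter_le [IsProbabilityMeasure Pr] {ρ c M : ℝ} (hρ : 0 ≤ ρ)
    (hρ' : ρ < 1) (hc : 0 ≤ c) {g : Ω → ℕ → ℝ} (hg : ∀ k, Integrable (fun ω => g ω k) Pr)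
    (hM : ∀ k, ∫ ω, g ω k ∂Pr ≤ M) :
    ∃ M', ∀ k, Integrable (fun ω => geomFilter ρ c (g ω) k) Pr ∧
      ∫ ω, geomFilter ρ c (g ω) k ∂Pr ≤ M' := by
  have hint : ∀ k, Integrable (fun ω => geomFilter ρ c (g ω) k) Pr := by
    intro k
    induction k with
    | zero => exact integrable_zero _ _ _
    | succ k ih => exact (ih.const_mul ρ).add (((integrable_const 1).add (hg k)).const_mul c)
  obtain ⟨M', hM'⟩ := exists_bound_of_le_mul_add hρ hρ' (M := c * (1 + M))
    (α := fun k => ∫ ω, geomFilter ρ c (g ω) k ∂Pr) (fun k => by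
      have h2 : ∫ ω, (1 + g ω k) ∂Pr = 1 + ∫ ω, g ω k ∂Pr := by
        rw [integral_add (integrable_const 1) (hg k)]; simp
      have h1 : ∫ ω, geomFilter ρ c (g ω) (k + 1) ∂Pr
          = ρ * ∫ ω, geomFilter ρ c (g ω) k ∂Pr + c * (1 + ∫ ω, g ω k ∂Pr) := by
        have h3 : Integrable (fun ω => 1 + g ω k) Pr := (integrable_const 1).add (hg k)
        simp only [geomFilter]
        rw [integral_add ((hint k).const_mul ρ) (h3.const_mul c),
          integral_const_mul, integral_const_mul, h2]
      rw [h1]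
      gcongr
      exact hM k)
  exact ⟨M', fun k => ⟨hint k, hM' k⟩⟩

end L2

/-! ### Complex variances and the Loewner order. -/

section CVar

variable {Ω : Type*} [MeasurableSpace Ω] {Pr : Measure Ω}

/-- The variance `E |f - E f|²` of a complex random variable. -/
noncomputable def cvar (Pr : Measure Ω) (f : Ω → ℂ) : ℝ := ∫ ω, ‖f ω - ∫ ω', f ω' ∂Pr‖ ^ 2 ∂Pr

lemma memLp_star_dotProduct {ι : Type*} [Fintype ι] {X : Ω → ι → ℂ}
    (hX : IsSquareIntegrable Pr X) (u : ι → ℂ) :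
    MemLp (fun ω => star u ⬝ᵥ X ω) 2 Pr := by
  simp only [dotProduct]
  exact memLp_finsetSum _ fun p _ => (hX p).const_mul _

lemma covMat_isHermitian {ι : Type*} (X : Ω → ι → ℂ) : (covMat Pr X).IsHermitian := by
  ext p q
  rw [conjTranspose_apply, covMat, of_apply, of_apply, Complex.star_def, ← integral_conj]
  congr 1
  ext ω
  simp [mul_comm]

variable [IsProbabilityMeasure Pr]

variable {f g : Ω → ℂ}

lemma memLp_sub_integral (hf : MemLp f 2 Pr) : MemLp (fun ω => f ω - ∫ ω', f ω' ∂Pr) 2 Pr :=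
  hf.sub (memLp_const _)

lemma cvar_eq_lpNorm_sq (hf : MemLp f 2 Pr) :
    cvar Pr f = lpNorm (fun ω => f ω - ∫ ω', f ω' ∂Pr) 2 Pr ^ 2 :=
  (lpNorm_two_sq (memLp_sub_integral hf)).symm

lemma integral_norm_sq_eq_cvar_add (hf : MemLp f 2 Pr) :
    ∫ ω, ‖f ω‖ ^ 2 ∂Pr = cvar Pr f + ‖∫ ω, f ω ∂Pr‖ ^ 2 := by
  set c := ∫ ω, f ω ∂Pr with hc
  have h1 : ∀ ω, ‖f ω‖ ^ 2 = ‖f ω - c‖ ^ 2 + 2 * ((star c) * (f ω - c)).re + ‖c‖ ^ 2 := by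
    intro ω
    simp only [← Complex.normSq_eq_norm_sq, Complex.normSq_apply, Complex.mul_re,
      Complex.sub_re, Complex.sub_im, Complex.star_def, Complex.conj_re, Complex.conj_im]
    ring
  have i1 := (memLp_two_iff_integrable_sq_norm (memLp_sub_integral hf).1).1 (memLp_sub_integral hf)
  have i2 : Integrable (fun ω => f ω - c) Pr := (memLp_sub_integral hf).integrable one_le_two
  have i3 : Integrable (fun ω => (star c) * (f ω - c)) Pr := i2.const_mul _
  have h2 : ∫ ω, ((star c) * (f ω - c)).re ∂Pr = 0 := by
    have h3 := integral_re i3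
    simp only [RCLike.re_eq_complex_re] at h3
    rw [h3, integral_const_mul, integral_sub (hf.integrable one_le_two) (integrable_const _)]
    simp [hc]
  have i4 : Integrable (fun ω => 2 * ((star c) * (f ω - c)).re) Pr := i3.re.const_mul 2
  have i5 : Integrable (fun ω => ‖f ω - c‖ ^ 2 + 2 * ((star c) * (f ω - c)).re) Pr := i1.add i4
  simp only [h1]
  rw [integral_add i5 (integrable_const _), integral_add i1 i4, integral_const_mul, h2]
  simp [cvar, hc]

lemma cvar_le_integral (hf : MemLp f 2 Pr) : cvar Pr f ≤ ∫ ω, ‖f ω‖ ^ 2 ∂Pr := by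
  rw [integral_norm_sq_eq_cvar_add hf]
  nlinarith [norm_nonneg (∫ ω, f ω ∂Pr)]

/-- Minkowski's inequality for the centred variables. It serves for `F δ` and `D`, which may be
dependent. -/
lemma sqrt_cvar_add_le (hf : MemLp f 2 Pr) (hg : MemLp g 2 Pr) :
    Real.sqrt (cvar Pr fun ω => f ω + g ω) ≤ Real.sqrt (cvar Pr f) + Real.sqrt (cvar Pr g) := by
  rw [cvar_eq_lpNorm_sq (f := fun ω => f ω + g ω) (hf.add hg), cvar_eq_lpNorm_sq hf,
    cvar_eq_lpNorm_sq hg, Real.sqrt_sq lpNorm_nonneg, Real.sqrt_sq lpNorm_nonneg,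
    Real.sqrt_sq lpNorm_nonneg]
  refine le_trans (le_of_eq ?_) (lpNorm_add_le (memLp_sub_integral hf) one_le_two)
  congr 1
  ext ω
  rw [integral_add (hf.integrable one_le_two) (hg.integrable one_le_two), Pi.add_apply]
  ring

lemma cvar_add_of_indepFun (hf : MemLp f 2 Pr) (hg : MemLp g 2 Pr) (h : IndepFun f g Pr) :
    cvar Pr (fun ω => f ω + g ω) = cvar Pr f + cvar Pr g := by
  set c := ∫ ω, f ω ∂Pr with hc
  set d := ∫ ω, g ω ∂Pr with hd
  have hf' := memLp_sub_integral hf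
  have hg' := memLp_sub_integral hg
  have h1 : ∀ ω, ‖f ω + g ω - (c + d)‖ ^ 2
      = ‖f ω - c‖ ^ 2 + 2 * ((f ω - c) * star (g ω - d)).re + ‖g ω - d‖ ^ 2 := by
    intro ω
    simp only [← Complex.normSq_eq_norm_sq, Complex.normSq_apply, Complex.mul_re, Complex.add_re,
      Complex.add_im, Complex.sub_re, Complex.sub_im, Complex.star_def, Complex.conj_re,
      Complex.conj_im, map_sub]
    ring
  have i1 := (memLp_two_iff_integrable_sq_norm hf'.1).1 hf'
  have i2 := (memLp_two_iff_integrable_sq_norm hg'.1).1 hg'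
  have i3 : Integrable (fun ω => (f ω - c) * star (g ω - d)) Pr := hf'.integrable_mul hg'.star
  have h2 : ∫ ω, ((f ω - c) * star (g ω - d)).re ∂Pr = 0 := by
    have h3 := integral_re i3
    simp only [RCLike.re_eq_complex_re] at h3
    have h4 : IndepFun (fun ω => f ω - c) (fun ω => star (g ω - d)) Pr :=
      h.comp (φ := fun z => z - c) (ψ := fun z => star (z - d)) (by fun_prop)
        (continuous_star.measurable.comp (by fun_prop))
    rw [h3, h4.integral_fun_mul_eq_mul_integral hf'.1 hg'.star.1,
      integral_sub (hf.integrable one_le_two) (integrable_const _)]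
    simp [hc]
  have i4 : Integrable (fun ω => 2 * ((f ω - c) * star (g ω - d)).re) Pr := i3.re.const_mul 2
  have i5 : Integrable (fun ω => ‖f ω - c‖ ^ 2 + 2 * ((f ω - c) * star (g ω - d)).re) Pr :=
    i1.add i4
  rw [cvar, integral_add (hf.integrable one_le_two) (hg.integrable one_le_two)]
  simp only [← hc, ← hd, h1]
  rw [integral_add i5 i2, integral_add i1 i4, integral_const_mul, h2]
  simp [cvar]

variable {ι : Type*} [Fintype ι]

lemma star_dotProduct_covMat_mulVec {X : Ω → ι → ℂ} (hX : IsSquareIntegrable Pr X) (u : ι → ℂ) :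
    star u ⬝ᵥ covMat Pr X *ᵥ u = (cvar Pr (fun ω => star u ⬝ᵥ X ω) : ℂ) := by
  have hX' : ∀ p, MemLp (fun ω => X ω p - ∫ ω', X ω' p ∂Pr) 2 Pr := fun p =>
    memLp_sub_integral (hX p)
  have hmean : ∫ ω, star u ⬝ᵥ X ω ∂Pr = ∑ p, star (u p) * ∫ ω, X ω p ∂Pr := by
    simp only [dotProduct]
    rw [integral_finsetSum _ fun p _ => ((hX p).integrable one_le_two).const_mul _]
    exact Finset.sum_congr rfl fun p _ => integral_const_mul _ _
  have h1 : ∀ ω, ((‖star u ⬝ᵥ X ω - ∫ ω', star u ⬝ᵥ X ω' ∂Pr‖ ^ 2 : ℝ) : ℂ)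
      = ∑ p, ∑ q, star (u p) * u q *
        ((X ω p - ∫ ω', X ω' p ∂Pr) * star (X ω q - ∫ ω', X ω' q ∂Pr)) := by
    intro ω
    have h2 : star u ⬝ᵥ X ω - ∫ ω', star u ⬝ᵥ X ω' ∂Pr
        = ∑ p, star (u p) * (X ω p - ∫ ω', X ω' p ∂Pr) := by
      rw [hmean]; simp [dotProduct, mul_sub]
    rw [← Complex.normSq_eq_norm_sq, ← Complex.mul_conj, ← Complex.star_def, h2, star_sum,
      Finset.sum_mul_sum]
    refine Finset.sum_congr rfl fun p _ => Finset.sum_congr rfl fun q _ => ?_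
    rw [star_mul, star_star]
    ring
  have hint : ∀ p q, Integrable (fun ω => star (u p) * u q *
        ((X ω p - ∫ ω', X ω' p ∂Pr) * star (X ω q - ∫ ω', X ω' q ∂Pr))) Pr := fun p q =>
    ((hX' p).integrable_mul (hX' q).star).const_mul _
  rw [cvar, ← integral_complex_ofReal]
  simp only [h1]
  rw [integral_finsetSum _ fun p _ => integrable_finsetSum _ fun q _ => hint p q]
  simp only [dotProduct, mulVec, Finset.mul_sum, covMat, of_apply, Pi.star_apply]
  refine Finset.sum_congr rfl fun p _ => ?_
  rw [integral_finsetSum _ fun q _ => hint p q]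
  refine Finset.sum_congr rfl fun q _ => ?_
  rw [integral_const_mul]
  ring

lemma quadRe_covMat {X : Ω → ι → ℂ} (hX : IsSquareIntegrable Pr X) (u : ι → ℂ) :
    quadRe (covMat Pr X) u = cvar Pr fun ω => star u ⬝ᵥ X ω := by
  rw [quadRe, star_dotProduct_covMat_mulVec hX, Complex.ofReal_re]

lemma posSemidef_iff_quadRe {M : Matrix ι ι ℂ} :
    M.PosSemidef ↔ M.IsHermitian ∧ ∀ u, 0 ≤ quadRe M u := by
  refine ⟨fun h => ⟨h.1, quadRe_nonneg h⟩, fun h => ?_⟩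
  refine posSemidef_iff_dotProduct_mulVec.2 ⟨h.1, fun u => ?_⟩
  rw [Complex.le_def]
  refine ⟨h.2 u, ?_⟩
  exact (Complex.conj_eq_iff_im.1 (h.1.star_dotProduct_mulVec u u)).symm

/-- Reduces matrix inequalities to the variances of the scalars `star u ⬝ᵥ X`, the form in which
they are proved. -/
theorem covLE_iff {X : Ω → ι → ℂ} {M : Matrix ι ι ℂ} :
    CovLE Pr X M ↔ IsSquareIntegrable Pr X ∧ M.IsHermitian ∧
      ∀ u, cvar Pr (fun ω => star u ⬝ᵥ X ω) ≤ quadRe M u := by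
  refine and_congr_right fun hX => ?_
  rw [posSemidef_iff_quadRe]
  refine and_congr ?_ (forall_congr' fun u => ?_)
  · refine ⟨fun h => ?_, fun h => h.sub (covMat_isHermitian X)⟩
    simpa using h.add (covMat_isHermitian X (Pr := Pr))
  · rw [quadRe_sub, quadRe_covMat hX, sub_nonneg]

lemma exists_cvar_le {X : ℕ → Ω → ι → ℂ} (hX : ∀ p, IsL2Bounded Pr fun k ω => X k ω p) :
    ∃ M, 0 ≤ M ∧ ∀ k u, cvar Pr (fun ω => star u ⬝ᵥ X k ω) ≤ M * sqNorm u := by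
  choose M hM using fun p => (hX p).exists_integral_le
  have hM0 : ∀ p, 0 ≤ M p := fun p => (integral_nonneg fun _ => by positivity).trans (hM p 0)
  refine ⟨∑ p, M p, Finset.sum_nonneg fun p _ => hM0 p, fun k u => ?_⟩
  have hmem : IsSquareIntegrable Pr (X k) := fun p => (hX p).memLp k
  have hint : ∀ p, Integrable (fun ω => ‖X k ω p‖ ^ 2) Pr := fun p =>
    (memLp_two_iff_integrable_sq_norm (hmem p).1).1 (hmem p)
  have hs : sqNorm (star u) = sqNorm u := by simp [sqNorm]
  calc cvar Pr (fun ω => star u ⬝ᵥ X k ω) ≤ ∫ ω, ‖star u ⬝ᵥ X k ω‖ ^ 2 ∂Pr :=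
        cvar_le_integral (memLp_star_dotProduct hmem u)
    _ ≤ ∫ ω, sqNorm u * sqNorm (X k ω) ∂Pr := by
        refine integral_mono ((memLp_two_iff_integrable_sq_norm
          (memLp_star_dotProduct hmem u).1).1 (memLp_star_dotProduct hmem u)) ?_ fun ω => ?_
        · exact (integrable_finsetSum _ fun p _ => hint p).const_mul _
        · simpa [hs] using norm_dotProduct_sq_le (star u) (X k ω)
    _ = sqNorm u * ∑ p, ∫ ω, ‖X k ω p‖ ^ 2 ∂Pr := by
        rw [integral_const_mul, ← integral_finsetSum _ fun p _ => hint p]; rfl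
    _ ≤ (∑ p, M p) * sqNorm u := by
        rw [mul_comm]
        exact mul_le_mul_of_nonneg_right (Finset.sum_le_sum fun p _ => hM p k) (sqNorm_nonneg u)

/-- One null sequence controls all directions `u`, as the Loewner bound requires. -/
lemma tendsto_cvar_bound {X : ℕ → Ω → ι → ℂ} (hX : ∀ p, IsL2Null Pr fun k ω => X k ω p) :
    ∃ D : ℕ → ℝ, (∀ k, 0 ≤ D k) ∧ Tendsto D atTop (𝓝 0) ∧
      ∀ k u, Real.sqrt (cvar Pr fun ω => star u ⬝ᵥ X k ω) ≤ D k * Real.sqrt (sqNorm u) := by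
  refine ⟨fun k => ∑ p, lpNorm (fun ω => X k ω p) 2 Pr,
    fun k => Finset.sum_nonneg fun p _ => lpNorm_nonneg, ?_, fun k u => ?_⟩
  · simpa using tendsto_finsetSum Finset.univ fun p _ => (hX p).2
  have hmem : IsSquareIntegrable Pr (X k) := fun p => (hX p).1 k
  have h1 : lpNorm (fun ω => star u ⬝ᵥ X k ω) 2 Pr
      ≤ ∑ p, ‖u p‖ * lpNorm (fun ω => X k ω p) 2 Pr := by
    have h2 : (fun ω => star u ⬝ᵥ X k ω) = ∑ p, fun ω => star (u p) * X k ω p := by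
      ext ω; simp [dotProduct]
    rw [h2]
    refine (lpNorm_sum_le (fun p _ => (hmem p).const_mul _) one_le_two).trans (le_of_eq ?_)
    exact Finset.sum_congr rfl fun p _ => by rw [lpNorm_const_mul_le, norm_star]
  refine (Real.sqrt_le_left lpNorm_nonneg).2 ?_ |>.trans (h1.trans ?_)
  · rw [lpNorm_two_sq (memLp_star_dotProduct hmem u)]
    exact cvar_le_integral (memLp_star_dotProduct hmem u)
  · rw [Finset.sum_mul]
    refine Finset.sum_le_sum fun p _ => ?_
    rw [mul_comm]
    exact mul_le_mul_of_nonneg_left (Real.le_sqrt_of_sq_le (norm_sq_le_sqNorm u p)) lpNorm_nonneg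

end CVar

/-! ### Boundedness of the signals and convergence to the optimal filter. -/

section EstimationErrors

variable {n m : ℕ} {Ω : Type*} {A : Matrix (Fin n) (Fin n) ℝ} {C : Matrix (Fin m) (Fin n) ℝ}
  {Sig0 Q P : Matrix (Fin n) (Fin n) ℝ} {R : Matrix (Fin m) (Fin m) ℝ}
  {K : Matrix (Fin n) (Fin m) ℝ}
  {x₀ : Ω → Fin n → ℝ} {w : ℕ → Ω → Fin n → ℝ} {v : ℕ → Ω → Fin m → ℝ}
  {x : ℕ → Ω → Fin n → ℝ} {y : ℕ → Ω → Fin m → ℝ} {L : ℕ → Matrix (Fin n) (Fin m) ℝ}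

lemma tendsto_estimationCov (hP : Tendsto (predictionCov A C Q R Sig0) atTop (𝓝 P))
    (hPinv : IsUnit (innovationCov C R P).det) :
    Tendsto (estimationCov A C Q R Sig0) atTop (𝓝 (filteredCov C R P)) :=
  (tendsto_add_atTop_iff_nat 1).1 (tendsto_filteredCov hP hPinv)

lemma estimationCov_eq_of_steady (hP : P = A * filteredCov C R P * Aᵀ + Q)
    (h : Sig0 = filteredCov C R P) (k : ℕ) : estimationCov A C Q R Sig0 k = filteredCov C R P := by
  cases k with
  | zero => exact h
  | succ k => rw [estimationCov, predictionCov_eq_of_steady hP h]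

/-- The difference of two filters follows the first closed loop and is driven by the gain difference
times the innovation of the second. -/
lemma gainEstimate_sub_gainEstimate_succ (K L : ℕ → Matrix (Fin n) (Fin m) ℝ) (k : ℕ) (ω : Ω) :
    gainEstimate A C K y (k + 1) ω - gainEstimate A C L y (k + 1) ω
      = (A - K k * C * A) *ᵥ (gainEstimate A C K y k ω - gainEstimate A C L y k ω)
        + (K k - L k) *ᵥ (y (k + 1) ω - (C * A) *ᵥ gainEstimate A C L y k ω) := by
  simp only [gainEstimate, sub_mulVec, mulVec_sub, mulVec_mulVec, Matrix.sub_mul, Matrix.mul_assoc]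
  abel

/-- Expresses the innovation through noise and estimation error; it can stay bounded while the
measurements grow. -/
lemma IsLinearPlant.innovation_eq (hP : IsLinearPlant A C x₀ w v x y) (k : ℕ) (ω : Ω) :
    y (k + 1) ω - (C * A) *ᵥ gainEstimate A C L y k ω
      = C *ᵥ w k ω + v (k + 1) ω - (C * A) *ᵥ (gainEstimate A C L y k ω - x k ω) := by
  simp only [hP.meas, hP.succ, mulVec_add, mulVec_sub, mulVec_mulVec]
  abel

variable [MeasurableSpace Ω] {Pr : Measure Ω}

lemma measurable_gainEstimate {N : ℕ} (hy : ∀ j, 1 ≤ j → j ≤ N → Measurable (y j)) {k : ℕ}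
    (hk : k ≤ N) : Measurable (gainEstimate A C L y k) := by
  induction k with
  | zero => exact measurable_const
  | succ k ih =>
    exact (measurable_mulVec_real _ (ih (by omega))).add
      (measurable_mulVec_real _ (hy (k + 1) (by omega) hk))

lemma IsGaussianNoise.measurable_state (hN : IsGaussianNoise Pr Sig0 Q R x₀ w v)
    (hP : IsLinearPlant A C x₀ w v x y) (k : ℕ) : Measurable (x k) := by
  induction k with
  | zero => rw [hP.init]; exact hN.measurable_init
  | succ k ih =>
    rw [funext (hP.succ k)]
    exact (measurable_mulVec_real A ih).add (hN.measurable_w k)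

lemma IsGaussianNoise.measurable_measurement (hN : IsGaussianNoise Pr Sig0 Q R x₀ w v)
    (hP : IsLinearPlant A C x₀ w v x y) (k : ℕ) : Measurable (y k) := by
  rw [funext (hP.meas k)]
  exact (measurable_mulVec_real C (hN.measurable_state hP k)).add (hN.measurable_v k)

lemma isL2Bounded_mulVec_ofReal {ι κ : Type*} [Fintype κ] (M : Matrix ι κ ℝ)
    {X : ℕ → Ω → κ → ℝ} (hX : ∀ j, IsL2Bounded Pr fun k ω => (X k ω j : ℂ)) (i : ι) :
    IsL2Bounded Pr fun k ω => ((M *ᵥ X k ω) i : ℂ) := by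
  have h := IsL2Bounded.mulVec (toC M) (u := fun k ω j => (X k ω j : ℂ)) hX i
  simpa only [toC_mulVec_ofReal] using h

variable [IsProbabilityMeasure Pr]

lemma IsGaussianNoise.isL2Bounded_of_crossCov_le (hN : IsGaussianNoise Pr Sig0 Q R x₀ w v)
    {ι : Type*} {X : ℕ → Ω → ι → ℝ} {i : ι} {M : ℝ}
    (hX : ∀ k, (fun ω => X k ω i) ∈ Submodule.span ℝ (Set.range (noiseCoord x₀ w v)))
    (h : ∀ k, crossCov Pr (X k) (X k) i i ≤ M) : IsL2Bounded Pr fun k ω => (X k ω i : ℂ) := by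
  refine isL2Bounded_ofReal (M := M) (fun k => (hN.memLp_and_integral_eq_zero (hX k)).1)
    fun k => ?_
  obtain ⟨h1, h2⟩ := hN.memLp_and_integral_eq_zero (hX k)
  have h3 := h k
  rw [crossCov, of_apply, covariance_eq_sub h1 h1, h2] at h3
  simpa [pow_two] using h3

lemma IsGaussianNoise.isL2Bounded_w (hN : IsGaussianNoise Pr Sig0 Q R x₀ w v) (i : Fin n) :
    IsL2Bounded Pr fun k ω => (w k ω i : ℂ) :=
  hN.isL2Bounded_of_crossCov_le (fun k => Submodule.subset_span ⟨.inr (.inl (k, i)), rfl⟩)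
    fun k => (congrFun (congrFun (hN.cov_w k) i) i).le

lemma IsGaussianNoise.isL2Bounded_v (hN : IsGaussianNoise Pr Sig0 Q R x₀ w v) (i : Fin m) :
    IsL2Bounded Pr fun k ω => (v (k + 1) ω i : ℂ) :=
  hN.isL2Bounded_of_crossCov_le (X := fun k => v (k + 1))
    (fun k => Submodule.subset_span ⟨.inr (.inr (k + 1, i)), rfl⟩)
    fun k => (congrFun (congrFun (hN.cov_v (k + 1)) i) i).le

lemma isL2Bounded_measurementNoise (hN : IsGaussianNoise Pr Sig0 Q R x₀ w v) (i : Fin m) :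
    IsL2Bounded Pr fun k ω => (((C *ᵥ w k ω) i + v (k + 1) ω i : ℝ) : ℂ) := by
  simp only [Complex.ofReal_add]
  exact (isL2Bounded_mulVec_ofReal C hN.isL2Bounded_w i).add (hN.isL2Bounded_v i)

/-- The local error is a stable recursion driven by noise, and the output depends on this error and
the noise only. No stability of the plant is needed. -/
lemma isL2Bounded_localOutput (hN : IsGaussianNoise Pr Sig0 Q R x₀ w v)
    (hP : IsLinearPlant A C x₀ w v x y) {lam β : Fin n → ℂ} (hlam : ∀ r, ‖lam r‖ < 1)
    {G : Matrix (Fin n) (Fin n) ℂ} {i : Fin m}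
    (hG : (G - Matrix.vecMulVec (fun _ => 1) ((toC C).row i)) * toC A = Matrix.diagonal lam * G)
    (hβ : β ᵥ* G = (toC C).row i ᵥ* toC A) :
    IsL2Bounded Pr fun k ω => localOutput lam β (fun t => y t ω) k i := by
  have herr : ∀ r, IsL2Bounded Pr fun k ω =>
      localError lam β G (fun t => x t ω) (fun t => y t ω) i k r := by
    intro r
    refine IsL2Bounded.of_stable_recursion (hlam r) ?_ ((isL2Bounded_measurementNoise hN i).sub
      (IsL2Bounded.mulVec G hN.isL2Bounded_w r))
      fun k ω => localError_succ (fun k => hP.succ k ω) (fun k => hP.meas k ω) hG k r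
    have h0 : ∀ j, MemLp (fun ω => (x 0 ω j : ℂ)) 2 Pr := fun j =>
      (hN.memLp (hP.state_mem 0 j)).ofReal
    have h1 : MemLp (fun ω => ∑ j, G r j * (x 0 ω j : ℂ)) 2 Pr :=
      memLp_finsetSum _ fun j _ => (h0 j).const_mul _
    have h2 : MemLp (fun ω => -∑ j, G r j * (x 0 ω j : ℂ)) 2 Pr := h1.neg
    simpa [localError, localFilter, mulVec, dotProduct] using h2
  have h : (fun k ω => localOutput lam β (fun t => y t ω) k i)
      = fun k ω => (((C *ᵥ w k ω) i + v (k + 1) ω i : ℝ) : ℂ)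
        - β ⬝ᵥ localError lam β G (fun t => x t ω) (fun t => y t ω) i k := by
    ext k ω
    exact localOutput_eq_localError (fun k => hP.succ k ω) (fun k => hP.meas k ω) hβ k
  rw [h]
  refine (isL2Bounded_measurementNoise hN i).sub ?_
  simp only [dotProduct]
  exact IsL2Bounded.sum _ fun r => (herr r).const_mul _

lemma isL2Bounded_deviation {S : Matrix (Fin n) (Fin n) ℂ} {B : Matrix (Fin n) (Fin 1) ℂ}
    {Γ : Matrix (Fin 1) (Fin n) ℂ} {a : Matrix (Fin m) (Fin m) ℝ} {c₀ c₁ ϱ ρ c : ℝ} {i : Fin m}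
    (hρ : 0 ≤ ρ) (hρ' : ρ < 1) (hc : 0 ≤ c)
    (hle : ∀ (z : ℕ → Fin m → ℂ) (k : ℕ),
      sqNorm ((synchronize S B Γ a c₀ c₁ ϱ z k).eta i - etaBar (synchronize S B Γ a c₀ c₁ ϱ z k))
        ≤ geomFilter ρ c (fun k => ∑ b, ‖z k b‖ ^ 2) k)
    {z : Ω → ℕ → Fin m → ℂ} (hz : ∀ k b, Measurable fun ω => z ω k b)
    (hz' : ∀ b, IsL2Bounded Pr fun k ω => z ω k b) (p : Fin m × Fin n) :
    IsL2Bounded Pr fun k ω => ((synchronize S B Γ a c₀ c₁ ϱ (z ω) k).eta i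
      - etaBar (synchronize S B Γ a c₀ c₁ ϱ (z ω) k)) p := by
  have hint : ∀ k b, Integrable (fun ω => ‖z ω k b‖ ^ 2) Pr := fun k b =>
    (memLp_two_iff_integrable_sq_norm ((hz' b).memLp k).1).1 ((hz' b).memLp k)
  choose M hM using fun b => (hz' b).exists_integral_le
  obtain ⟨M', hM'⟩ := exists_integral_geomFilter_le hρ hρ' hc (M := ∑ b, M b) (Pr := Pr)
    (g := fun ω k => ∑ b, ‖z ω k b‖ ^ 2) (fun k => integrable_finsetSum _ fun b _ => hint k b)
    (fun k => by
      rw [integral_finsetSum _ fun b _ => hint k b]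
      exact Finset.sum_le_sum fun b _ => hM b k)
  have hmeas : ∀ k, Measurable fun ω => ((synchronize S B Γ a c₀ c₁ ϱ (z ω) k).eta i
      - etaBar (synchronize S B Γ a c₀ c₁ ϱ (z ω) k)) p := fun k =>
    (measurable_pi_apply p).comp (measurable_deviation S B Γ a c₀ c₁ ϱ (fun j _ b => hz j b) i)
  have hpt : ∀ k ω, ‖((synchronize S B Γ a c₀ c₁ ϱ (z ω) k).eta i
      - etaBar (synchronize S B Γ a c₀ c₁ ϱ (z ω) k)) p‖ ^ 2
      ≤ geomFilter ρ c (fun k => ∑ b, ‖z ω k b‖ ^ 2) k := fun k ω =>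
    (norm_sq_le_sqNorm _ p).trans (hle (z ω) k)
  have hsq : ∀ k, Integrable (fun ω => ‖((synchronize S B Γ a c₀ c₁ ϱ (z ω) k).eta i
      - etaBar (synchronize S B Γ a c₀ c₁ ϱ (z ω) k)) p‖ ^ 2) Pr := fun k =>
    (hM' k).1.mono' ((hmeas k).norm.pow_const 2).aestronglyMeasurable
      (Eventually.of_forall fun ω => by
        rw [Real.norm_of_nonneg (by positivity)]; exact hpt k ω)
  exact IsL2Bounded.of_integral_le
    (fun k => (memLp_two_iff_integrable_sq_norm (hmeas k).aestronglyMeasurable).2 (hsq k))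
    fun k => (integral_mono (hsq k) (hM' k).1 (hpt k)).trans (hM' k).2

lemma isL2Bounded_optimal_error (hN : IsGaussianNoise Pr Sig0 Q R x₀ w v)
    (hP : IsLinearPlant A C x₀ w v x y)
    (hinv : ∀ k, IsUnit (innovationCov C R (predictionCov A C Q R Sig0 k)).det)
    (hlim : Tendsto (predictionCov A C Q R Sig0) atTop (𝓝 P))
    (hPinv : IsUnit (innovationCov C R P).det) (i : Fin n) :
    IsL2Bounded Pr fun k ω => ((optimalEstimate A C Q R Sig0 y k ω - x k ω) i : ℂ) := by
  have h1 : Tendsto (fun k => estimationCov A C Q R Sig0 k i i) atTop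
      (𝓝 (filteredCov C R P i i)) :=
    ((tendsto_estimationCov hlim hPinv).apply_nhds i).apply_nhds i
  obtain ⟨M, hM⟩ := h1.bddAbove_range
  refine hN.isL2Bounded_of_crossCov_le (M := M)
    (X := fun k ω => optimalEstimate A C Q R Sig0 y k ω - x k ω)
    (fun k => span_pastNoise_le k (hP.error_mem k i)) fun k => ?_
  rw [crossCov_optimal_error hN hP hinv]
  exact hM ⟨k, rfl⟩

/-- In the coordinates `V⁻¹` the difference of the two filters solves scalar recursions with stable
poles `λ_r`. Their inputs are bounded innovations with coefficients from `K - L_k`, which tend to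
zero. -/
lemma isL2Null_kalman_sub_optimal (hN : IsGaussianNoise Pr Sig0 Q R x₀ w v)
    (hP : IsLinearPlant A C x₀ w v x y)
    (hinv : ∀ k, IsUnit (innovationCov C R (predictionCov A C Q R Sig0 k)).det)
    (hlim : Tendsto (predictionCov A C Q R Sig0) atTop (𝓝 P))
    (hPinv : IsUnit (innovationCov C R P).det) (hK : K = kalmanGain C R P)
    {V : Matrix (Fin n) (Fin n) ℂ} {lam : Fin n → ℂ} (hV : IsUnit V.det)
    (hdiag : toC (A - K * C * A) = V * Matrix.diagonal lam * V⁻¹) (hlam : ∀ r, ‖lam r‖ < 1)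
    (i : Fin n) :
    IsL2Null Pr fun k ω =>
      ((gainEstimate A C (fun _ => K) y k ω - optimalEstimate A C Q R Sig0 y k ω) i : ℂ) := by
  set Lk := fun k => kalmanGain C R (predictionCov A C Q R Sig0 k) with hL
  set d : ℕ → Ω → Fin n → ℂ := fun k ω r =>
    ((gainEstimate A C (fun _ => K) y k ω - optimalEstimate A C Q R Sig0 y k ω) r : ℂ) with hd
  set ν : ℕ → Ω → Fin m → ℝ := fun k ω =>
    y (k + 1) ω - (C * A) *ᵥ optimalEstimate A C Q R Sig0 y k ω with hν
  have hνb : ∀ b, IsL2Bounded Pr fun k ω => (ν k ω b : ℂ) := by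
    intro b
    have h1 := (isL2Bounded_measurementNoise (C := C) hN b).sub
      (isL2Bounded_mulVec_ofReal (C * A) (isL2Bounded_optimal_error hN hP hinv hlim hPinv) b)
    simp only [optimalEstimate] at h1
    simp only [hν, optimalEstimate, hP.innovation_eq]
    simpa using h1
  have hrec : ∀ k ω, d (k + 1) ω
      = toC (A - K * C * A) *ᵥ d k ω + toC (K - Lk k) *ᵥ fun b => (ν k ω b : ℂ) := by
    intro k ω
    simp only [hd]
    rw [toC_mulVec_ofReal, toC_mulVec_ofReal]
    ext r
    simp only [optimalEstimate, gainEstimate_sub_gainEstimate_succ, hν, Pi.add_apply,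
      Complex.ofReal_add, hL]
  have hV' : V⁻¹ * V = 1 := nonsing_inv_mul V hV
  have hV'' : V * V⁻¹ = 1 := mul_nonsing_inv V hV
  have hrec' : ∀ r k ω, (V⁻¹ *ᵥ d (k + 1) ω) r = lam r * (V⁻¹ *ᵥ d k ω) r
      + ∑ b, (V⁻¹ * toC (K - Lk k)) r b * (ν k ω b : ℂ) := by
    intro r k ω
    rw [hrec, hdiag, mulVec_add, mulVec_mulVec, mulVec_mulVec, Matrix.mul_assoc V,
      ← Matrix.mul_assoc V⁻¹, hV', Matrix.one_mul, ← mulVec_mulVec, Pi.add_apply, mulVec_diagonal]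
    rfl
  have hcoef : ∀ r b, Tendsto (fun k => (V⁻¹ * toC (K - Lk k)) r b) atTop (𝓝 0) := by
    intro r b
    have h1 : Tendsto (fun k => K - Lk k) atTop (𝓝 0) := by
      have := (tendsto_kalmanGain hlim hPinv).const_sub K
      rwa [← hK, sub_self] at this
    have hc : Continuous fun M : Matrix (Fin n) (Fin m) ℝ => (V⁻¹ * toC M) r b := by
      simp only [mul_apply, toC, map_apply]
      fun_prop
    simpa [toC, Function.comp_def] using (hc.tendsto 0).comp h1
  have hnull : ∀ r, IsL2Null Pr fun k ω => (V⁻¹ *ᵥ d k ω) r := fun r =>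
    IsL2Null.of_stable_recursion (hlam r)
      (by simp [hd, optimalEstimate, gainEstimate, mulVec, dotProduct])
      (IsL2Null.sum _ fun b => IsL2Null.of_tendsto_mul (hcoef r b) (hνb b)) (hrec' r)
  have hback : (fun k ω => d k ω i) = fun k ω => ∑ r, V i r * (V⁻¹ *ᵥ d k ω) r := by
    ext k ω
    have : d k ω = V *ᵥ (V⁻¹ *ᵥ d k ω) := by rw [mulVec_mulVec, hV'', one_mulVec]
    exact congrFun this i
  change IsL2Null Pr fun k ω => d k ω i
  rw [hback]
  exact IsL2Null.sum _ fun r => (hnull r).const_mul _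

end EstimationErrors

/-! ### Covariance bounds for the decomposed error. -/

section CovarianceBounds

lemma quadRe_const_smul {ι : Type*} [Fintype ι] (c : ℝ) (M : Matrix ι ι ℂ) (u : ι → ℂ) :
    quadRe ((c : ℂ) • M) u = c * quadRe M u := by
  rw [quadRe, smul_mulVec, dotProduct_smul, smul_eq_mul, Complex.re_ofReal_mul, quadRe]

lemma quadRe_one {ι : Type*} [Fintype ι] [DecidableEq ι] (u : ι → ℂ) :
    quadRe 1 u = sqNorm u := by
  rw [quadRe, one_mulVec, star_dotProduct_self, Complex.ofReal_re]

lemma quadRe_le_mul_sqNorm {ι : Type*} [Fintype ι] (M : Matrix ι ι ℂ) (u : ι → ℂ) :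
    quadRe M u ≤ (∑ i, ∑ j, ‖M i j‖) * sqNorm u :=
  (Complex.re_le_norm _).trans (norm_quadForm_le M u)

variable {Ω ι κ : Type*} [MeasurableSpace Ω] {Pr : Measure Ω} [Fintype ι] [Fintype κ]

lemma covMat_ofReal {ι : Type*} (X : Ω → ι → ℝ) :
    covMat Pr (fun ω i => (X ω i : ℂ)) = toC (crossCov Pr X X) := by
  ext i j
  simp only [covMat, of_apply, toC, map_apply, crossCov, covariance]
  rw [← integral_complex_ofReal (μ := Pr)]
  simp [integral_complex_ofReal]

lemma star_dotProduct_mulVec_eq (F : Matrix ι κ ℂ) (u : ι → ℂ) (X : κ → ℂ) :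
    star u ⬝ᵥ F *ᵥ X = star (Fᴴ *ᵥ u) ⬝ᵥ X := by
  rw [star_mulVec, conjTranspose_conjTranspose, dotProduct_mulVec]

lemma IsSquareIntegrable.mulVec {ι : Type*} (F : Matrix ι κ ℂ) {X : Ω → κ → ℂ}
    (hX : IsSquareIntegrable Pr X) : IsSquareIntegrable Pr fun ω => F *ᵥ X ω := by
  intro i
  simp only [Matrix.mulVec, dotProduct]
  exact memLp_finsetSum _ fun j _ => (hX j).const_mul _

variable [IsProbabilityMeasure Pr]

/-- The variances of `F X + D + E`, where `cov X ≤ Ξ`, `D` is small and `E` is independent of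
`F X + D`. -/
lemma cvar_mulVec_add_add_le {F : Matrix ι κ ℂ} {Ξ : Matrix κ κ ℂ} {X : Ω → κ → ℂ}
    {D E : Ω → ι → ℂ} (hX : CovLE Pr X Ξ) (hD : IsSquareIntegrable Pr D)
    (hE : IsSquareIntegrable Pr E) (u : ι → ℂ)
    (hind : IndepFun (fun ω => star u ⬝ᵥ (F *ᵥ X ω + D ω)) (fun ω => star u ⬝ᵥ E ω) Pr) {t : ℝ}
    (ht : Real.sqrt (cvar Pr fun ω => star u ⬝ᵥ D ω) ≤ t * Real.sqrt (sqNorm u)) :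
    cvar Pr (fun ω => star u ⬝ᵥ (F *ᵥ X ω + D ω + E ω))
      ≤ (Real.sqrt (quadRe (F * Ξ * Fᴴ) u) + t * Real.sqrt (sqNorm u)) ^ 2
        + quadRe (covMat Pr E) u := by
  have hFX := hX.1.mulVec F
  have h1 : cvar Pr (fun ω => star u ⬝ᵥ (F *ᵥ X ω + D ω + E ω))
      = cvar Pr (fun ω => star u ⬝ᵥ (F *ᵥ X ω + D ω)) + quadRe (covMat Pr E) u := by
    rw [quadRe_covMat hE, ← cvar_add_of_indepFun (memLp_star_dotProduct
      (X := fun ω => F *ᵥ X ω + D ω) (fun p => (hFX p).add (hD p)) u)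
      (memLp_star_dotProduct hE u) hind]
    simp only [dotProduct_add]
  rw [h1]
  gcongr
  refine (Real.sqrt_le_left ?_).1 ?_
  · exact add_nonneg (Real.sqrt_nonneg _) ((Real.sqrt_nonneg _).trans ht)
  simp only [dotProduct_add]
  refine (sqrt_cvar_add_le (memLp_star_dotProduct hFX u) (memLp_star_dotProduct hD u)).trans
    (add_le_add (Real.sqrt_le_sqrt ?_) ht)
  rw [quadRe_mul_mul_conjTranspose]
  simp only [star_dotProduct_mulVec_eq]
  exact (covLE_iff.1 hX).2.2 _

/-- Expanding the square, the excess over the limiting bound is a null sequence times `sqNorm u`,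
the same for all sensors and all directions. -/
theorem eventually_cvar_le {σ : Type*} {F : Matrix ι κ ℂ} {Ξ : Matrix κ κ ℂ}
    {X : σ → ℕ → Ω → κ → ℂ} {D E : ℕ → Ω → ι → ℂ} {M : ℕ → Matrix ι ι ℂ} {N : Matrix ι ι ℂ}
    (hX : ∀ i k, CovLE Pr (X i k) Ξ) (hD : ∀ p, IsL2Null Pr fun k ω => D k ω p)
    (hE : ∀ k, IsSquareIntegrable Pr (E k)) (hEcov : ∀ k, covMat Pr (E k) = M k)
    (hM : Tendsto M atTop (𝓝 N))
    (hind : ∀ i k u, IndepFun (fun ω => star u ⬝ᵥ (F *ᵥ X i k ω + D k ω))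
      (fun ω => star u ⬝ᵥ E k ω) Pr) {ε : ℝ} (hε : 0 < ε) :
    ∀ᶠ k in atTop, ∀ i u, cvar Pr (fun ω => star u ⬝ᵥ (F *ᵥ X i k ω + D k ω + E k ω))
      ≤ quadRe (F * Ξ * Fᴴ) u + quadRe N u + ε * sqNorm u := by
  obtain ⟨t, ht0, ht, hDt⟩ := tendsto_cvar_bound hD
  set q : ℝ := ∑ i, ∑ j, ‖(F * Ξ * Fᴴ) i j‖ with hq
  -- The three terms come from the cross term of the square, from the square of the bound on `D`,
  -- and from `cov E - N`.
  have hlim : Tendsto (fun k => 2 * (Real.sqrt q * t k) + t k ^ 2 + ∑ i, ∑ j, ‖(M k - N) i j‖)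
      atTop (𝓝 0) := by
    have hc : Continuous fun p : ℝ × Matrix ι ι ℂ =>
        2 * (Real.sqrt q * p.1) + p.1 ^ 2 + ∑ i, ∑ j, ‖(p.2 - N) i j‖ := by
      simp only [Matrix.sub_apply]
      fun_prop
    simpa [Function.comp_def] using (hc.tendsto (0, N)).comp (ht.prodMk_nhds hM)
  filter_upwards [hlim.eventually (gt_mem_nhds hε)] with k hk i u
  refine (cvar_mulVec_add_add_le (hX i k) (fun p => (hD p).1 k) (hE k) u (hind i k u)
    (hDt k u)).trans ?_
  have hs : 0 ≤ sqNorm u := sqNorm_nonneg u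
  have hs2 : Real.sqrt (sqNorm u) ^ 2 = sqNorm u := Real.sq_sqrt hs
  have hq0 : 0 ≤ q := by positivity
  have hFΞ : 0 ≤ quadRe (F * Ξ * Fᴴ) u := by
    rw [quadRe_mul_mul_conjTranspose]
    exact (integral_nonneg fun _ => by positivity).trans ((covLE_iff.1 (hX i k)).2.2 _)
  have h1 : Real.sqrt (quadRe (F * Ξ * Fᴴ) u) ≤ Real.sqrt q * Real.sqrt (sqNorm u) := by
    rw [← Real.sqrt_mul hq0]
    exact Real.sqrt_le_sqrt (quadRe_le_mul_sqNorm _ _)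
  have h2 : quadRe (covMat Pr (E k)) u
      ≤ quadRe N u + (∑ i, ∑ j, ‖(M k - N) i j‖) * sqNorm u := by
    have := quadRe_le_mul_sqNorm (M k - N) u
    rw [quadRe_sub] at this
    rw [hEcov]
    linarith
  have h3 : Real.sqrt (quadRe (F * Ξ * Fᴴ) u) * (t k * Real.sqrt (sqNorm u))
      ≤ Real.sqrt q * t k * sqNorm u := by
    calc _ ≤ Real.sqrt q * Real.sqrt (sqNorm u) * (t k * Real.sqrt (sqNorm u)) :=
          mul_le_mul_of_nonneg_right h1 (mul_nonneg (ht0 k) (Real.sqrt_nonneg _))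
      _ = Real.sqrt q * t k * Real.sqrt (sqNorm u) ^ 2 := by ring
      _ = _ := by rw [hs2]
  have h4 : (t k * Real.sqrt (sqNorm u)) ^ 2 = t k ^ 2 * sqNorm u := by rw [mul_pow, hs2]
  have h5 := Real.sq_sqrt hFΞ
  have h6 := mul_le_mul_of_nonneg_right hk.le hs
  rw [add_sq, h4, h5]
  nlinarith

/-- With a right inverse of `F`, `sqNorm u` is at most a constant times `sqNorm (Fᴴ *ᵥ u)`. A large
multiple of the identity thus bounds `X` and, through `F`, also every `Y`. -/
theorem exists_uniform_covLE {σ : Type*} [Fintype σ] [DecidableEq ι] [DecidableEq κ]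
    {F : Matrix ι κ ℂ} {G : Matrix κ ι ℂ}
    (hFG : F * G = 1) {N : Matrix ι ι ℂ} (hN : N.PosSemidef) {c : ℝ} (hc : 1 ≤ c)
    {X : σ → ℕ → Ω → κ → ℂ} {Y : σ → ℕ → Ω → ι → ℂ}
    (hX : ∀ i p, IsL2Bounded Pr fun k ω => X i k ω p)
    (hY : ∀ i p, IsL2Bounded Pr fun k ω => Y i k ω p) :
    ∃ Ξ : Matrix κ κ ℂ, ∀ i k, CovLE Pr (X i k) Ξ ∧
      CovLE Pr (Y i k) ((c : ℂ) • (F * Ξ * Fᴴ) + N) := by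
  choose M₁ hM₁ h1 using fun i => exists_cvar_le (hX i)
  choose M₂ hM₂ h2 using fun i => exists_cvar_le (hY i)
  set g : ℝ := ∑ k, sqNorm (Gᴴ k) with hg
  have hg0 : 0 ≤ g := Finset.sum_nonneg fun _ _ => sqNorm_nonneg _
  have hG : ∀ u, sqNorm u ≤ g * sqNorm (Fᴴ *ᵥ u) := by
    intro u
    have h3 : Gᴴ *ᵥ (Fᴴ *ᵥ u) = u := by
      rw [mulVec_mulVec, ← conjTranspose_mul, hFG, conjTranspose_one, one_mulVec]
    simpa only [h3] using sqNorm_mulVec_le Gᴴ (Fᴴ *ᵥ u)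
  -- The first sum bounds all `X i`; the second, weighted by the norm of the right inverse, bounds
  -- all `Y i`.
  set ξ : ℝ := ∑ i, M₁ i + (∑ i, M₂ i) * g with hξ
  have hs1 : ∀ i, M₁ i ≤ ∑ i, M₁ i := fun i =>
    Finset.single_le_sum (fun i _ => hM₁ i) (Finset.mem_univ i)
  have hs2 : ∀ i, M₂ i ≤ ∑ i, M₂ i := fun i =>
    Finset.single_le_sum (fun i _ => hM₂ i) (Finset.mem_univ i)
  have hp1 : 0 ≤ ∑ i, M₁ i := Finset.sum_nonneg fun i _ => hM₁ i
  have hp2 : 0 ≤ ∑ i, M₂ i := Finset.sum_nonneg fun i _ => hM₂ i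
  have hξ0 : 0 ≤ ξ := add_nonneg hp1 (mul_nonneg hp2 hg0)
  have hherm : ((ξ : ℂ) • (1 : Matrix κ κ ℂ)).IsHermitian := by
    rw [IsHermitian, conjTranspose_smul, conjTranspose_one]; simp
  refine ⟨(ξ : ℂ) • 1, fun i k => ⟨covLE_iff.2 ⟨fun p => (hX i p).memLp k, hherm, fun u => ?_⟩,
    covLE_iff.2 ⟨fun p => (hY i p).memLp k, ?_, fun u => ?_⟩⟩⟩
  · rw [quadRe_const_smul, quadRe_one]
    refine (h1 i k u).trans (mul_le_mul_of_nonneg_right ?_ (sqNorm_nonneg u))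
    linarith [hs1 i, mul_nonneg hp2 hg0]
  · refine IsHermitian.add ?_ hN.1
    rw [IsHermitian, conjTranspose_smul, (isHermitian_mul_mul_conjTranspose F hherm).eq]
    simp
  · rw [quadRe_add, quadRe_const_smul, quadRe_mul_mul_conjTranspose, quadRe_const_smul, quadRe_one]
    have hn := quadRe_nonneg hN u
    have hF0 := sqNorm_nonneg (Fᴴ *ᵥ u)
    have h3 : M₂ i * sqNorm u ≤ (∑ i, M₂ i) * (g * sqNorm (Fᴴ *ᵥ u)) :=
      mul_le_mul (hs2 i) (hG u) (sqNorm_nonneg u) hp2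
    have h4 : (∑ i, M₂ i) * (g * sqNorm (Fᴴ *ᵥ u)) ≤ ξ * sqNorm (Fᴴ *ᵥ u) := by
      rw [← mul_assoc]
      exact mul_le_mul_of_nonneg_right (by linarith) hF0
    have h5 : ξ * sqNorm (Fᴴ *ᵥ u) ≤ c * (ξ * sqNorm (Fᴴ *ᵥ u)) :=
      le_mul_of_one_le_left (mul_nonneg hξ0 hF0) hc
    linarith [h2 i k u]

end CovarianceBounds

/-! ### Independence of the deviations from the optimal error. -/

section Independence

variable {Ω : Type*} {n m : ℕ}

lemma measurable_comap_measurements (y : ℕ → Ω → Fin m → ℝ) {j k : ℕ} (hj : 1 ≤ j) (hk : j ≤ k) :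
    Measurable[MeasurableSpace.comap (fun ω (p : Fin k × Fin m) => y (p.1 + 1) ω p.2)
      inferInstance] (y j) := by
  refine (@measurable_pi_iff _ _ _ (_) _ _).2 fun i => ?_
  have h := (measurable_pi_apply (X := fun _ : Fin k × Fin m => ℝ)
    (⟨j - 1, by omega⟩, i)).comp (comap_measurable fun ω (p : Fin k × Fin m) => y (p.1 + 1) ω p.2)
  simpa [Function.comp_def, Nat.sub_add_cancel hj] using h

lemma indepFun_of_measurable_comap [MeasurableSpace Ω] {Pr : Measure Ω} {α β γ : Type*}
    [MeasurableSpace α] [MeasurableSpace β] [MeasurableSpace γ] {Y : Ω → α} {E : Ω → β} {f : Ω → γ}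
    (h : IndepFun Y E Pr) (hf : Measurable[MeasurableSpace.comap Y inferInstance] f) :
    IndepFun f E Pr := by
  rw [IndepFun_iff_Indep] at h ⊢
  exact indep_of_indep_of_le_left h hf.comap_le

lemma measurable_star_dotProduct {ι : Type*} [Fintype ι] (u : ι → ℂ) :
    Measurable fun X : ι → ℂ => star u ⬝ᵥ X :=
  (Continuous.dotProduct continuous_const continuous_id).measurable

lemma measurable_ofReal_comp {ι : Type*} [MeasurableSpace Ω] {X : Ω → ι → ℝ} (hX : Measurable X) :
    Measurable fun ω i => (X ω i : ℂ) :=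
  measurable_pi_iff.2 fun i => Complex.measurable_ofReal.comp ((measurable_pi_apply i).comp hX)

/-- Everything that the sensors compute from the measurements up to time `k` is independent of the
error of the optimal estimate. -/
lemma indepFun_deviation_optimal_error [MeasurableSpace Ω] {Pr : Measure Ω}
    [IsProbabilityMeasure Pr] {A : Matrix (Fin n) (Fin n) ℝ} {C : Matrix (Fin m) (Fin n) ℝ}
    {Sig0 Q : Matrix (Fin n) (Fin n) ℝ} {R : Matrix (Fin m) (Fin m) ℝ}
    {x₀ : Ω → Fin n → ℝ} {w : ℕ → Ω → Fin n → ℝ} {v : ℕ → Ω → Fin m → ℝ}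
    {x : ℕ → Ω → Fin n → ℝ} {y : ℕ → Ω → Fin m → ℝ} (hN : IsGaussianNoise Pr Sig0 Q R x₀ w v)
    (hP : IsLinearPlant A C x₀ w v x y)
    (hinv : ∀ k, IsUnit (innovationCov C R (predictionCov A C Q R Sig0 k)).det)
    (K : ℕ → Matrix (Fin n) (Fin m) ℝ)
    (lam β : Fin n → ℂ) (S : Matrix (Fin n) (Fin n) ℂ) (B : Matrix (Fin n) (Fin 1) ℂ)
    (Γ : Matrix (Fin 1) (Fin n) ℂ) (a : Matrix (Fin m) (Fin m) ℝ) (c₀ c₁ ϱ : ℝ)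
    (F : Matrix (Fin n) (Fin m × Fin n) ℂ) (i : Fin m) (k : ℕ) (u : Fin n → ℂ) :
    IndepFun (fun ω => star u ⬝ᵥ
        ((F *ᵥ ((synchronize S B Γ a c₀ c₁ ϱ (localOutput lam β fun t => y t ω) k).eta i
          - etaBar (synchronize S B Γ a c₀ c₁ ϱ (localOutput lam β fun t => y t ω) k)))
        + fun r => ((gainEstimate A C K y k ω - optimalEstimate A C Q R Sig0 y k ω) r : ℂ)))
      (fun ω => star u ⬝ᵥ fun r => ((optimalEstimate A C Q R Sig0 y k ω - x k ω) r : ℂ)) Pr := by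
  refine IndepFun.comp (φ := id) (ψ := fun X : Fin n → ℝ => star u ⬝ᵥ fun r => (X r : ℂ))
    (indepFun_of_measurable_comap (indepFun_optimal_error hN hP hinv k).symm ?_) measurable_id
    ((measurable_star_dotProduct u).comp (measurable_ofReal_comp measurable_id))
  -- From here measurability refers to the σ-algebra generated by `y_1, …, y_k`.
  have hy := fun j (h1 : 1 ≤ j) (h2 : j ≤ k) => measurable_comap_measurements y h1 h2
  generalize MeasurableSpace.comap (fun ω (p : Fin k × Fin m) => y (p.1 + 1) ω p.2) _ = 𝓖 at hy
  refine (measurable_star_dotProduct u).comp (Measurable.add (measurable_mulVec F ?_)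
    (measurable_ofReal_comp (Measurable.sub ?_ ?_)))
  · exact measurable_deviation S B Γ a c₀ c₁ ϱ
      (fun j hj b => measurable_localOutput lam β hy b hj) i
  · exact measurable_gainEstimate hy le_rfl
  · exact measurable_gainEstimate hy le_rfl

end Independence

/-! ### Assembly of the theorem. -/

lemma matrixMahler_nonneg {n : ℕ} (S : Matrix (Fin n) (Fin n) ℂ) : 0 ≤ matrixMahler S := by
  refine Multiset.prod_nonneg fun x hx => ?_
  obtain ⟨μ, -, rfl⟩ := Multiset.mem_map.1 hx
  positivity

theorem theorem2
    {n m : ℕ} (hm : 2 ≤ m)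
    {Ω : Type*} [MeasurableSpace Ω] (Pr : Measure Ω) [IsProbabilityMeasure Pr]
    -- the plant, the sensors and the noises
    (A : Matrix (Fin n) (Fin n) ℝ) (C : Matrix (Fin m) (Fin n) ℝ)
    (Q : Matrix (Fin n) (Fin n) ℝ) (R : Matrix (Fin m) (Fin m) ℝ)
    (Sig0 : Matrix (Fin n) (Fin n) ℝ)
    (hQ : Q.PosSemidef) (hR : R.PosSemidef) (hSig0 : Sig0.PosSemidef)
    (x₀ : Ω → EuclideanSpace ℝ (Fin n)) (w : ℕ → Ω → EuclideanSpace ℝ (Fin n))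
    (v : ℕ → Ω → EuclideanSpace ℝ (Fin m))
    (hx₀_meas : Measurable x₀) (hw_meas : ∀ k, Measurable (w k)) (hv_meas : ∀ k, Measurable (v k))
    (hx₀_law : HasLaw x₀ (multivariateGaussian 0 Sig0) Pr)
    (hw_law : ∀ k, HasLaw (w k) (multivariateGaussian 0 Q) Pr)
    (hv_law : ∀ k, HasLaw (v k) (multivariateGaussian 0 R) Pr)
    (hw_indep : iIndepFun w Pr) (hv_indep : iIndepFun v Pr)
    (hx₀w_indep : IndepFun x₀ (fun ω k => w k ω) Pr)
    (hv_indep_x₀w : IndepFun (fun ω k => v k ω) (fun ω => (x₀ ω, fun k => w k ω)) Pr)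
    (hobs : IsObservable A C)
    -- the steady-state Kalman gain
    (P : Matrix (Fin n) (Fin n) ℝ) (K : Matrix (Fin n) (Fin m) ℝ)
    (hinv : ∀ k, IsUnit (innovationCov C R (predictionCov A C Q R Sig0 k)).det)
    (hP : Tendsto (predictionCov A C Q R Sig0) atTop (𝓝 P))
    (hPinv : IsUnit (innovationCov C R P).det)
    (hK : K = kalmanGain C R P)
    (hstable : R.PosDef ∨ IsSchurStable (A - K * C * A))
    -- the spectrum of `A - K C A`, and its diagonalization
    (hdistinct : (toC (A - K * C * A)).charpoly.roots.Nodup)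
    (hdisjoint : Disjoint (toC (A - K * C * A)).charpoly.roots (toC A).charpoly.roots)
    (V : Matrix (Fin n) (Fin n) ℂ) (lam : Fin n → ℂ) (hV : IsUnit V.det)
    (hdiag : toC (A - K * C * A) = V * Matrix.diagonal lam * V⁻¹)
    -- the local filters
    (β : Fin n → ℂ) (G : Fin m → Matrix (Fin n) (Fin n) ℂ)
    (hG : ∀ i, (G i - Matrix.vecMulVec (fun _ => 1) ((toC C).row i)) * toC A
      = Matrix.diagonal lam * G i)
    (hβ : ∀ i, β ᵥ* G i = (toC C).row i ᵥ* toC A)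
    (S : Matrix (Fin n) (Fin n) ℂ) (hS : S = filterMatrix lam β)
    -- the communication network
    (a : Matrix (Fin m) (Fin m) ℝ) (ha : IsConnectedNetwork a)
    (μ : Fin m → ℝ) (hμ : IsOrderedSpectrum (weightedLaplacian a) μ)
    (μ₂ μₘ : ℝ) (hμ₂ : μ₂ = μ ⟨1, by omega⟩) (hμₘ : μₘ = μ ⟨m - 1, by omega⟩)
    -- the gain and the triggering thresholds
    (B : Matrix (Fin n) (Fin 1) ℂ) (hB : IsControllable S B)
    (hMahler : matrixMahler S * (1 - μ₂ / μₘ) < 1 + μ₂ / μₘ)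
    (ζ : ℝ) (hζ : matrixMahler S < ζ⁻¹) (hζ' : ζ⁻¹ * (1 - μ₂ / μₘ) ≤ 1 + μ₂ / μₘ)
    (PP : Matrix (Fin n) (Fin n) ℂ) (hPP : SolvesRiccatiInequality ζ S B PP)
    (Γ : Matrix (Fin 1) (Fin n) ℂ) (hΓ : Γ = syncGain μ₂ μₘ S B PP)
    (c₀ c₁ ϱ : ℝ) (hc₀ : 0 < c₀) (hc₁ : 0 < c₁) (hϱ : 0 < ϱ) (hϱ' : ϱ < 1)
    (F : Matrix (Fin n) (Fin m × Fin n) ℂ) (hF : F = fusionMatrix V K)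
    -- the trajectories
    (x : ℕ → Ω → Fin n → ℝ) (hx : ∀ k ω, x k ω = plantState A (x₀ ω) (fun t => w t ω) k)
    (y : ℕ → Ω → Fin m → ℝ)
    (hy : ∀ k ω, y k ω = measurement C (fun t => x t ω) (fun t => v t ω) k)
    (xhat : ℕ → Ω → Fin n → ℝ)
    (hxhat : ∀ k ω, xhat k ω = kalmanEstimate A C K (fun t => y t ω) k)
    (s : ℕ → Ω → SyncState m n)
    (hs : ∀ k ω, s k ω
      = synchronize S B Γ a c₀ c₁ ϱ (localOutput lam β fun t => y t ω) k)
    -- the deviations from the average state and the estimation errors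
    (δ : Fin m → ℕ → Ω → Fin m × Fin n → ℂ)
    (hδ : ∀ i k ω, δ i k ω = (s k ω).eta i - etaBar (s k ω))
    (e : Fin m → ℕ → Ω → Fin n → ℂ)
    (he : ∀ i k ω, e i k ω
      = localEstimate F (s k ω) i - fun r => ((x k ω r : ℝ) : ℂ)) :
    -- (1) the average of the local estimates is the Kalman estimate
    (∀ k ω, (1 / (m : ℂ)) • ∑ i, localEstimate F (s k ω) i = fun r => ((xhat k ω r : ℝ) : ℂ)) ∧
    -- (2a) one bound for all sensors and all times
    (∃ Ξ : Matrix (Fin m × Fin n) (Fin m × Fin n) ℂ, ∀ i k, CovLE Pr (δ i k) Ξ ∧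
      CovLE Pr (e i k) ((m : ℂ) ^ 2 • (F * Ξ * Fᴴ) + toC (filteredCov C R P))) ∧
    -- the filtering covariance in (2a) is at most `P`
    (P - filteredCov C R P).PosSemidef ∧
    -- (2b) the bound with an arbitrary `Ξ` that bounds the deviations
    (∀ Ξ : Matrix (Fin m × Fin n) (Fin m × Fin n) ℂ, (∀ i k, CovLE Pr (δ i k) Ξ) →
      -- asymptotically
      (∀ ε : ℝ, 0 < ε → ∀ᶠ k in atTop, ∀ i, CovLE Pr (e i k)
        ((m : ℂ) ^ 2 • (F * Ξ * Fᴴ) + toC (filteredCov C R P) + (ε : ℂ) • 1)) ∧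
      -- at all times, if the Kalman filter starts in its steady state
      (Sig0 = filteredCov C R P → ∀ i k, CovLE Pr (e i k)
        ((m : ℂ) ^ 2 • (F * Ξ * Fᴴ) + toC (filteredCov C R P)))) := by
  subst hS hF
  have hN := isGaussianNoise hQ hR hSig0 hx₀_meas hw_meas hv_meas hx₀_law hw_law hv_law hw_indep
    hv_indep hx₀w_indep hv_indep_x₀w
  have hplant : IsLinearPlant A C (fun ω i => x₀ ω i) (fun k ω i => w k ω i) (fun k ω i => v k ω i)
      x y := by
    refine ⟨?_, fun k ω => ?_, fun k ω => ?_⟩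
    · ext1 ω; rw [hx]; rfl
    · rw [hx, hx]; rfl
    · rw [hy]; rfl
  have hPsd := posSemidef_of_tendsto (predictionCov_posSemidef hQ hR hSig0 hinv) hP
  have hfix := riccati_fixed_point hP hPinv
  have hlam := norm_eigenvalue_lt_one hQ hR hPsd hfix hPinv hK hstable hdisjoint hV hdiag
  obtain ⟨G', hG'⟩ := exists_fusionMatrix_mul_eq_one hV hdisjoint hdiag
  -- The Mahler measure is nonnegative, so its strict upper bound `ζ⁻¹` is positive.
  have hζ0 : 0 < ζ := inv_pos.1 ((matrixMahler_nonneg _).trans_lt hζ)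
  obtain ⟨ρ, c, hρ, hρ', hc, hle⟩ := exists_sqNorm_deviation_le hm ha hμ hμ₂ hμₘ rfl rfl hζ0 hζ' hPP
    hΓ hc₀ hc₁ hϱ hϱ'
  have hm0 : (m : ℂ) ≠ 0 := by
    rw [Nat.cast_ne_zero]; omega
  -- the average of the local states
  have hsum : ∀ k ω, fusionMatrix V K *ᵥ ∑ i, (s k ω).eta i = fun r => ((xhat k ω r : ℝ) : ℂ) := by
    intro k ω
    rw [hxhat, ← kalmanEstimate_eq_fusion hV hdiag β]
    congr 1
    ext ⟨b, r⟩
    rw [hs, Finset.sum_apply, sum_eta_eq_localFilter ha.2.1]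
  have hbar : ∀ k ω, ((m : ℂ) • fusionMatrix V K) *ᵥ etaBar (s k ω)
      = fun r => ((xhat k ω r : ℝ) : ℂ) := by
    intro k ω
    rw [← hsum, etaBar, smul_mulVec, mulVec_smul, smul_smul, mul_one_div_cancel hm0, one_smul]
  have havg : ∀ k ω, (1 / (m : ℂ)) • ∑ i, localEstimate (fusionMatrix V K) (s k ω) i
      = fun r => ((xhat k ω r : ℝ) : ℂ) := by
    intro k ω
    simp only [localEstimate]
    rw [← Finset.smul_sum, smul_smul, one_div_mul_cancel hm0, one_smul, ← hsum, mulVec_sum]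
  -- the decomposition of the local errors
  set F := (m : ℂ) • fusionMatrix V K with hF
  have hFΞ : ∀ Ξ : Matrix (Fin m × Fin n) (Fin m × Fin n) ℂ,
      (m : ℂ) ^ 2 • (fusionMatrix V K * Ξ * (fusionMatrix V K)ᴴ) = F * Ξ * Fᴴ := by
    intro Ξ
    rw [hF, conjTranspose_smul, Matrix.smul_mul, Matrix.smul_mul, Matrix.mul_smul, smul_smul,
      Complex.star_def, Complex.conj_natCast, pow_two]
  set xo := optimalEstimate A C Q R Sig0 y with hxo
  set D : ℕ → Ω → Fin n → ℂ := fun k ω r =>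
    ((gainEstimate A C (fun _ => K) y k ω - xo k ω) r : ℂ) with hD
  set E : ℕ → Ω → Fin n → ℂ := fun k ω r => ((xo k ω - x k ω) r : ℂ) with hE
  -- With `F` now containing the factor `m`, `F η̄` is the Kalman estimate; adding and subtracting
  -- the optimal estimate gives the three terms.
  have hdecomp : ∀ i k, e i k = fun ω => F *ᵥ δ i k ω + D k ω + E k ω := by
    intro i k
    ext1 ω
    have h1 : xhat k ω = gainEstimate A C (fun _ => K) y k ω := by
      rw [hxhat, kalmanEstimate_eq_gainEstimate]
    rw [he, hδ, mulVec_sub, hbar, h1, localEstimate, hF, smul_mulVec]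
    ext r
    simp only [hD, hE, Pi.add_apply, Pi.sub_apply, Complex.ofReal_sub]
    ring
  -- square integrability
  have hδs : ∀ i k ω, δ i k ω
      = (synchronize (filterMatrix lam β) B Γ a c₀ c₁ ϱ (localOutput lam β fun t => y t ω) k).eta i
        - etaBar (synchronize (filterMatrix lam β) B Γ a c₀ c₁ ϱ
          (localOutput lam β fun t => y t ω) k) := fun i k ω => by rw [hδ, hs]
  have hδb : ∀ i p, IsL2Bounded Pr fun k ω => δ i k ω p := by
    intro i p
    simp only [hδs]
    refine isL2Bounded_deviation (z := fun ω => localOutput lam β fun t => y t ω) hρ hρ' hc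
      (fun z k => hle z k i) (fun k b => ?_)
      (fun b => isL2Bounded_localOutput hN hplant hlam (hG b) (hβ b)) p
    exact measurable_localOutput lam β (N := k + 1)
      (fun j _ _ => hN.measurable_measurement hplant j) b k.lt_succ_self
  have hDn : ∀ p, IsL2Null Pr fun k ω => D k ω p :=
    isL2Null_kalman_sub_optimal hN hplant hinv hP hPinv hK hV hdiag hlam
  have hEb : ∀ p, IsL2Bounded Pr fun k ω => E k ω p :=
    isL2Bounded_optimal_error hN hplant hinv hP hPinv
  have heb : ∀ i p, IsL2Bounded Pr fun k ω => e i k ω p := by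
    intro i p
    simp only [hdecomp]
    exact ((IsL2Bounded.mulVec F (hδb i) p).add (hDn p).isL2Bounded).add (hEb p)
  have hesq : ∀ i k, IsSquareIntegrable Pr (e i k) := fun i k p => (heb i p).memLp k
  have hEcov : ∀ k, covMat Pr (E k) = toC (estimationCov A C Q R Sig0 k) := by
    intro k
    rw [← crossCov_optimal_error hN hplant hinv k]
    exact covMat_ofReal _
  have hind : ∀ i k u, IndepFun (fun ω => star u ⬝ᵥ (F *ᵥ δ i k ω + D k ω))
      (fun ω => star u ⬝ᵥ E k ω) Pr := by
    intro i k u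
    simp only [hδs]
    exact indepFun_deviation_optimal_error hN hplant hinv _ lam β _ B Γ a c₀ c₁ ϱ F i k u
  have hfilt : (toC (filteredCov C R P)).PosSemidef :=
    toC_posSemidef (filteredCov_posSemidef hPinv hPsd hR)
  have hherm : ∀ Ξ : Matrix (Fin m × Fin n) (Fin m × Fin n) ℂ, Ξ.IsHermitian →
      (F * Ξ * Fᴴ + toC (filteredCov C R P)).IsHermitian :=
    fun Ξ h => (isHermitian_mul_mul_conjTranspose F h).add hfilt.1
  refine ⟨havg, ?_, sub_filteredCov_posSemidef hPsd hR,
    fun Ξ hΞ => ⟨fun ε hε => ?_, fun hst i k => ?_⟩⟩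
  -- Only uniform `L²` bounds enter here: `Ξ` is taken so large that it absorbs the transient of `D`
  -- and `E`.
  · have h1 : (1 : ℝ) ≤ (m : ℝ) ^ 2 := one_le_pow₀ (by norm_cast; omega)
    simpa using exists_uniform_covLE hG' hfilt h1 hδb heb
  · have hlim : Tendsto (fun k => toC (estimationCov A C Q R Sig0 k)) atTop
        (𝓝 (toC (filteredCov C R P))) := by
      have hcont : Continuous fun M : Matrix (Fin n) (Fin n) ℝ => toC M :=
        continuous_id.matrix_map Complex.continuous_ofReal
      exact (hcont.tendsto _).comp (tendsto_estimationCov hP hPinv)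
    filter_upwards [eventually_cvar_le (F := F) hΞ hDn (fun k p => (hEb p).memLp k) hEcov hlim hind
      hε] with k hk i
    rw [hFΞ]
    refine covLE_iff.2 ⟨hesq i k, (hherm Ξ (covLE_iff.1 (hΞ i k)).2.1).add ?_, fun u => ?_⟩
    · rw [IsHermitian, conjTranspose_smul, conjTranspose_one]; simp
    · rw [quadRe_add, quadRe_add, quadRe_const_smul, quadRe_one, hdecomp]
      exact hk i u
  -- From the steady state every optimal gain equals `K`, so the two filters coincide and the bound
  -- applies with `t = 0`.
  · have hD0 : D k = fun _ => 0 := by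
      have h1 : xo = gainEstimate A C (fun _ => K) y := by
        rw [hxo, optimalEstimate]
        congr 1
        ext1 k
        rw [predictionCov_eq_of_steady hfix hst, hK]
      ext ω r
      simp [hD, h1]
    rw [hFΞ]
    refine covLE_iff.2 ⟨hesq i k, hherm Ξ (covLE_iff.1 (hΞ i k)).2.1, fun u => ?_⟩
    have h1 := cvar_mulVec_add_add_le (F := F) (t := 0) (hΞ i k) (fun p => (hDn p).1 k)
      (fun p => (hEb p).memLp k) u (hind i k u) (by simp [hD0, cvar])
    have h2 : 0 ≤ quadRe (F * Ξ * Fᴴ) u := by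
      rw [quadRe_mul_mul_conjTranspose]
      exact (integral_nonneg fun _ => by positivity).trans ((covLE_iff.1 (hΞ i k)).2.2 _)
    rw [zero_mul, add_zero, Real.sq_sqrt h2, hEcov, estimationCov_eq_of_steady hfix hst,
      ← quadRe_add] at h1
    rw [hdecomp]
    exact h1
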